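/- Let $n\ge 1$ and let $\mathcal D=\bigcup_{k\in\mathbb Z}\mathcal D_k$ be a dyadic system on $\mathbb R^n$: each $\mathcal D_k$ is a partition of $\mathbb R^n$ into half-open cubes $\prod_i[c_i,c_i+2^{-k})$, and any two cubes of $\mathcal D$ are disjoint or nested. For $Q\in\mathcal D_k$ let $\widehat Q\in\mathcal D_{k-1}$ be the cube containing $Q$ and $\mathcal D_r(Q)=\{R\in\mathcal D_{k+r}:R\subseteq Q\}$. Let $\mu$ be a Borel measure on $\mathbb R^n$ with $0<\mu(Q)<\infty$ for all $Q\in\mathcal D$, and write $\langle f\rangle_Q=\mu(Q)^{-1}\int_Q f\,d\mu$, $\langle f,g\rangle=\int fg\,d\mu$. Let $\{h_Q^j\}_{Q\in\mathcal D,\,1\le j\le 2^n-1}$ be a Haar system for $\mu$: an orthonormal family in $L^2(\mu)$ of real functions such that $h_Q^j$ is supported on $Q$, is constant on each cube of $\mathcal D_1(Q)$, and has integral $0$. Assume that $\mu$ is balanced: $$\sup_{Q\in\mathcal D}\ \sup_{R\in\mathcal D_1(Q)}\ \sup_{i,j}\Big[\|h_Q^i\|_{L^1(\mu)}\|h_R^j\|_{L^\infty(\mu)}+\|h_Q^i\|_{L^\infty(\mu)}\|h_R^j\|_{L^1(\mu)}\Big]<\infty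 .$$ For $1<q<\infty$ and $\alpha>0$ let $\Lambda_q(\alpha)$ be the set of real $f\in L^q_{\mathrm{loc}}(\mu)$ with $$\|f\|_{\Lambda_q(\alpha)}:=\sup_{Q\in\mathcal D}\frac1{\mu(Q)^{1/q+\alpha}}\Big(\int_Q|f-\langle f\rangle_{\widehat Q}|^q\,d\mu\Big)^{1/q}<\infty .$$ A Haar shift of complexity $(r,s)\in\mathbb N\times\mathbb N$ is an operator of the form $$Tf=\sum_{Q\in\mathcal D}t_Q(f),\qquad t_Q(f)=\sum_{R\in\mathcal D_r(Q)}\ \sum_{S\in\mathcal D_s(Q)}\ \sum_{i,j}\alpha^{Q,i,j}_{R,S}\,\langle f,h_R^i\rangle\,h_S^j ,$$ with real coefficients $\alpha^{Q,i,j}_{R,S}$; it is bounded on $L^2(\mu)$ if for every $f\in L^2(\mu)$ the series converges unconditionally in $L^2(\mu)$ and this defines a bounded operator $T$ on $L^2(\mu)$. For $f\in L^q_{\mathrm{loc}}(\mu)$, we say that $g\in L^q_{\mathrm{loc}}(\mu)$ represents $Tf$ if for every $P\in\mathcal D$ the series $\sum_{Q}\big(t_Q(f)-\langle t_Q(f)\rangle_P\big)$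 converges unconditionally in $L^q(P,\mu)$ to $g-\langle g\rangle_P$; up to $\mu$-null sets, this determines $g$ up to functions that are constant on each cube of $\mathcal D$, and such functions have zero $\Lambda_q(\alpha)$-seminorm. **Theorem.** Let $r,s\in\mathbb N$, $1<q<\infty$ and $\alpha>0$. There is a constant $C<\infty$, depending only on $\mathcal D$, $\mu$, $\{h_Q^j\}$, $r$, $s$, $q$, $\alpha$, such that for every Haar shift $T$ of complexity $(r,s)$ that is bounded on $L^2(\mu)$ and every $f\in\Lambda_q(\alpha)$: there is a $g\in L^q_{\mathrm{loc}}(\mu)$ that represents $Tf$; if moreover $f\in L^2(\mu)$, then the $L^2(\mu)$-function $Tf$ represents $Tf$; and every $g$ that represents $Tf$ belongs to $\Lambda_q(\alpha)$ and satisfies $$\|g\|_{\Lambda_q(\alpha)}\le C\,\|T\|_{L^2(\mu)\to L^2(\mu)}\,\|f\|_{\Lambda_q(\alpha)},$$ that is, $\|Tf\|_{\Lambda_q(\alpha)}\lesssim\|f\|_{\Lambda_q(\alpha)}$. -/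

import Mathlib

open MeasureTheory Filter Topology
open scoped ENNReal NNReal

noncomputable section

/-- Labels `(k, j) ∈ ℤ × ℤⁿ` of dyadic cubes: `k` is the generation, `j` the position. -/
abbrev CubeIndex (n : ℕ) : Type := ℤ × (Fin n → ℤ)

/-- The half-open cube with lower corner `c` and side length `2⁻ᵏ`. -/
def halfOpenCube {n : ℕ} (k : ℤ) (c : Fin n → ℝ) : Set (Fin n → ℝ) :=
  Set.pi Set.univ fun i => Set.Ico (c i) (c i + (2 : ℝ) ^ (-k))

/-- A dyadic system on `ℝⁿ`: for each `k ∈ ℤ` a family, labelled by `ℤⁿ`, of half-open cubes of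
side length `2⁻ᵏ` partitioning `ℝⁿ`, such that any two cubes of the system are disjoint or
nested. -/
structure DyadicSystem (n : ℕ) where
  /-- the lower corner of the cube labelled `(k, j)` -/
  corner : CubeIndex n → (Fin n → ℝ)
  partition : ∀ (k : ℤ) (x : Fin n → ℝ), ∃! j : Fin n → ℤ, x ∈ halfOpenCube k (corner (k, j))
  nested : ∀ Q R : CubeIndex n,
    Disjoint (halfOpenCube Q.1 (corner Q)) (halfOpenCube R.1 (corner R)) ∨
      halfOpenCube Q.1 (corner Q) ⊆ halfOpenCube R.1 (corner R) ∨
      halfOpenCube R.1 (corner R) ⊆ halfOpenCube Q.1 (corner Q)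

namespace DyadicSystem

variable {n : ℕ} (D : DyadicSystem n)

/-- The cube labelled `Q`, as a subset of `ℝⁿ`. -/
def cube (Q : CubeIndex n) : Set (Fin n → ℝ) := halfOpenCube Q.1 (D.corner Q)

/-- The (label of the) cube of generation `k` that contains the point `x`. -/
def cubeAt (k : ℤ) (x : Fin n → ℝ) : CubeIndex n := (k, (D.partition k x).choose)

/-- The dyadic parent `Q̂`: the cube of the previous generation that contains `Q`
(see `cube_subset_cube_parent`). -/
def parent (Q : CubeIndex n) : CubeIndex n := D.cubeAt (Q.1 - 1) (D.corner Q)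

theorem mem_cube_cubeAt (k : ℤ) (x : Fin n → ℝ) : x ∈ D.cube (D.cubeAt k x) :=
  (D.partition k x).choose_spec.1

theorem corner_mem_cube (Q : CubeIndex n) : D.corner Q ∈ D.cube Q := by
  intro i _
  exact ⟨le_refl _, by linarith [zpow_pos (two_pos : (0 : ℝ) < 2) (-Q.1)]⟩

theorem cube_subset_cube_parent (Q : CubeIndex n) : D.cube Q ⊆ D.cube (D.parent Q) := by
  have h1 : D.corner Q ∈ D.cube (D.parent Q) := D.mem_cube_cubeAt _ _
  have h2 := D.corner_mem_cube Q
  rcases D.nested Q (D.parent Q) with h | h | h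
  · exact absurd h1 (Set.disjoint_left.1 h h2)
  · exact h
  · intro y _ i hi
    exfalso
    have hp := zpow_pos (two_pos : (0 : ℝ) < 2) (-Q.1)
    have hk : (2 : ℝ) ^ (-(D.parent Q).1) = 2 * 2 ^ (-Q.1) := by
      have : -(D.parent Q).1 = 1 + -Q.1 := by
        change -(Q.1 - 1) = _
        ring
      rw [this, zpow_add₀ two_ne_zero, zpow_one]
    have hc : D.corner (D.parent Q) ∈ D.cube Q := h (D.corner_mem_cube _)
    have hz : (fun m => D.corner (D.parent Q) m + (2 : ℝ) ^ (-Q.1)) ∈ D.cube Q := by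
      apply h
      intro m _
      simp only [Set.mem_Ico, hk]
      constructor <;> linarith
    have e1 := (hc i hi).1
    have e2 := (hz i hi).2
    simp only at e2
    linarith

theorem measurableSet_cube (Q : CubeIndex n) : MeasurableSet (D.cube Q) :=
  MeasurableSet.univ_pi fun _ => measurableSet_Ico

theorem finite_descendants (r : ℕ) (Q : CubeIndex n) :
    {R : CubeIndex n | R.1 = Q.1 + r ∧ D.cube R ⊆ D.cube Q}.Finite := by
  set A := {R : CubeIndex n | R.1 = Q.1 + r ∧ D.cube R ⊆ D.cube Q}
  have hvol : ∀ R : CubeIndex n,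
      volume (D.cube R) = ENNReal.ofReal ((2 : ℝ) ^ (-R.1)) ^ n := by
    intro R
    simp [cube, halfOpenCube, volume_pi_pi, Real.volume_Ico]
  have hpos : 0 < ENNReal.ofReal ((2 : ℝ) ^ (-(Q.1 + r))) ^ n :=
    ENNReal.pow_pos (ENNReal.ofReal_pos.2 (zpow_pos two_pos _)) n
  have hfin := Measure.finite_const_le_meas_of_disjoint_iUnion (volume : Measure (Fin n → ℝ))
    (ι := A) (As := fun R => D.cube R.1) hpos
    (fun R => D.measurableSet_cube R.1)
    (by
      intro R S hRS
      refine Set.disjoint_left.2 fun x hxR hxS => hRS ?_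
      obtain ⟨⟨k, j⟩, hR⟩ := R
      obtain ⟨⟨k', j'⟩, hS⟩ := S
      have hkk : k = k' := hR.1.trans hS.1.symm
      subst hkk
      have := (D.partition k x).unique hxR hxS
      subst this
      rfl)
    (by
      refine ne_top_of_le_ne_top ?_ (measure_mono (t := D.cube Q) ?_)
      · rw [hvol]
        exact ENNReal.pow_ne_top ENNReal.ofReal_ne_top
      · exact Set.iUnion_subset fun R => R.2.2)
  have huniv : {R : A | ENNReal.ofReal ((2 : ℝ) ^ (-(Q.1 + r))) ^ n ≤ volume (D.cube R.1)}
      = Set.univ := by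
    ext R
    simp only [Set.mem_ofPred_eq, Set.mem_univ, iff_true, hvol]
    rw [R.2.1]
  rw [huniv] at hfin
  exact Set.finite_coe_iff.1 (Set.finite_univ_iff.1 hfin)

/-- `𝒟_r(Q)`: the cubes `R ⊆ Q` of the system with `ℓ(Q) = 2 ^ r ℓ(R)`. -/
def descendants (r : ℕ) (Q : CubeIndex n) : Finset (CubeIndex n) :=
  (D.finite_descendants r Q).toFinset

/-- `f ∈ L^q_loc(μ)`. Every compact set is covered by finitely many cubes of the system and every
cube is bounded, so local integrability may be tested on the cubes. -/
def MemLqLoc (μ : Measure (Fin n → ℝ)) (q : ℝ) (f : (Fin n → ℝ) → ℝ) : Prop :=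
  ∀ Q : CubeIndex n, MemLp f (ENNReal.ofReal q) (μ.restrict (D.cube Q))

/-- The martingale Lipschitz seminorm
`sup_Q μ(Q) ^ (-(1/q + a)) (∫_Q |f - ⟨f⟩_{Q̂}|^q dμ) ^ (1/q)`, with values in `[0, ∞]`. -/
def lipSeminorm (μ : Measure (Fin n → ℝ)) (q a : ℝ) (f : (Fin n → ℝ) → ℝ) : ℝ≥0∞ :=
  ⨆ Q : CubeIndex n,
    (∫⁻ x in D.cube Q, ‖f x - ⨍ y in D.cube (D.parent Q), f y ∂μ‖ₑ ^ q ∂μ) ^ (1 / q) /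
      μ (D.cube Q) ^ (1 / q + a)

/-- `f ∈ Λ_q(a)`. -/
def MemLip (μ : Measure (Fin n → ℝ)) (q a : ℝ) (f : (Fin n → ℝ) → ℝ) : Prop :=
  D.MemLqLoc μ q f ∧ D.lipSeminorm μ q a f < ∞

end DyadicSystem

/-- A Haar system for `μ` along `D`: to every cube `Q` are attached `2ⁿ - 1` functions supported on
`Q`, constant on the dyadic children of `Q`, of mean zero, and all of these together are
orthonormal in `L²(μ)`. (When all cubes have positive finite measure, the functions attached to `Q`
therefore span all mean-zero functions on `Q` that are constant on the children of `Q`.) -/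
structure HaarSystem {n : ℕ} (D : DyadicSystem n) (μ : Measure (Fin n → ℝ)) where
  h : CubeIndex n → Fin (2 ^ n - 1) → (Fin n → ℝ) → ℝ
  support : ∀ Q i x, x ∉ D.cube Q → h Q i x = 0
  const_on_children : ∀ Q i, ∀ R ∈ D.descendants 1 Q, ∃ c : ℝ, ∀ x ∈ D.cube R, h Q i x = c
  integral_eq_zero : ∀ Q i, ∫ x, h Q i x ∂μ = 0
  normalized : ∀ Q i, ∫ x, h Q i x * h Q i x ∂μ = 1
  orthogonal : ∀ Q i R j, (Q, i) ≠ (R, j) → ∫ x, h Q i x * h R j x ∂μ = 0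

namespace HaarSystem

variable {n : ℕ} {D : DyadicSystem n} {μ : Measure (Fin n → ℝ)} (H : HaarSystem D μ)

/-- The balanced condition
`sup_Q sup_{R ∈ 𝒟₁(Q)} (‖h_Q‖_{L¹} ‖h_R‖_{L^∞} + ‖h_Q‖_{L^∞} ‖h_R‖_{L¹}) < ∞`, the supremum being
also over all Haar functions attached to `Q` and to `R`. -/
def Balanced : Prop :=
  (⨆ (Q : CubeIndex n) (R ∈ D.descendants 1 Q) (i : Fin (2 ^ n - 1)) (j : Fin (2 ^ n - 1)),
    (eLpNorm (H.h Q i) 1 μ * eLpNorm (H.h R j) ∞ μ +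
      eLpNorm (H.h Q i) ∞ μ * eLpNorm (H.h R j) 1 μ)) < ∞

/-- Coefficients `α^Q_{R,S}` of a Haar shift; they may also depend on which of the Haar functions
of `R` and of `S` are involved. -/
abbrev Coeff (n : ℕ) : Type :=
  CubeIndex n → CubeIndex n → CubeIndex n → Fin (2 ^ n - 1) → Fin (2 ^ n - 1) → ℝ

/-- The `Q`-th term
`∑_{R ∈ 𝒟_r(Q), S ∈ 𝒟_s(Q)} ∑_{i, j} α^{Q,i,j}_{R,S} ⟨f, h_R^i⟩ h_S^j` of a Haar shift of
complexity `(r, s)`. -/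
def shiftTerm (r s : ℕ) (α : Coeff n) (f : (Fin n → ℝ) → ℝ) (Q : CubeIndex n)
    (x : Fin n → ℝ) : ℝ :=
  ∑ R ∈ D.descendants r Q, ∑ S ∈ D.descendants s Q, ∑ i, ∑ j,
    α Q R S i j * (∫ y, f y * H.h R i y ∂μ) * H.h S j x

/-- The bounded operator `T` on `L²(μ)` is the Haar shift of complexity `(r, s)` with
coefficients `α`: for every `f ∈ L²(μ)` the series of the terms of the shift converges to `T f`
(unconditionally, in `L²(μ)`). -/
def IsShiftOnL2 (r s : ℕ) (α : Coeff n) (T : Lp ℝ 2 μ →L[ℝ] Lp ℝ 2 μ) : Prop :=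
  ∀ f : Lp ℝ 2 μ,
    Tendsto (fun F : Finset (CubeIndex n) =>
      eLpNorm (fun x => (∑ Q ∈ F, H.shiftTerm r s α f Q x) - T f x) 2 μ) atTop (𝓝 0)

/-- `g` is (a representative of) the image `T f` of `f ∈ L^q_loc(μ)` under the Haar shift.
For functions that do not decay the series of the shift converges only up to additive constants:
`T f` is the function `g ∈ L^q_loc(μ)` such that on every cube `P` the series
`∑_Q (t_Q - ⟨t_Q⟩_P)`, `t_Q` being the terms of the shift, converges to `g - ⟨g⟩_P`
(unconditionally, in `L^q(P, μ)`). Terms whose Haar functions live on cubes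
strictly larger than `P` are constant on `P` and drop out. This determines `g`
up to a function that is constant on every cube of the system. -/
def IsShiftImage (r s : ℕ) (α : Coeff n) (q : ℝ) (f g : (Fin n → ℝ) → ℝ) : Prop :=
  D.MemLqLoc μ q g ∧
  ∀ P : CubeIndex n,
    Tendsto (fun F : Finset (CubeIndex n) =>
      eLpNorm (fun x =>
          (∑ Q ∈ F, (H.shiftTerm r s α f Q x - ⨍ y in D.cube P, H.shiftTerm r s α f Q y ∂μ)) -
            (g x - ⨍ y in D.cube P, g y ∂μ))
        (ENNReal.ofReal q) (μ.restrict (D.cube P))) atTop (𝓝 0)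

end HaarSystem

end

/-!
Modulo constants on a cube `P`, only those terms `t_Q(f)` matter for which `Q` meets `P` and is at
most `s` generations older than `P`. If `Q ⊆ P`, the coefficients of `t_Q(f)` see only the
restriction of `f - ⟨f⟩_{P̂}` to `P`, and Bessel's inequality controls their squares. There remain
boundedly many strict ancestors `Q` of `P`, and balance is what bounds their coefficients by
`‖f‖_{Λ(a)} μ(P) ^ (1/2 + a)`. A finite partial sum of the shift is `T` applied to a finite Haar
projection of `f`, so the sum of squares of the coefficients gives a bound in `Λ₂(a)` by `‖T‖`,
uniform over the partial sums.

By the John–Nirenberg inequality the seminorms of `Λ_p(a)`, `0 < p < ∞`, are equivalent. Hence the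
partial sums are bounded in every `Λ_p(a)`, which upgrades their convergence modulo constants from
`L²(P, μ)` to `L^q(P, μ)`; the limits on different cubes agree up to constants and glue.
-/

namespace DyadicSystem

variable {n : ℕ} (D : DyadicSystem n)

theorem eq_of_mem_cube {Q R : CubeIndex n} {x : Fin n → ℝ} (hg : Q.1 = R.1) (hQ : x ∈ D.cube Q)
    (hR : x ∈ D.cube R) : Q = R := by
  obtain ⟨k, j⟩ := Q
  obtain ⟨k', j'⟩ := R
  have hkk : k = k' := hg
  subst hkk
  have := (D.partition k x).unique hQ hR
  subst this
  rfl

theorem cubeAt_eq {Q : CubeIndex n} {x : Fin n → ℝ} (hQ : x ∈ D.cube Q) : D.cubeAt Q.1 x = Q :=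
  D.eq_of_mem_cube rfl (D.mem_cube_cubeAt _ _) hQ

theorem cube_subset_of_mem {Q R : CubeIndex n} {x : Fin n → ℝ} (hg : Q.1 ≤ R.1)
    (hQ : x ∈ D.cube Q) (hR : x ∈ D.cube R) : D.cube R ⊆ D.cube Q := by
  rcases hg.eq_or_lt with h | h
  · rw [D.eq_of_mem_cube h hQ hR]
  rcases D.nested Q R with h1 | h1 | h1
  · exact absurd hR (Set.disjoint_left.1 h1 hQ)
  · intro y _ i hi
    exfalso
    have hp := zpow_pos (two_pos : (0 : ℝ) < 2) (-R.1)
    have hlt : (2 : ℝ) ^ (-R.1) < 2 ^ (-Q.1) := zpow_lt_zpow_right₀ one_lt_two (by omega)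
    have hc := h1 (D.corner_mem_cube Q)
    have hz : (fun m => D.corner Q m + (2 : ℝ) ^ (-R.1)) ∈ D.cube R := by
      apply h1
      intro m _
      simp only [Set.mem_Ico]
      constructor <;> linarith
    have e1 := (hc i hi).1
    have e2 := (hz i hi).2
    simp only at e2
    linarith
  · exact h1

theorem disjoint_or_subset {Q R : CubeIndex n} (hg : Q.1 ≤ R.1) :
    Disjoint (D.cube Q) (D.cube R) ∨ D.cube R ⊆ D.cube Q := by
  by_cases h : Disjoint (D.cube Q) (D.cube R)
  · exact Or.inl h
  · obtain ⟨x, hx1, hx2⟩ := Set.not_disjoint_iff.1 h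
    exact Or.inr (D.cube_subset_of_mem hg hx1 hx2)

theorem mem_descendants {r : ℕ} {Q R : CubeIndex n} :
    R ∈ D.descendants r Q ↔ R.1 = Q.1 + r ∧ D.cube R ⊆ D.cube Q := by
  simp [descendants]

theorem cubeAt_mem_descendants (r : ℕ) {Q : CubeIndex n} {x : Fin n → ℝ} (hx : x ∈ D.cube Q) :
    D.cubeAt (Q.1 + r) x ∈ D.descendants r Q :=
  D.mem_descendants.2 ⟨rfl, D.cube_subset_of_mem (by simp [cubeAt]) hx (D.mem_cube_cubeAt _ _)⟩

theorem mem_descendants_of_mem {Q R : CubeIndex n} {x : Fin n → ℝ} {r : ℕ} (hg : R.1 = Q.1 + r)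
    (hQ : x ∈ D.cube Q) (hR : x ∈ D.cube R) : R ∈ D.descendants r Q :=
  D.mem_descendants.2 ⟨hg, D.cube_subset_of_mem (by omega) hQ hR⟩

theorem descendants_nonempty (r : ℕ) (Q : CubeIndex n) : (D.descendants r Q).Nonempty :=
  ⟨_, D.cubeAt_mem_descendants r (D.corner_mem_cube Q)⟩

theorem cube_eq_biUnion (r : ℕ) (Q : CubeIndex n) :
    D.cube Q = ⋃ R ∈ D.descendants r Q, D.cube R := by
  ext x
  simp only [Set.mem_iUnion, exists_prop]
  constructor
  · intro hx
    exact ⟨_, D.cubeAt_mem_descendants r hx, D.mem_cube_cubeAt _ _⟩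
  · rintro ⟨R, hR, hx⟩
    exact (D.mem_descendants.1 hR).2 hx

theorem pairwiseDisjoint_descendants (r : ℕ) (Q : CubeIndex n) :
    Set.PairwiseDisjoint (↑(D.descendants r Q)) D.cube := by
  intro R hR S hS hne
  refine Set.disjoint_left.2 fun x hx1 hx2 => hne ?_
  exact D.eq_of_mem_cube ((D.mem_descendants.1 hR).1.trans (D.mem_descendants.1 hS).1.symm) hx1 hx2

theorem parent_of_mem_descendants {Q R : CubeIndex n} (hR : R ∈ D.descendants 1 Q) :
    D.parent R = Q := by
  have h := D.mem_descendants.1 hR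
  have : R.1 - 1 = Q.1 := by rw [h.1]; simp
  rw [parent, this]
  exact D.cubeAt_eq (h.2 (D.corner_mem_cube R))

theorem mem_descendants_parent (Q : CubeIndex n) : Q ∈ D.descendants 1 (D.parent Q) :=
  D.mem_descendants.2 ⟨by simp [parent, cubeAt], D.cube_subset_cube_parent Q⟩

theorem exists_mem_descendants_of_succ {r : ℕ} {Q R : CubeIndex n}
    (hR : R ∈ D.descendants (r + 1) Q) :
    ∃ S ∈ D.descendants r Q, R ∈ D.descendants 1 S := by
  obtain ⟨h1, h2⟩ := D.mem_descendants.1 hR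
  refine ⟨D.parent R, D.mem_descendants_of_mem (x := D.corner R) ?_ (h2 (D.corner_mem_cube R))
    (D.cube_subset_cube_parent R (D.corner_mem_cube R)), D.mem_descendants_parent R⟩
  simp only [parent, cubeAt, h1]
  push_cast
  ring

theorem dist_le_of_mem_cube {R : CubeIndex n} {x y : Fin n → ℝ} (hx : x ∈ D.cube R)
    (hy : y ∈ D.cube R) : dist x y ≤ (2 : ℝ) ^ (-R.1) := by
  refine (dist_pi_le_iff (by positivity)).2 fun i => ?_
  have h1 := hx i (Set.mem_univ i)
  have h2 := hy i (Set.mem_univ i)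
  rw [Real.dist_eq, abs_le]
  constructor <;> linarith [h1.1, h1.2, h2.1, h2.2]

theorem volume_cube (R : CubeIndex n) :
    volume (D.cube R) = ENNReal.ofReal ((2 : ℝ) ^ (-R.1)) ^ n := by
  simp [cube, halfOpenCube, volume_pi_pi, Real.volume_Ico]

theorem measure_cube_eq_sum (ν : Measure (Fin n → ℝ)) (r : ℕ) (Q : CubeIndex n) :
    ν (D.cube Q) = ∑ R ∈ D.descendants r Q, ν (D.cube R) := by
  conv_lhs => rw [D.cube_eq_biUnion r Q]
  exact measure_biUnion_finset (D.pairwiseDisjoint_descendants r Q)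
    fun R _ => D.measurableSet_cube R

theorem lintegral_cube_eq_sum (ν : Measure (Fin n → ℝ)) (r : ℕ) (Q : CubeIndex n)
    (F : (Fin n → ℝ) → ℝ≥0∞) :
    ∫⁻ x in D.cube Q, F x ∂ν = ∑ R ∈ D.descendants r Q, ∫⁻ x in D.cube R, F x ∂ν := by
  conv_lhs => rw [D.cube_eq_biUnion r Q]
  exact lintegral_biUnion_finset (D.pairwiseDisjoint_descendants r Q)
    (fun R _ => D.measurableSet_cube R) _

theorem integral_cube_eq_sum (ν : Measure (Fin n → ℝ)) (r : ℕ) (Q : CubeIndex n)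
    {F : (Fin n → ℝ) → ℝ} (hF : IntegrableOn F (D.cube Q) ν) :
    ∫ x in D.cube Q, F x ∂ν = ∑ R ∈ D.descendants r Q, ∫ x in D.cube R, F x ∂ν := by
  conv_lhs => rw [D.cube_eq_biUnion r Q]
  exact integral_biUnion_finset _ (fun R _ => D.measurableSet_cube R)
    (D.pairwiseDisjoint_descendants r Q) fun R hR => hF.mono_set (D.mem_descendants.1 hR).2

theorem card_descendants (r : ℕ) (Q : CubeIndex n) : (D.descendants r Q).card = 2 ^ (n * r) := by
  have hvol : ∀ R : CubeIndex n, volume.real (D.cube R) = ((2 : ℝ) ^ (-R.1)) ^ n := fun R => by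
    rw [Measure.real, D.volume_cube, ENNReal.toReal_pow, ENNReal.toReal_ofReal (by positivity)]
  have hdesc : ∀ R ∈ D.descendants r Q,
      volume.real (D.cube R) = ((2 : ℝ) ^ (n * r))⁻¹ * volume.real (D.cube Q) := by
    intro R hR
    rw [hvol, hvol, (D.mem_descendants.1 hR).1, neg_add, zpow_add₀ two_ne_zero, mul_pow,
      zpow_neg _ (r : ℤ), zpow_natCast, inv_pow, ← pow_mul, mul_comm r n, mul_comm]
  have hfin : ∀ R : CubeIndex n, volume (D.cube R) ≠ ∞ := fun R => by
    rw [D.volume_cube]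
    exact ENNReal.pow_ne_top ENNReal.ofReal_ne_top
  have h := congrArg ENNReal.toReal (D.measure_cube_eq_sum volume r Q)
  rw [ENNReal.toReal_sum fun R _ => hfin R] at h
  change volume.real (D.cube Q) = ∑ R ∈ _, volume.real (D.cube R) at h
  rw [Finset.sum_congr rfl hdesc, Finset.sum_const, nsmul_eq_mul] at h
  have hQ : 0 < volume.real (D.cube Q) := by
    rw [hvol]
    positivity
  have hcard : ((D.descendants r Q).card : ℝ) = 2 ^ (n * r) := by
    field_simp at h
    exact h.symm
  exact_mod_cast hcard

theorem measurable_cubeAt (k : ℤ) : Measurable (D.cubeAt k) := by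
  refine measurable_to_countable' fun Q => ?_
  by_cases h : Q.1 = k
  · convert D.measurableSet_cube Q using 1
    ext x
    constructor
    · rintro rfl
      exact D.mem_cube_cubeAt k x
    · intro hx
      subst h
      exact D.cubeAt_eq hx
  · convert MeasurableSet.empty using 1
    ext x
    simp only [Set.mem_preimage, Set.mem_singleton_iff, Set.mem_empty_iff_false, iff_false]
    rintro rfl
    exact h rfl

variable (μ : Measure (Fin n → ℝ))

/-- The mean `⟨f⟩_Q`. -/
noncomputable abbrev mean (f : (Fin n → ℝ) → ℝ) (Q : CubeIndex n) : ℝ := ⨍ y in D.cube Q, f y ∂μ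

/-- All cubes of the system have positive and finite measure. -/
abbrev IsNondegenerate : Prop := ∀ Q : CubeIndex n, 0 < μ (D.cube Q) ∧ μ (D.cube Q) < ∞

variable {D μ} {f g : (Fin n → ℝ) → ℝ} {Q : CubeIndex n}

theorem mean_sub_fun (hf : IntegrableOn f (D.cube Q) μ) (hg : IntegrableOn g (D.cube Q) μ) :
    D.mean μ (fun x => f x - g x) Q = D.mean μ f Q - D.mean μ g Q := by
  simp only [mean, setAverage_eq]
  rw [integral_sub hf hg, smul_sub]

variable (hμ : D.IsNondegenerate μ)
include hμ

theorem measureReal_cube_pos (Q : CubeIndex n) : 0 < μ.real (D.cube Q) :=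
  ENNReal.toReal_pos (hμ Q).1.ne' (hμ Q).2.ne

theorem isFiniteMeasure_restrict_cube (Q : CubeIndex n) : IsFiniteMeasure (μ.restrict (D.cube Q)) :=
  ⟨by simpa using (hμ Q).2⟩

theorem integrableOn_const_cube (Q : CubeIndex n) (c : ℝ) :
    IntegrableOn (fun _ => c) (D.cube Q) μ :=
  integrableOn_const (hμ Q).2.ne

theorem measureReal_cube_eq_sum (r : ℕ) (Q : CubeIndex n) :
    μ.real (D.cube Q) = ∑ S ∈ D.descendants r Q, μ.real (D.cube S) := by
  simpa using D.integral_cube_eq_sum μ r Q (integrableOn_const_cube hμ Q 1)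

theorem mean_mul (f : (Fin n → ℝ) → ℝ) (Q : CubeIndex n) :
    D.mean μ f Q * μ.real (D.cube Q) = ∫ x in D.cube Q, f x ∂μ := by
  rw [mean, setAverage_eq, smul_eq_mul]
  have := (measureReal_cube_pos hμ Q).ne'
  field_simp

theorem mean_const (c : ℝ) (Q : CubeIndex n) : D.mean μ (fun _ => c) Q = c :=
  setAverage_const (hμ Q).1.ne' (hμ Q).2.ne c

theorem mean_sub_const (hf : IntegrableOn f (D.cube Q) μ) (c : ℝ) :
    D.mean μ (fun x => f x - c) Q = D.mean μ f Q - c := by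
  rw [mean_sub_fun hf (integrableOn_const_cube hμ Q c), mean_const hμ]

theorem enorm_mean_mul_le (f : (Fin n → ℝ) → ℝ) (Q : CubeIndex n) :
    ‖D.mean μ f Q‖ₑ * μ (D.cube Q) ≤ ∫⁻ x in D.cube Q, ‖f x‖ₑ ∂μ := by
  have h : μ (D.cube Q) = ‖μ.real (D.cube Q)‖ₑ := by
    rw [Real.enorm_eq_ofReal measureReal_nonneg, ofReal_measureReal (hμ Q).2.ne]
  rw [h, ← enorm_mul, mean_mul hμ]
  exact enorm_integral_le_lintegral_enorm _

theorem enorm_mean_sub_mul_le (hf : IntegrableOn f (D.cube Q) μ) (c : ℝ) :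
    ‖D.mean μ f Q - c‖ₑ * μ (D.cube Q) ≤ ∫⁻ x in D.cube Q, ‖f x - c‖ₑ ∂μ := by
  rw [← mean_sub_const hμ hf]
  exact enorm_mean_mul_le hμ _ Q

end DyadicSystem

/-! ### The John–Nirenberg inequality -/

theorem lintegral_enorm_rpow_le_of_tendsto_eLpNorm {Ω ι E : Type*} [MeasurableSpace Ω]
    {ν : Measure Ω} [NormedAddCommGroup E] {l : Filter ι} [l.NeBot] [l.IsCountablyGenerated]
    {u : ι → Ω → E} {v : Ω → E} (hu : ∀ i, AEStronglyMeasurable (u i) ν)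
    (hv : AEStronglyMeasurable v ν) {e : ℝ≥0∞} (he : e ≠ 0)
    (h : Tendsto (fun i => eLpNorm (fun x => u i x - v x) e ν) l (𝓝 0))
    {p : ℝ} {B : ℝ≥0∞} (hB : ∀ i, ∫⁻ x, ‖u i x‖ₑ ^ p ∂ν ≤ B) :
    ∫⁻ x, ‖v x‖ₑ ^ p ∂ν ≤ B := by
  obtain ⟨w, hw⟩ := exists_seq_tendsto l
  have hmeasure : TendstoInMeasure ν (fun m => u (w m)) atTop v :=
    tendstoInMeasure_of_tendsto_eLpNorm he (fun m => hu (w m)) hv (h.comp hw)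
  obtain ⟨ns, -, hns⟩ := hmeasure.exists_seq_tendsto_ae
  have hliminf : ∫⁻ x, ‖v x‖ₑ ^ p ∂ν
      = ∫⁻ x, liminf (fun m => ‖u (w (ns m)) x‖ₑ ^ p) atTop ∂ν := by
    refine lintegral_congr_ae ?_
    filter_upwards [hns] with x hx
    have : Tendsto (fun m => ‖u (w (ns m)) x‖ₑ ^ p) atTop (𝓝 (‖v x‖ₑ ^ p)) :=
      (ENNReal.continuous_rpow_const.tendsto _).comp ((continuous_enorm.tendsto _).comp hx)
    exact this.liminf_eq.symm
  rw [hliminf]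
  refine (lintegral_liminf_le' fun m => ((hu _).enorm.pow_const p)).trans ?_
  exact (liminf_le_liminf (Eventually.of_forall fun m => hB (w (ns m)))).trans (by simp)

theorem rpow_le_tsum_ite_lt {p : ℝ} (hp : 0 < p) {t : ℝ≥0∞} (ht : t ≠ 0) {y : ℝ≥0∞}
    (hy : y ≠ ∞) :
    y ^ p ≤ ∑' j : ℕ, (((j : ℝ≥0∞) + 1) * t) ^ p * (if (j : ℝ≥0∞) * t < y then 1 else 0) := by
  classical
  rcases eq_or_ne y 0 with rfl | hy0
  · simp [ENNReal.zero_rpow_of_pos hp]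
  have hex : ∃ j : ℕ, y ≤ ((j : ℝ≥0∞) + 1) * t := by
    obtain ⟨m, hm⟩ := ENNReal.exists_nat_mul_gt ht hy
    exact ⟨m, hm.le.trans (by gcongr; exact le_self_add)⟩
  set j := Nat.find hex
  have hlt : (j : ℝ≥0∞) * t < y := by
    rcases Nat.eq_zero_or_pos j with h0 | h0
    · simp [h0, pos_iff_ne_zero, hy0]
    · have hmin := Nat.find_min hex (m := j - 1) (by omega)
      have hcast : ((j - 1 : ℕ) : ℝ≥0∞) + 1 = j := by exact_mod_cast Nat.sub_add_cancel h0
      rw [hcast] at hmin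
      exact not_le.1 hmin
  refine le_trans ?_ (ENNReal.le_tsum j)
  simp only [hlt, if_true, mul_one]
  exact ENNReal.rpow_le_rpow (Nat.find_spec hex) hp.le

theorem lintegral_rpow_le_tsum_measure_lt {Ω : Type*} [MeasurableSpace Ω] {ν : Measure Ω} {p : ℝ}
    (hp : 0 < p) {t : ℝ≥0∞} (ht : t ≠ 0) {F : Ω → ℝ≥0∞} (hF : Measurable F) (hF' : ∀ x, F x ≠ ∞) :
    ∫⁻ x, F x ^ p ∂ν
      ≤ ∑' j : ℕ, (((j : ℝ≥0∞) + 1) * t) ^ p * ν {x | (j : ℝ≥0∞) * t < F x} := by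
  have hs : ∀ j : ℕ, MeasurableSet {x | (j : ℝ≥0∞) * t < F x} :=
    fun j => measurableSet_lt measurable_const hF
  calc ∫⁻ x, F x ^ p ∂ν
      ≤ ∫⁻ x, ∑' j : ℕ, (((j : ℝ≥0∞) + 1) * t) ^ p *
          {x | (j : ℝ≥0∞) * t < F x}.indicator 1 x ∂ν := by
        refine lintegral_mono fun x => (rpow_le_tsum_ite_lt hp ht (hF' x)).trans_eq ?_
        simp only [Set.indicator_apply, Set.mem_ofPred_eq, Pi.one_apply]
    _ = ∑' j : ℕ, (((j : ℝ≥0∞) + 1) * t) ^ p * ν {x | (j : ℝ≥0∞) * t < F x} := by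
        rw [lintegral_tsum fun j => ((measurable_one.indicator (hs j)).const_mul _).aemeasurable]
        refine tsum_congr fun j => ?_
        rw [lintegral_const_mul _ (measurable_one.indicator (hs j)), lintegral_indicator_one (hs j)]

/-- The constant `∑ⱼ (j + 1)ᵖ 2⁻ʲ` of the John–Nirenberg inequality
`DyadicSystem.lintegral_sub_mean_parent_rpow_le`. -/
noncomputable def johnNirenbergConst (p : ℝ) : ℝ≥0∞ := ∑' j : ℕ, ((j : ℝ≥0∞) + 1) ^ p * 2⁻¹ ^ j

theorem johnNirenbergConst_ne_zero (p : ℝ) : johnNirenbergConst p ≠ 0 := fun h => by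
  simpa using ENNReal.tsum_eq_zero.1 h 0

theorem johnNirenbergConst_ne_top (p : ℝ) : johnNirenbergConst p ≠ ∞ := by
  obtain ⟨k, hk⟩ := exists_nat_ge p
  have hsum : Summable fun j : ℕ => ((j : ℝ) + 1) ^ k * (2⁻¹ : ℝ) ^ (j + 1) := by
    have := summable_pow_mul_geometric_of_norm_lt_one (R := ℝ) k (r := 2⁻¹) (by norm_num)
    simpa using (summable_nat_add_iff 1).2 this
  have hle : ∀ j : ℕ, ((j : ℝ≥0∞) + 1) ^ p * 2⁻¹ ^ j
      ≤ 2 * ENNReal.ofReal (((j : ℝ) + 1) ^ k * (2⁻¹ : ℝ) ^ (j + 1)) := by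
    intro j
    have hcoe : ENNReal.ofReal (((j : ℝ) + 1) ^ k * (2⁻¹ : ℝ) ^ (j + 1))
        = ((j : ℝ≥0∞) + 1) ^ k * 2⁻¹ ^ (j + 1) := by
      rw [ENNReal.ofReal_mul (by positivity), ENNReal.ofReal_pow (by positivity),
        ENNReal.ofReal_pow (by positivity), ENNReal.ofReal_add (by positivity) zero_le_one,
        ENNReal.ofReal_natCast, ENNReal.ofReal_one, ENNReal.ofReal_inv_of_pos two_pos,
        ENNReal.ofReal_ofNat]
    calc ((j : ℝ≥0∞) + 1) ^ p * 2⁻¹ ^ j ≤ ((j : ℝ≥0∞) + 1) ^ k * 2⁻¹ ^ j := by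
          gcongr
          rw [← ENNReal.rpow_natCast]
          exact ENNReal.rpow_le_rpow_of_exponent_le le_add_self hk
      _ = ((j : ℝ≥0∞) + 1) ^ k * 2⁻¹ ^ j * (2⁻¹ * 2) := by
          rw [ENNReal.inv_mul_cancel two_ne_zero ENNReal.ofNat_ne_top, mul_one]
      _ = 2 * ENNReal.ofReal (((j : ℝ) + 1) ^ k * (2⁻¹ : ℝ) ^ (j + 1)) := by
          rw [hcoe, pow_succ]
          ring
  refine ((ENNReal.tsum_le_tsum hle).trans_lt ?_).ne
  rw [ENNReal.tsum_mul_left, ← ENNReal.ofReal_tsum_of_nonneg (fun j => by positivity) hsum]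
  exact ENNReal.mul_lt_top ENNReal.ofNat_lt_top ENNReal.ofReal_lt_top

namespace DyadicSystem

variable {n : ℕ} {D : DyadicSystem n} {μ : Measure (Fin n → ℝ)} {f : (Fin n → ℝ) → ℝ}

variable (D μ) in
/-- The conditional expectation `E_k f`: its value on each cube of generation `k` is the mean of
`f`. -/
noncomputable def cubeMean (f : (Fin n → ℝ) → ℝ) (k : ℤ) (x : Fin n → ℝ) : ℝ :=
  D.mean μ f (D.cubeAt k x)

theorem measurable_cubeMean (f : (Fin n → ℝ) → ℝ) (k : ℤ) : Measurable (D.cubeMean μ f k) :=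
  (measurable_of_countable fun Q => D.mean μ f Q).comp (D.measurable_cubeAt k)

theorem cubeMean_of_mem {Q : CubeIndex n} {x : Fin n → ℝ} (hx : x ∈ D.cube Q) :
    D.cubeMean μ f Q.1 x = D.mean μ f Q := by
  rw [cubeMean, D.cubeAt_eq hx]

theorem lintegral_cubeMean_le (hμ : D.IsNondegenerate μ) (f : (Fin n → ℝ) → ℝ) (P : CubeIndex n)
    (m : ℕ) :
    ∫⁻ x in D.cube P, ‖D.cubeMean μ f (P.1 + m) x‖ₑ ∂μ ≤ ∫⁻ x in D.cube P, ‖f x‖ₑ ∂μ := by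
  rw [D.lintegral_cube_eq_sum μ m P, D.lintegral_cube_eq_sum μ m P]
  refine Finset.sum_le_sum fun R hR => le_of_eq_of_le ?_ (enorm_mean_mul_le hμ f R)
  rw [← setLIntegral_const, ← (D.mem_descendants.1 hR).1]
  exact setLIntegral_congr_fun (D.measurableSet_cube R) fun x hx => by
    simp only [cubeMean_of_mem hx]

theorem enorm_cubeMean_sub_le (hμ : D.IsNondegenerate μ) {k : ℤ} {x : Fin n → ℝ} {δ : ℝ≥0∞}
    (hf : IntegrableOn f (D.cube (D.cubeAt k x)) μ)
    (hδ : ∀ y ∈ D.cube (D.cubeAt k x), ‖f y - f x‖ₑ ≤ δ) : ‖D.cubeMean μ f k x - f x‖ₑ ≤ δ := by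
  have hmul := (enorm_mean_sub_mul_le hμ hf (f x)).trans
    (setLIntegral_mono measurable_const hδ)
  rw [setLIntegral_const] at hmul
  exact (ENNReal.mul_le_mul_iff_left (hμ _).1.ne' (hμ _).2.ne).1 hmul

theorem eventually_enorm_cubeMean_sub_le (hμ : D.IsNondegenerate μ) {P : CubeIndex n}
    (hf : IntegrableOn f (D.cube P) μ) (hf' : UniformContinuous f) {δ : ℝ} (hδ : 0 < δ) :
    ∀ᶠ m : ℕ in atTop, ∀ x ∈ D.cube P,
      ‖D.cubeMean μ f (P.1 + m) x - f x‖ₑ ≤ ENNReal.ofReal δ := by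
  obtain ⟨η, hη, hunif⟩ := Metric.uniformContinuous_iff.1 hf' δ hδ
  have hside : Tendsto (fun m : ℕ => (2 : ℝ) ^ (-(P.1 + (m : ℤ)))) atTop (𝓝 0) := by
    have h : Tendsto (fun m : ℕ => (2 : ℝ) ^ (-P.1) * (2⁻¹ : ℝ) ^ m) atTop (𝓝 0) := by
      simpa using (tendsto_pow_atTop_nhds_zero_of_lt_one (r := (2⁻¹ : ℝ)) (by norm_num)
        (by norm_num)).const_mul ((2 : ℝ) ^ (-P.1))
    refine h.congr fun m => ?_
    rw [neg_add, zpow_add₀ two_ne_zero, zpow_neg _ (m : ℤ), zpow_natCast, inv_pow]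
  filter_upwards [hside.eventually (gt_mem_nhds hη)] with m hm x hx
  have hsub : D.cube (D.cubeAt (P.1 + m) x) ⊆ D.cube P :=
    (D.mem_descendants.1 (D.cubeAt_mem_descendants m hx)).2
  refine enorm_cubeMean_sub_le hμ (hf.mono_set hsub) fun y hy => ?_
  rw [← ofReal_norm, ← dist_eq_norm]
  refine ENNReal.ofReal_le_ofReal (hunif (lt_of_le_of_lt ?_ hm)).le
  exact D.dist_le_of_mem_cube hy (D.mem_cube_cubeAt _ x)

theorem lintegral_cubeMean_sub_le (hμ : D.IsNondegenerate μ) {f g : (Fin n → ℝ) → ℝ}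
    {P : CubeIndex n} (hf : IntegrableOn f (D.cube P) μ) (hg : IntegrableOn g (D.cube P) μ)
    {m : ℕ} {δ : ℝ≥0∞} (hδ : ∀ x ∈ D.cube P, ‖D.cubeMean μ g (P.1 + m) x - g x‖ₑ ≤ δ) :
    ∫⁻ x in D.cube P, ‖D.cubeMean μ f (P.1 + m) x - f x‖ₑ ∂μ
      ≤ 2 * ∫⁻ x in D.cube P, ‖f x - g x‖ₑ ∂μ + δ * μ (D.cube P) := by
  set u : (Fin n → ℝ) → ℝ := fun y => f y - g y
  have hpt : ∀ x ∈ D.cube P, ‖D.cubeMean μ f (P.1 + m) x - f x‖ₑ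
      ≤ ‖D.cubeMean μ u (P.1 + m) x‖ₑ + (δ + ‖u x‖ₑ) := by
    intro x hx
    have hsub : D.cube (D.cubeAt (P.1 + m) x) ⊆ D.cube P :=
      (D.mem_descendants.1 (D.cubeAt_mem_descendants m hx)).2
    have hsplit : D.cubeMean μ f (P.1 + m) x - f x
        = D.cubeMean μ u (P.1 + m) x + ((D.cubeMean μ g (P.1 + m) x - g x) - u x) := by
      simp only [u, cubeMean, mean_sub_fun (hf.mono_set hsub) (hg.mono_set hsub)]
      ring
    rw [hsplit]
    exact (enorm_add_le _ _).trans
      (add_le_add_right (enorm_sub_le.trans (add_le_add_left (hδ x hx) _)) _)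
  calc ∫⁻ x in D.cube P, ‖D.cubeMean μ f (P.1 + m) x - f x‖ₑ ∂μ
      ≤ ∫⁻ x in D.cube P, (‖D.cubeMean μ u (P.1 + m) x‖ₑ + (δ + ‖u x‖ₑ)) ∂μ :=
        setLIntegral_mono' (D.measurableSet_cube P) hpt
    _ = ∫⁻ x in D.cube P, ‖D.cubeMean μ u (P.1 + m) x‖ₑ ∂μ
          + (δ * μ (D.cube P) + ∫⁻ x in D.cube P, ‖u x‖ₑ ∂μ) := by
        rw [lintegral_add_left (measurable_cubeMean _ _).enorm, lintegral_add_left measurable_const,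
          setLIntegral_const]
    _ ≤ ∫⁻ x in D.cube P, ‖u x‖ₑ ∂μ + (δ * μ (D.cube P) + ∫⁻ x in D.cube P, ‖u x‖ₑ ∂μ) := by
        exact add_le_add_left (lintegral_cubeMean_le hμ u P m) _
    _ = 2 * ∫⁻ x in D.cube P, ‖u x‖ₑ ∂μ + δ * μ (D.cube P) := by ring

theorem tendsto_lintegral_cubeMean_sub (hμ : D.IsNondegenerate μ) {P : CubeIndex n}
    (hf : IntegrableOn f (D.cube P) μ) :
    Tendsto (fun m : ℕ => ∫⁻ x in D.cube P, ‖D.cubeMean μ f (P.1 + m) x - f x‖ₑ ∂μ)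
      atTop (𝓝 0) := by
  have := isFiniteMeasure_restrict_cube hμ P
  have hlim : Tendsto (fun δ : ℝ => ENNReal.ofReal δ * (2 + μ (D.cube P))) (𝓝[>] 0) (𝓝 0) := by
    have h := ENNReal.Tendsto.mul_const (b := 2 + μ (D.cube P))
      (ENNReal.tendsto_ofReal (tendsto_id (α := ℝ) (x := 𝓝 0)))
      (Or.inr (ENNReal.add_ne_top.2 ⟨ENNReal.ofNat_ne_top, (hμ P).2.ne⟩))
    rw [ENNReal.ofReal_zero, zero_mul] at h
    exact h.mono_left nhdsWithin_le_nhds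
  rw [ENNReal.tendsto_nhds_zero]
  intro ε hε
  obtain ⟨δ, hδ, hδ0⟩ := ((ENNReal.tendsto_nhds_zero.1 hlim ε hε).and self_mem_nhdsWithin).exists
  obtain ⟨g, hgs, hfg, hgc, hg⟩ := (memLp_one_iff_integrable.2 hf
    ).exists_hasCompactSupport_eLpNorm_sub_le ENNReal.one_ne_top (ENNReal.ofReal_pos.2 hδ0).ne'
  rw [eLpNorm_one_eq_lintegral_enorm] at hfg
  have hgP : IntegrableOn g (D.cube P) μ := memLp_one_iff_integrable.1 hg
  filter_upwards [eventually_enorm_cubeMean_sub_le hμ hgP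
    (hgs.uniformContinuous_of_continuous hgc) hδ0] with m hm
  calc ∫⁻ x in D.cube P, ‖D.cubeMean μ f (P.1 + m) x - f x‖ₑ ∂μ
      ≤ 2 * ∫⁻ x in D.cube P, ‖f x - g x‖ₑ ∂μ + ENNReal.ofReal δ * μ (D.cube P) :=
        lintegral_cubeMean_sub_le hμ hf hgP hm
    _ ≤ 2 * ENNReal.ofReal δ + ENNReal.ofReal δ * μ (D.cube P) := by
        gcongr
        exact hfg
    _ = ENNReal.ofReal δ * (2 + μ (D.cube P)) := by ring
    _ ≤ ε := hδ

variable (D μ) in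
/-- The mass of the maximal cubes `R ⊆ Q`, among those at most `m` generations below `Q`, for which
`|⟨f⟩_R - c| > t`. -/
noncomputable def stoppedMass (f : (Fin n → ℝ) → ℝ) (c : ℝ) (t : ℝ≥0∞) :
    ℕ → CubeIndex n → ℝ≥0∞
  | 0, Q => if t < ‖D.mean μ f Q - c‖ₑ then μ (D.cube Q) else 0
  | m + 1, Q => if t < ‖D.mean μ f Q - c‖ₑ then μ (D.cube Q) else
      ∑ R ∈ D.descendants 1 Q, stoppedMass f c t m R

theorem stoppedMass_of_lt {f : (Fin n → ℝ) → ℝ} {c : ℝ} {t : ℝ≥0∞} (m : ℕ) {Q : CubeIndex n}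
    (h : t < ‖D.mean μ f Q - c‖ₑ) : D.stoppedMass μ f c t m Q = μ (D.cube Q) := by
  cases m <;> simp [stoppedMass, h]

theorem stoppedMass_le (f : (Fin n → ℝ) → ℝ) (c : ℝ) (t : ℝ≥0∞) (m : ℕ) (Q : CubeIndex n) :
    D.stoppedMass μ f c t m Q ≤ μ (D.cube Q) := by
  induction m generalizing Q with
  | zero => simp only [stoppedMass]; split_ifs <;> simp
  | succ m ih =>
    simp only [stoppedMass]
    split_ifs
    · exact le_rfl
    · rw [D.measure_cube_eq_sum μ 1 Q]
      exact Finset.sum_le_sum fun R _ => ih R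

theorem stoppedMass_add_le (f : (Fin n → ℝ) → ℝ) {c c' : ℝ} {s : ℝ≥0∞} (t : ℝ≥0∞)
    (hc : ‖c' - c‖ₑ ≤ s) (m : ℕ) (Q : CubeIndex n) :
    D.stoppedMass μ f c (s + t) m Q ≤ D.stoppedMass μ f c' t m Q := by
  have key : ∀ Q, s + t < ‖D.mean μ f Q - c‖ₑ → t < ‖D.mean μ f Q - c'‖ₑ := by
    intro Q h
    by_contra! h'
    refine absurd h (not_lt.2 ?_)
    calc ‖D.mean μ f Q - c‖ₑ = ‖(c' - c) + (D.mean μ f Q - c')‖ₑ := by congr 1; ring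
      _ ≤ ‖c' - c‖ₑ + ‖D.mean μ f Q - c'‖ₑ := enorm_add_le _ _
      _ ≤ s + t := add_le_add hc h'
  induction m generalizing Q with
  | zero =>
    by_cases h : s + t < ‖D.mean μ f Q - c‖ₑ
    · rw [stoppedMass_of_lt _ h, stoppedMass_of_lt _ (key Q h)]
    · simp [stoppedMass, h]
  | succ m ih =>
    by_cases h' : t < ‖D.mean μ f Q - c'‖ₑ
    · rw [stoppedMass_of_lt _ h']
      exact stoppedMass_le ..
    · have h : ¬ s + t < ‖D.mean μ f Q - c‖ₑ := fun h => h' (key Q h)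
      simp only [stoppedMass, h, h', if_false]
      exact Finset.sum_le_sum fun R _ => ih R

theorem mul_stoppedMass_le (hμ : D.IsNondegenerate μ) (hf : ∀ Q, IntegrableOn f (D.cube Q) μ)
    (c : ℝ) (t : ℝ≥0∞) (m : ℕ) (Q : CubeIndex n) :
    t * D.stoppedMass μ f c t m Q ≤ ∫⁻ x in D.cube Q, ‖f x - c‖ₑ ∂μ := by
  have key : ∀ m Q, t < ‖D.mean μ f Q - c‖ₑ →
      t * D.stoppedMass μ f c t m Q ≤ ∫⁻ x in D.cube Q, ‖f x - c‖ₑ ∂μ := by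
    intro m Q h
    rw [stoppedMass_of_lt _ h]
    refine le_trans ?_ (enorm_mean_sub_mul_le hμ (hf Q) c)
    gcongr
  induction m generalizing Q with
  | zero =>
    by_cases h : t < ‖D.mean μ f Q - c‖ₑ
    · exact key _ _ h
    · simp [stoppedMass, h]
  | succ m ih =>
    by_cases h : t < ‖D.mean μ f Q - c‖ₑ
    · exact key _ _ h
    · simp only [stoppedMass, h, if_false]
      rw [Finset.mul_sum, D.lintegral_cube_eq_sum μ 1 Q]
      exact Finset.sum_le_sum fun R _ => ih R

theorem mul_stoppedMass_add_le (hμ : D.IsNondegenerate μ) (hf : ∀ Q, IntegrableOn f (D.cube Q) μ)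
    {P : CubeIndex n} {A : ℝ≥0∞}
    (hA : ∀ R, D.cube R ⊆ D.cube P →
      ∫⁻ x in D.cube R, ‖f x - D.mean μ f (D.parent R)‖ₑ ∂μ ≤ A * μ (D.cube R))
    {c : ℝ} {s : ℝ≥0∞} (t : ℝ≥0∞) (m : ℕ) {Q : CubeIndex n} (hQ : D.cube Q ⊆ D.cube P)
    (hc : ‖D.mean μ f (D.parent Q) - c‖ₑ ≤ s) :
    t * D.stoppedMass μ f c (s + t) m Q ≤ A * D.stoppedMass μ f c s m Q := by
  have key : ∀ m Q, D.cube Q ⊆ D.cube P → ‖D.mean μ f (D.parent Q) - c‖ₑ ≤ s →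
      s < ‖D.mean μ f Q - c‖ₑ →
      t * D.stoppedMass μ f c (s + t) m Q ≤ A * D.stoppedMass μ f c s m Q := by
    intro m Q hQ hc h
    rw [stoppedMass_of_lt _ h]
    calc t * D.stoppedMass μ f c (s + t) m Q
        ≤ t * D.stoppedMass μ f (D.mean μ f (D.parent Q)) t m Q := by
          gcongr; exact stoppedMass_add_le f t hc m Q
      _ ≤ _ := mul_stoppedMass_le hμ hf _ t m Q
      _ ≤ _ := hA Q hQ
  induction m generalizing Q with
  | zero =>
    by_cases h : s < ‖D.mean μ f Q - c‖ₑ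
    · exact key _ _ hQ hc h
    · have h' : ¬ s + t < ‖D.mean μ f Q - c‖ₑ := fun h' => h (le_self_add.trans_lt h')
      simp [stoppedMass, h']
  | succ m ih =>
    by_cases h : s < ‖D.mean μ f Q - c‖ₑ
    · exact key _ _ hQ hc h
    · have h' : ¬ s + t < ‖D.mean μ f Q - c‖ₑ := fun h' => h (le_self_add.trans_lt h')
      simp only [stoppedMass, h, h', if_false]
      rw [Finset.mul_sum, Finset.mul_sum]
      refine Finset.sum_le_sum fun R hR => ih ((D.mem_descendants.1 hR).2.trans hQ) ?_
      rw [D.parent_of_mem_descendants hR]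
      exact not_lt.1 h

theorem measure_lt_cubeMean_le_stoppedMass (f : (Fin n → ℝ) → ℝ) (c : ℝ) (t : ℝ≥0∞) (m : ℕ)
    (Q : CubeIndex n) :
    μ.restrict (D.cube Q) {x | t < ‖D.cubeMean μ f (Q.1 + m) x - c‖ₑ}
      ≤ D.stoppedMass μ f c t m Q := by
  induction m generalizing Q with
  | zero =>
    by_cases h : t < ‖D.mean μ f Q - c‖ₑ
    · rw [stoppedMass_of_lt _ h]
      exact (measure_mono (Set.subset_univ _)).trans (by simp)
    · rw [Measure.restrict_apply' (D.measurableSet_cube Q)]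
      refine le_of_eq_of_le ?_ zero_le
      convert measure_empty (μ := μ)
      ext x
      simp only [Set.mem_inter_iff, Set.mem_ofPred_eq, Set.mem_empty_iff_false, iff_false, not_and]
      intro hx hxQ
      simp only [Nat.cast_zero, add_zero, cubeMean_of_mem hxQ] at hx
      exact h hx
  | succ m ih =>
    by_cases h : t < ‖D.mean μ f Q - c‖ₑ
    · rw [stoppedMass_of_lt _ h]
      exact (measure_mono (Set.subset_univ _)).trans (by simp)
    · simp only [stoppedMass, h, if_false]
      have e : μ.restrict (D.cube Q) {x | t < ‖D.cubeMean μ f (Q.1 + (m + 1 : ℕ)) x - c‖ₑ}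
          ≤ ∑ R ∈ D.descendants 1 Q, μ.restrict (D.cube R)
            {x | t < ‖D.cubeMean μ f (Q.1 + (m + 1 : ℕ)) x - c‖ₑ} := by
        rw [Measure.restrict_apply' (D.measurableSet_cube Q)]
        simp_rw [fun R => Measure.restrict_apply' (μ := μ)
          (t := {x | t < ‖D.cubeMean μ f (Q.1 + (m + 1 : ℕ)) x - c‖ₑ})
          (D.measurableSet_cube R)]
        refine le_trans (measure_mono ?_) (measure_biUnion_finset_le _ _)
        conv_lhs => rw [D.cube_eq_biUnion 1 Q]
        rw [Set.inter_iUnion₂]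
      refine e.trans (Finset.sum_le_sum fun R hR => le_trans (le_of_eq ?_) (ih R))
      have : Q.1 + ((m + 1 : ℕ) : ℤ) = R.1 + m := by
        rw [(D.mem_descendants.1 hR).1]; push_cast; ring
      rw [this]

theorem stoppedMass_le_inv_two_pow_mul (hμ : D.IsNondegenerate μ)
    (hf : ∀ Q, IntegrableOn f (D.cube Q) μ) {P : CubeIndex n} {A : ℝ≥0∞} (hA0 : A ≠ 0)
    (hA1 : A ≠ ∞)
    (hA : ∀ R, D.cube R ⊆ D.cube P →
      ∫⁻ x in D.cube R, ‖f x - D.mean μ f (D.parent R)‖ₑ ∂μ ≤ A * μ (D.cube R)) (m j : ℕ) :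
    D.stoppedMass μ f (D.mean μ f (D.parent P)) (j * (2 * A)) m P ≤ 2⁻¹ ^ j * μ (D.cube P) := by
  induction j with
  | zero => simpa using stoppedMass_le (D := D) (μ := μ) f _ _ m P
  | succ j ih =>
    have hstep := mul_stoppedMass_add_le hμ hf hA (c := D.mean μ f (D.parent P))
      (s := j * (2 * A)) (2 * A) m subset_rfl (by simp)
    rw [mul_comm 2 A, mul_assoc A, mul_comm A 2] at hstep
    have hhalf := ((ENNReal.mul_le_mul_iff_right hA0 hA1).1 hstep).trans ih
    rw [Nat.cast_succ, add_one_mul, pow_succ', mul_assoc, ← ENNReal.div_eq_inv_mul,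
      ENNReal.le_div_iff_mul_le (Or.inl two_ne_zero) (Or.inl ENNReal.ofNat_ne_top), mul_comm]
    exact hhalf

theorem lintegral_cubeMean_sub_rpow_le (hμ : D.IsNondegenerate μ)
    (hf : ∀ Q, IntegrableOn f (D.cube Q) μ) {P : CubeIndex n} {A : ℝ≥0∞} (hA0 : A ≠ 0)
    (hA1 : A ≠ ∞)
    (hA : ∀ R, D.cube R ⊆ D.cube P →
      ∫⁻ x in D.cube R, ‖f x - D.mean μ f (D.parent R)‖ₑ ∂μ ≤ A * μ (D.cube R))
    {p : ℝ} (hp : 0 < p) (m : ℕ) :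
    ∫⁻ x in D.cube P, ‖D.cubeMean μ f (P.1 + m) x - D.mean μ f (D.parent P)‖ₑ ^ p ∂μ
      ≤ johnNirenbergConst p * (2 * A) ^ p * μ (D.cube P) := by
  set c := D.mean μ f (D.parent P)
  calc ∫⁻ x in D.cube P, ‖D.cubeMean μ f (P.1 + m) x - c‖ₑ ^ p ∂μ
      ≤ ∑' j : ℕ, (((j : ℝ≥0∞) + 1) * (2 * A)) ^ p * μ.restrict (D.cube P)
          {x | (j : ℝ≥0∞) * (2 * A) < ‖D.cubeMean μ f (P.1 + m) x - c‖ₑ} :=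
        lintegral_rpow_le_tsum_measure_lt hp (mul_ne_zero two_ne_zero hA0)
          ((measurable_cubeMean f _).sub_const c).enorm fun _ => enorm_ne_top
    _ ≤ ∑' j : ℕ, (((j : ℝ≥0∞) + 1) * (2 * A)) ^ p * (2⁻¹ ^ j * μ (D.cube P)) := by
        gcongr with j
        exact (measure_lt_cubeMean_le_stoppedMass f c _ m P).trans
          (stoppedMass_le_inv_two_pow_mul hμ hf hA0 hA1 hA m j)
    _ = johnNirenbergConst p * (2 * A) ^ p * μ (D.cube P) := by
        rw [johnNirenbergConst, ← ENNReal.tsum_mul_right, ← ENNReal.tsum_mul_right]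
        refine tsum_congr fun j => ?_
        rw [ENNReal.mul_rpow_of_nonneg _ _ hp.le]
        ring

theorem lintegral_sub_mean_parent_rpow_le (hμ : D.IsNondegenerate μ)
    (hf : ∀ Q, IntegrableOn f (D.cube Q) μ) {P : CubeIndex n} {A : ℝ≥0∞}
    (hA : ∀ R, D.cube R ⊆ D.cube P →
      ∫⁻ x in D.cube R, ‖f x - D.mean μ f (D.parent R)‖ₑ ∂μ ≤ A * μ (D.cube R))
    {p : ℝ} (hp : 0 < p) :
    ∫⁻ x in D.cube P, ‖f x - D.mean μ f (D.parent P)‖ₑ ^ p ∂μ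
      ≤ johnNirenbergConst p * (2 * A) ^ p * μ (D.cube P) := by
  have hpos : ∀ B : ℝ≥0∞, A < B → B < ∞ →
      ∫⁻ x in D.cube P, ‖f x - D.mean μ f (D.parent P)‖ₑ ^ p ∂μ
        ≤ johnNirenbergConst p * (2 * B) ^ p * μ (D.cube P) := by
    intro B hAB hB
    refine lintegral_enorm_rpow_le_of_tendsto_eLpNorm (l := atTop) (e := 1)
      (u := fun (m : ℕ) x => D.cubeMean μ f (P.1 + m) x - D.mean μ f (D.parent P))
      (fun m => ((measurable_cubeMean f _).sub_const _).aestronglyMeasurable)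
      ((hf P).aestronglyMeasurable.sub aestronglyMeasurable_const) one_ne_zero ?_ fun m =>
        lintegral_cubeMean_sub_rpow_le hμ hf hAB.ne_bot hB.ne
          (fun R hR => (hA R hR).trans (by gcongr)) hp m
    simp only [eLpNorm_one_eq_lintegral_enorm, Pi.sub_apply, sub_sub_sub_cancel_right]
    exact tendsto_lintegral_cubeMean_sub hμ (hf P)
  rcases eq_or_ne A ∞ with rfl | hA1
  · rw [ENNReal.mul_top two_ne_zero, ENNReal.top_rpow_of_pos hp,
      ENNReal.mul_top (johnNirenbergConst_ne_zero p), ENNReal.top_mul (hμ P).1.ne']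
    exact le_top
  have hcont : Tendsto (fun B : ℝ≥0∞ => johnNirenbergConst p * (2 * B) ^ p * μ (D.cube P)) (𝓝[>] A)
      (𝓝 (johnNirenbergConst p * (2 * A) ^ p * μ (D.cube P))) := by
    refine Tendsto.mono_left ?_ nhdsWithin_le_nhds
    refine ENNReal.Tendsto.mul_const (ENNReal.Tendsto.const_mul ?_
      (Or.inr (johnNirenbergConst_ne_top p))) (Or.inr (hμ P).2.ne)
    exact (ENNReal.continuous_rpow_const.tendsto _).comp
      (ENNReal.Tendsto.const_mul tendsto_id (Or.inr ENNReal.ofNat_ne_top))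
  have : (𝓝[>] A).NeBot := nhdsGT_neBot_of_exists_gt ⟨∞, hA1.lt_top⟩
  refine ge_of_tendsto hcont ?_
  filter_upwards [Ioo_mem_nhdsGT hA1.lt_top] with B hB
  exact hpos B hB.1 hB.2

end DyadicSystem

namespace DyadicSystem

variable {n : ℕ} {D : DyadicSystem n} {μ : Measure (Fin n → ℝ)} {f : (Fin n → ℝ) → ℝ}

theorem MemLqLoc.integrableOn (hμ : D.IsNondegenerate μ) {q : ℝ} (hq : 1 ≤ q)
    (hf : D.MemLqLoc μ q f) (Q : CubeIndex n) : IntegrableOn f (D.cube Q) μ := by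
  have := isFiniteMeasure_restrict_cube hμ Q
  exact (hf Q).integrable (by simpa using ENNReal.ofReal_le_ofReal hq)

theorem lipSeminorm_le_iff (hμ : D.IsNondegenerate μ) {q : ℝ} (hq : 0 < q) {a : ℝ} {L : ℝ≥0∞} :
    D.lipSeminorm μ q a f ≤ L ↔ ∀ Q : CubeIndex n,
      ∫⁻ x in D.cube Q, ‖f x - D.mean μ f (D.parent Q)‖ₑ ^ q ∂μ
        ≤ (L * μ (D.cube Q) ^ (1 / q + a)) ^ q := by
  simp only [lipSeminorm, iSup_le_iff]
  refine forall_congr' fun Q => ?_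
  rw [ENNReal.div_le_iff (ENNReal.rpow_pos (hμ Q).1 (hμ Q).2.ne).ne'
    (ENNReal.rpow_ne_top_of_ne_zero (hμ Q).1.ne' (hμ Q).2.ne), one_div,
    ENNReal.rpow_inv_le_iff hq]

theorem lintegral_rpow_le_lipSeminorm (hμ : D.IsNondegenerate μ) {q : ℝ} (hq : 0 < q) (a : ℝ)
    (f : (Fin n → ℝ) → ℝ) (Q : CubeIndex n) :
    ∫⁻ x in D.cube Q, ‖f x - D.mean μ f (D.parent Q)‖ₑ ^ q ∂μ
      ≤ (D.lipSeminorm μ q a f * μ (D.cube Q) ^ (1 / q + a)) ^ q :=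
  (lipSeminorm_le_iff hμ hq).1 le_rfl Q

theorem lintegral_le_lipSeminorm_one (hμ : D.IsNondegenerate μ) (a : ℝ)
    (f : (Fin n → ℝ) → ℝ) (Q : CubeIndex n) :
    ∫⁻ x in D.cube Q, ‖f x - D.mean μ f (D.parent Q)‖ₑ ∂μ
      ≤ D.lipSeminorm μ 1 a f * μ (D.cube Q) ^ a * μ (D.cube Q) := by
  have h := lintegral_rpow_le_lipSeminorm hμ one_pos a f Q
  simp only [ENNReal.rpow_one, div_one] at h
  rwa [ENNReal.rpow_add _ _ (hμ Q).1.ne' (hμ Q).2.ne, ENNReal.rpow_one, mul_comm (μ _),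
    ← mul_assoc] at h

theorem abs_mean_sub_mean_parent_le (hμ : D.IsNondegenerate μ) {a : ℝ}
    (hf : ∀ Q, IntegrableOn f (D.cube Q) μ) (hL : D.lipSeminorm μ 1 a f ≠ ∞) (Q : CubeIndex n) :
    |D.mean μ f Q - D.mean μ f (D.parent Q)|
      ≤ (D.lipSeminorm μ 1 a f).toReal * μ.real (D.cube Q) ^ a := by
  have h0 := (hμ Q).1.ne'
  have h1 := (hμ Q).2.ne
  have h : ‖D.mean μ f Q - D.mean μ f (D.parent Q)‖ₑ
      ≤ D.lipSeminorm μ 1 a f * μ (D.cube Q) ^ a :=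
    (ENNReal.mul_le_mul_iff_left h0 h1).1 ((enorm_mean_sub_mul_le hμ (hf Q) _).trans
      (lintegral_le_lipSeminorm_one hμ a f Q))
  have h' := ENNReal.toReal_mono
    (ENNReal.mul_ne_top hL (ENNReal.rpow_ne_top_of_ne_zero h0 h1)) h
  rwa [toReal_enorm, Real.norm_eq_abs, ENNReal.toReal_mul, ← ENNReal.toReal_rpow] at h'

theorem lipSeminorm_mono_exponent (hμ : D.IsNondegenerate μ) {p q : ℝ} (hp : 0 < p) (hpq : p ≤ q)
    (a : ℝ) (hf : ∀ Q, IntegrableOn f (D.cube Q) μ) :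
    D.lipSeminorm μ p a f ≤ D.lipSeminorm μ q a f := by
  rw [lipSeminorm_le_iff hμ hp]
  intro Q
  have hJensen := eLpNorm'_le_eLpNorm'_mul_rpow_measure_univ hp hpq
    ((hf Q).aestronglyMeasurable.sub (aestronglyMeasurable_const (b := D.mean μ f (D.parent Q))))
  simp only [eLpNorm', Measure.restrict_apply_univ, Pi.sub_apply] at hJensen
  have hq : (∫⁻ x in D.cube Q, ‖f x - D.mean μ f (D.parent Q)‖ₑ ^ q ∂μ) ^ (1 / q)
      ≤ D.lipSeminorm μ q a f * μ (D.cube Q) ^ (1 / q + a) := by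
    rw [one_div, ENNReal.rpow_inv_le_iff (hp.trans_le hpq), ← one_div]
    exact lintegral_rpow_le_lipSeminorm hμ (hp.trans_le hpq) a f Q
  rw [← ENNReal.rpow_inv_le_iff hp, ← one_div]
  refine (hJensen.trans (mul_le_mul_left hq _)).trans_eq ?_
  rw [mul_assoc, ← ENNReal.rpow_add _ _ (hμ Q).1.ne' (hμ Q).2.ne]
  congr 2
  ring

theorem exists_lipSeminorm_le_mul_lipSeminorm_one (hμ : D.IsNondegenerate μ) {p : ℝ} (hp : 0 < p)
    {a : ℝ} (ha : 0 ≤ a) :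
    ∃ K : ℝ≥0, ∀ f : (Fin n → ℝ) → ℝ, (∀ Q, IntegrableOn f (D.cube Q) μ) →
      D.lipSeminorm μ p a f ≤ K * D.lipSeminorm μ 1 a f := by
  set K : ℝ≥0∞ := johnNirenbergConst p ^ (1 / p) * 2
  have hK : K ≠ ∞ := ENNReal.mul_ne_top (ENNReal.rpow_ne_top_of_ne_zero
    (johnNirenbergConst_ne_zero p) (johnNirenbergConst_ne_top p)) ENNReal.ofNat_ne_top
  refine ⟨K.toNNReal, fun f hf => ?_⟩
  rw [ENNReal.coe_toNNReal hK, lipSeminorm_le_iff hμ hp]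
  intro P
  set L := D.lipSeminorm μ 1 a f
  calc ∫⁻ x in D.cube P, ‖f x - D.mean μ f (D.parent P)‖ₑ ^ p ∂μ
      ≤ johnNirenbergConst p * (2 * (L * μ (D.cube P) ^ a)) ^ p * μ (D.cube P) :=
        lintegral_sub_mean_parent_rpow_le hμ hf
          (fun R hR => (lintegral_le_lipSeminorm_one hμ a f R).trans (by gcongr)) hp
    _ = (K * L * μ (D.cube P) ^ (1 / p + a)) ^ p := by
        have hpow : ∀ t : ℝ≥0∞, (t ^ (1 / p)) ^ p = t := fun t => by
          rw [← ENNReal.rpow_mul, one_div_mul_cancel hp.ne', ENNReal.rpow_one]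
        rw [ENNReal.rpow_add _ _ (hμ P).1.ne' (hμ P).2.ne]
        simp only [K, ENNReal.mul_rpow_of_nonneg _ _ hp.le, hpow]
        ring

end DyadicSystem

/-! ### Haar functions on a single cube -/

namespace HaarSystem

variable {n : ℕ} {D : DyadicSystem n} {μ : Measure (Fin n → ℝ)} (H : HaarSystem D μ)

theorem h_eq_of_mem_child {Q R : CubeIndex n} (hR : R ∈ D.descendants 1 Q) (i : Fin (2 ^ n - 1))
    {x : Fin n → ℝ} (hx : x ∈ D.cube R) : H.h Q i x = H.h Q i (D.corner R) := by
  obtain ⟨c, hc⟩ := H.const_on_children Q i R hR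
  rw [hc x hx, hc _ (D.corner_mem_cube R)]

theorem h_eq_of_mem_cube {S P : CubeIndex n} (hg : S.1 < P.1) (i : Fin (2 ^ n - 1))
    {x : Fin n → ℝ} (hx : x ∈ D.cube P) : H.h S i x = H.h S i (D.corner P) := by
  by_cases hxS : x ∈ D.cube S
  · set R := D.cubeAt (S.1 + (1 : ℕ)) x
    have hR : R ∈ D.descendants 1 S := D.cubeAt_mem_descendants 1 hxS
    have hxR : x ∈ D.cube R := D.mem_cube_cubeAt _ _
    have hPR : D.cube P ⊆ D.cube R :=
      D.cube_subset_of_mem (by rw [(D.mem_descendants.1 hR).1]; push_cast; omega) hxR hx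
    rw [H.h_eq_of_mem_child hR i hxR, H.h_eq_of_mem_child hR i (hPR (D.corner_mem_cube P))]
  · have hcS : D.corner P ∉ D.cube S := fun hc =>
      hxS (D.cube_subset_of_mem hg.le hc (D.corner_mem_cube P) hx)
    rw [H.support S i x hxS, H.support S i _ hcS]

theorem h_eq_sum_indicator (Q : CubeIndex n) (i : Fin (2 ^ n - 1)) :
    H.h Q i = fun x => ∑ R ∈ D.descendants 1 Q,
      (D.cube R).indicator (fun _ => H.h Q i (D.corner R)) x := by
  funext x
  by_cases hx : x ∈ D.cube Q
  · have hR := D.cubeAt_mem_descendants 1 hx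
    have hxR : x ∈ D.cube (D.cubeAt (Q.1 + (1 : ℕ)) x) := D.mem_cube_cubeAt _ _
    rw [Finset.sum_eq_single _ _ fun h => absurd hR h, Set.indicator_of_mem hxR,
      H.h_eq_of_mem_child hR i hxR]
    intro S hS hne
    refine Set.indicator_of_notMem (fun hxS => hne ?_) _
    exact D.eq_of_mem_cube (D.mem_descendants.1 hS).1 hxS hxR
  · rw [H.support Q i x hx]
    refine (Finset.sum_eq_zero fun S hS => Set.indicator_of_notMem (fun hxS => hx ?_) _).symm
    exact (D.mem_descendants.1 hS).2 hxS

theorem measurable_h (Q : CubeIndex n) (i : Fin (2 ^ n - 1)) : Measurable (H.h Q i) := by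
  rw [H.h_eq_sum_indicator Q i]
  exact Finset.measurable_sum _ fun R _ => measurable_const.indicator (D.measurableSet_cube R)

theorem memLp_h (hμ : D.IsNondegenerate μ) (p : ℝ≥0∞) (Q : CubeIndex n) (i : Fin (2 ^ n - 1)) :
    MemLp (H.h Q i) p μ := by
  rw [H.h_eq_sum_indicator Q i]
  exact memLp_finsetSum _ fun R _ =>
    memLp_indicator_const p (D.measurableSet_cube R) _ (Or.inr (hμ R).2.ne)

theorem integrable_h (hμ : D.IsNondegenerate μ) (Q : CubeIndex n) (i : Fin (2 ^ n - 1)) :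
    Integrable (H.h Q i) μ :=
  memLp_one_iff_integrable.1 (H.memLp_h hμ 1 Q i)

theorem exists_bound_h (Q : CubeIndex n) (i : Fin (2 ^ n - 1)) :
    ∃ B : ℝ, ∀ x, ‖H.h Q i x‖ ≤ B := by
  refine ⟨∑ R ∈ D.descendants 1 Q, ‖H.h Q i (D.corner R)‖, fun x => ?_⟩
  by_cases hx : x ∈ D.cube Q
  · have hR := D.cubeAt_mem_descendants 1 hx
    rw [H.h_eq_of_mem_child hR i (D.mem_cube_cubeAt _ _)]
    exact Finset.single_le_sum (f := fun R => ‖H.h Q i (D.corner R)‖)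
      (fun _ _ => norm_nonneg _) hR
  · rw [H.support Q i x hx, norm_zero]
    exact Finset.sum_nonneg fun _ _ => norm_nonneg _

theorem integrableOn_mul_h {f : (Fin n → ℝ) → ℝ} {Q S : CubeIndex n}
    (hf : IntegrableOn f (D.cube Q) μ) (i : Fin (2 ^ n - 1)) :
    IntegrableOn (fun x => f x * H.h S i x) (D.cube Q) μ := by
  obtain ⟨B, hB⟩ := H.exists_bound_h S i
  exact Integrable.mul_bdd (c := B) hf (H.measurable_h S i).aestronglyMeasurable
    (Eventually.of_forall hB)

theorem integral_mul_h_eq_setIntegral (f : (Fin n → ℝ) → ℝ) {P Q : CubeIndex n}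
    (hQ : D.cube Q ⊆ D.cube P) (i : Fin (2 ^ n - 1)) :
    ∫ x, f x * H.h Q i x ∂μ = ∫ x in D.cube P, f x * H.h Q i x ∂μ :=
  (setIntegral_eq_integral_of_forall_compl_eq_zero fun x hx => by
    rw [H.support Q i x fun h => hx (hQ h), mul_zero]).symm

theorem integral_mul_h_eq_sum {f : (Fin n → ℝ) → ℝ} {Q : CubeIndex n}
    (hf : IntegrableOn f (D.cube Q) μ) (i : Fin (2 ^ n - 1)) :
    ∫ x, f x * H.h Q i x ∂μ
      = ∑ R ∈ D.descendants 1 Q, H.h Q i (D.corner R) * ∫ x in D.cube R, f x ∂μ := by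
  rw [H.integral_mul_h_eq_setIntegral f subset_rfl,
    D.integral_cube_eq_sum μ 1 Q (H.integrableOn_mul_h hf i)]
  refine Finset.sum_congr rfl fun R hR => ?_
  rw [mul_comm, ← integral_mul_const]
  exact setIntegral_congr_fun (D.measurableSet_cube R) fun x hx => by
    simp only [H.h_eq_of_mem_child hR i hx]

theorem setIntegral_h_eq_zero {P S : CubeIndex n} (hg : P.1 ≤ S.1) (i : Fin (2 ^ n - 1)) :
    ∫ x in D.cube P, H.h S i x ∂μ = 0 := by
  rcases D.disjoint_or_subset hg with h | h
  · refine setIntegral_eq_zero_of_forall_eq_zero fun x hx => H.support S i x ?_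
    exact Set.disjoint_left.1 h hx
  · rw [setIntegral_eq_integral_of_forall_compl_eq_zero, H.integral_eq_zero]
    exact fun x hx => H.support S i x fun hxS => hx (h hxS)

theorem sum_h_mul_measureReal (hμ : D.IsNondegenerate μ) (Q : CubeIndex n)
    (i : Fin (2 ^ n - 1)) :
    ∑ R ∈ D.descendants 1 Q, H.h Q i (D.corner R) * μ.real (D.cube R) = 0 := by
  have h := H.integral_mul_h_eq_sum (DyadicSystem.integrableOn_const_cube hμ Q 1) i
  simp only [one_mul, H.integral_eq_zero, setIntegral_const, smul_eq_mul, mul_one] at h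
  exact h.symm

theorem integral_h_mul_h_eq_sum (hμ : D.IsNondegenerate μ) (Q : CubeIndex n)
    (i j : Fin (2 ^ n - 1)) :
    ∫ x, H.h Q i x * H.h Q j x ∂μ = ∑ R ∈ D.descendants 1 Q,
      H.h Q i (D.corner R) * H.h Q j (D.corner R) * μ.real (D.cube R) := by
  rw [H.integral_mul_h_eq_sum (H.integrable_h hμ Q i).integrableOn j]
  refine Finset.sum_congr rfl fun R hR => ?_
  rw [setIntegral_congr_fun (g := fun _ => H.h Q i (D.corner R)) (D.measurableSet_cube R)
    fun x hx => H.h_eq_of_mem_child hR i hx, setIntegral_const, smul_eq_mul]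
  ring

/-- The values on the children `S` of `Q` of the functions that, up to normalisation, form an
orthonormal basis of the functions on `Q` constant on its children: the indicator of `Q`, divided
by `μ(Q) ^ (1/2)` (index `none`), and the Haar functions attached to `Q`. -/
noncomputable def childValue (Q : CubeIndex n) : Option (Fin (2 ^ n - 1)) → CubeIndex n → ℝ
  | none, _ => (√(μ.real (D.cube Q)))⁻¹
  | some i, S => H.h Q i (D.corner S)

theorem sum_childValue_mul_childValue (hμ : D.IsNondegenerate μ) (Q : CubeIndex n)
    (o o' : Option (Fin (2 ^ n - 1))) :
    ∑ S ∈ D.descendants 1 Q, H.childValue Q o S * H.childValue Q o' S * μ.real (D.cube S)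
      = if o = o' then 1 else 0 := by
  have hQ := DyadicSystem.measureReal_cube_pos hμ Q
  have hconst : ∀ i, ∑ S ∈ D.descendants 1 Q,
      H.h Q i (D.corner S) * (√(μ.real (D.cube Q)))⁻¹ * μ.real (D.cube S) = 0 := fun i => by
    simp only [mul_right_comm _ (√(μ.real (D.cube Q)))⁻¹]
    rw [← Finset.sum_mul, H.sum_h_mul_measureReal hμ, zero_mul]
  rcases o with _ | i <;> rcases o' with _ | j
  · simp only [childValue, if_true]
    rw [← Finset.mul_sum, ← DyadicSystem.measureReal_cube_eq_sum hμ, ← mul_inv,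
      Real.mul_self_sqrt hQ.le, inv_mul_cancel₀ hQ.ne']
  · simpa only [childValue, mul_comm (√(μ.real (D.cube Q)))⁻¹, reduceCtorEq, if_false]
      using hconst j
  · simpa only [childValue, reduceCtorEq, if_false] using hconst i
  · simp only [childValue, Option.some.injEq]
    rw [← H.integral_h_mul_h_eq_sum hμ]
    split_ifs with hij
    · rw [hij, H.normalized]
    · exact H.orthogonal Q i Q j (by simpa using hij)

/-- The square matrix with entries `v(S) μ(S) ^ (1/2)`, where `v` is one of the functions of
`childValue` and `S` a child of `Q`. -/
noncomputable def childMatrix (Q : CubeIndex n) :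
    Matrix (Option (Fin (2 ^ n - 1))) (D.descendants 1 Q) ℝ :=
  Matrix.of fun o S => H.childValue Q o S * √(μ.real (D.cube S))

theorem childMatrix_mul_transpose (hμ : D.IsNondegenerate μ) (Q : CubeIndex n) :
    H.childMatrix Q * (H.childMatrix Q).transpose = 1 := by
  ext o o'
  rw [Matrix.mul_apply, Matrix.one_apply, ← H.sum_childValue_mul_childValue hμ,
    ← Finset.sum_coe_sort _ fun S => H.childValue Q o S * H.childValue Q o' S * μ.real (D.cube S)]
  refine Finset.sum_congr rfl fun S _ => ?_
  simp only [childMatrix, Matrix.transpose_apply, Matrix.of_apply]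
  rw [mul_mul_mul_comm, Real.mul_self_sqrt measureReal_nonneg]

-- Both index sets have `2 ^ n` elements, so orthonormal rows make orthonormal columns.
theorem transpose_mul_childMatrix (hμ : D.IsNondegenerate μ) (Q : CubeIndex n) :
    (H.childMatrix Q).transpose * H.childMatrix Q = 1 := by
  classical
  refine (Matrix.mul_eq_one_comm_of_card_eq _ _ _ ?_).1 (H.childMatrix_mul_transpose hμ Q)
  rw [Fintype.card_option, Fintype.card_fin, Fintype.card_coe, D.card_descendants, mul_one]
  exact Nat.sub_add_cancel Nat.one_le_two_pow

theorem sum_sq_mul_measureReal_add (hμ : D.IsNondegenerate μ) {Q R : CubeIndex n}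
    (hR : R ∈ D.descendants 1 Q) :
    (∑ i, H.h Q i (D.corner R) ^ 2) * μ.real (D.cube R)
      + μ.real (D.cube R) / μ.real (D.cube Q) = 1 := by
  have hcol := congrFun (congrFun (H.transpose_mul_childMatrix hμ Q) ⟨R, hR⟩) ⟨R, hR⟩
  rw [Matrix.mul_apply, Matrix.one_apply_eq, Fintype.sum_option] at hcol
  simp only [childMatrix, childValue, Matrix.transpose_apply, Matrix.of_apply, mul_mul_mul_comm,
    Real.mul_self_sqrt measureReal_nonneg, ← mul_inv] at hcol
  rw [← Finset.sum_mul] at hcol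
  simp only [pow_two]
  rw [div_eq_inv_mul]
  linarith

end HaarSystem

/-! ### Consequences of balance -/

namespace HaarSystem

open DyadicSystem

variable {n : ℕ} {D : DyadicSystem n} {μ : Measure (Fin n → ℝ)} (H : HaarSystem D μ)

/-- `‖h_Q^i‖_{L¹}` as a real number. -/
noncomputable def normOne (Q : CubeIndex n) (i : Fin (2 ^ n - 1)) : ℝ :=
  (eLpNorm (H.h Q i) 1 μ).toReal

/-- `‖h_Q^i‖_{L^∞}` as a real number. -/
noncomputable def normTop (Q : CubeIndex n) (i : Fin (2 ^ n - 1)) : ℝ :=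
  (eLpNorm (H.h Q i) ∞ μ).toReal

theorem normOne_nonneg (Q : CubeIndex n) (i : Fin (2 ^ n - 1)) : 0 ≤ H.normOne Q i :=
  ENNReal.toReal_nonneg

theorem normTop_nonneg (Q : CubeIndex n) (i : Fin (2 ^ n - 1)) : 0 ≤ H.normTop Q i :=
  ENNReal.toReal_nonneg

theorem normOne_eq_sum (hμ : D.IsNondegenerate μ) (Q : CubeIndex n) (i : Fin (2 ^ n - 1)) :
    H.normOne Q i = ∑ R ∈ D.descendants 1 Q, |H.h Q i (D.corner R)| * μ.real (D.cube R) := by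
  rw [normOne, eLpNorm_one_eq_lintegral_enorm, ← integral_norm_eq_lintegral_enorm
      (H.measurable_h Q i).aestronglyMeasurable,
    ← setIntegral_eq_integral_of_forall_compl_eq_zero (s := D.cube Q)
      (fun x hx => by rw [H.support Q i x hx, norm_zero]),
    D.integral_cube_eq_sum μ 1 Q (H.integrable_h hμ Q i).norm.integrableOn]
  refine Finset.sum_congr rfl fun R hR => ?_
  rw [setIntegral_congr_fun (g := fun _ => |H.h Q i (D.corner R)|) (D.measurableSet_cube R)
    fun x hx => by simp only [Real.norm_eq_abs, H.h_eq_of_mem_child hR i hx],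
    setIntegral_const, smul_eq_mul, mul_comm]

theorem abs_h_mul_measureReal_le_normOne (hμ : D.IsNondegenerate μ) {Q R : CubeIndex n}
    (hR : R ∈ D.descendants 1 Q) (i : Fin (2 ^ n - 1)) :
    |H.h Q i (D.corner R)| * μ.real (D.cube R) ≤ H.normOne Q i := by
  rw [H.normOne_eq_sum hμ]
  exact Finset.single_le_sum (f := fun R => |H.h Q i (D.corner R)| * μ.real (D.cube R))
    (fun S _ => mul_nonneg (abs_nonneg _) measureReal_nonneg) hR

theorem abs_h_le_normTop (hμ : D.IsNondegenerate μ) {Q R : CubeIndex n}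
    (hR : R ∈ D.descendants 1 Q) (i : Fin (2 ^ n - 1)) :
    |H.h Q i (D.corner R)| ≤ H.normTop Q i := by
  have hae : ∀ᵐ x ∂μ, ‖H.h Q i x‖ₑ ≤ eLpNorm (H.h Q i) ∞ μ := by
    rw [eLpNorm_exponent_top]
    exact enorm_ae_le_eLpNormEssSup _ _
  obtain ⟨x, hx, hle⟩ : ∃ x ∈ D.cube R, ‖H.h Q i x‖ₑ ≤ eLpNorm (H.h Q i) ∞ μ := by
    by_contra! hc
    exact (hμ R).1.ne' (measure_mono_null (fun x hx => not_le.2 (hc x hx)) (ae_iff.1 hae))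
  rw [H.h_eq_of_mem_child hR i hx] at hle
  simpa only [normTop, toReal_enorm, Real.norm_eq_abs] using
    ENNReal.toReal_mono (H.memLp_h hμ ∞ Q i).2.ne hle

theorem one_le_normOne_mul_normTop (hμ : D.IsNondegenerate μ) (Q : CubeIndex n)
    (i : Fin (2 ^ n - 1)) : 1 ≤ H.normOne Q i * H.normTop Q i := by
  rw [← H.normalized Q i, H.integral_h_mul_h_eq_sum hμ, H.normOne_eq_sum hμ, Finset.sum_mul]
  refine Finset.sum_le_sum fun R hR => ?_
  rw [← abs_mul_abs_self, mul_right_comm]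
  gcongr
  exact H.abs_h_le_normTop hμ hR i

theorem normOne_pos (hμ : D.IsNondegenerate μ) (Q : CubeIndex n) (i : Fin (2 ^ n - 1)) :
    0 < H.normOne Q i :=
  pos_of_mul_pos_left (zero_lt_one.trans_le (H.one_le_normOne_mul_normTop hμ Q i))
    (H.normTop_nonneg Q i)

theorem one_le_normTop_sq_mul_measureReal (hμ : D.IsNondegenerate μ) (Q : CubeIndex n)
    (i : Fin (2 ^ n - 1)) : 1 ≤ H.normTop Q i ^ 2 * μ.real (D.cube Q) := by
  rw [← H.normalized Q i, H.integral_h_mul_h_eq_sum hμ, measureReal_cube_eq_sum hμ 1,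
    Finset.mul_sum]
  refine Finset.sum_le_sum fun R hR => mul_le_mul_of_nonneg_right ?_ measureReal_nonneg
  rw [← abs_mul_abs_self, ← pow_two]
  exact pow_le_pow_left₀ (abs_nonneg _) (H.abs_h_le_normTop hμ hR i) 2

/-- The balanced condition with an explicit real constant. -/
def BalancedWith (K : ℝ) : Prop :=
  ∀ Q, ∀ R ∈ D.descendants 1 Q, ∀ i j,
    H.normOne Q i * H.normTop R j ≤ K ∧ H.normTop Q i * H.normOne R j ≤ K

variable {H}

theorem Balanced.exists_balancedWith (hbal : H.Balanced) : ∃ K, 1 ≤ K ∧ H.BalancedWith K := by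
  set B : ℝ≥0∞ := ⨆ (Q : CubeIndex n) (R ∈ D.descendants 1 Q) (i : Fin (2 ^ n - 1))
    (j : Fin (2 ^ n - 1)), (eLpNorm (H.h Q i) 1 μ * eLpNorm (H.h R j) ∞ μ +
      eLpNorm (H.h Q i) ∞ μ * eLpNorm (H.h R j) 1 μ)
  have hB : B ≠ ∞ := ne_of_lt hbal
  refine ⟨max 1 B.toReal, le_max_left _ _, fun Q R hR i j => ?_⟩
  have hle : eLpNorm (H.h Q i) 1 μ * eLpNorm (H.h R j) ∞ μ +
      eLpNorm (H.h Q i) ∞ μ * eLpNorm (H.h R j) 1 μ ≤ B :=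
    le_iSup_of_le Q (le_iSup_of_le R (le_iSup_of_le hR
      (le_iSup_of_le i (le_iSup_of_le j le_rfl))))
  rw [normOne, normTop, normTop, normOne, ← ENNReal.toReal_mul, ← ENNReal.toReal_mul]
  exact ⟨le_max_of_le_right (ENNReal.toReal_mono hB (le_self_add.trans hle)),
    le_max_of_le_right (ENNReal.toReal_mono hB (le_add_self.trans hle))⟩

namespace BalancedWith

variable {K : ℝ} (hK : H.BalancedWith K) (hμ : D.IsNondegenerate μ)
include hK hμ

theorem normOne_le_mul_child {Q R : CubeIndex n} (hR : R ∈ D.descendants 1 Q)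
    (i j : Fin (2 ^ n - 1)) : H.normOne Q i ≤ K * H.normOne R j :=
  calc H.normOne Q i ≤ H.normOne Q i * (H.normOne R j * H.normTop R j) :=
        le_mul_of_one_le_right (H.normOne_nonneg Q i) (H.one_le_normOne_mul_normTop hμ R j)
    _ = H.normOne Q i * H.normTop R j * H.normOne R j := by ring
    _ ≤ K * H.normOne R j :=
        mul_le_mul_of_nonneg_right (hK Q R hR i j).1 (H.normOne_nonneg R j)

theorem normOne_child_le_mul {Q R : CubeIndex n} (hR : R ∈ D.descendants 1 Q)
    (i j : Fin (2 ^ n - 1)) : H.normOne R j ≤ K * H.normOne Q i :=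
  calc H.normOne R j ≤ H.normOne R j * (H.normOne Q i * H.normTop Q i) :=
        le_mul_of_one_le_right (H.normOne_nonneg R j) (H.one_le_normOne_mul_normTop hμ Q i)
    _ = H.normTop Q i * H.normOne R j * H.normOne Q i := by ring
    _ ≤ K * H.normOne Q i :=
        mul_le_mul_of_nonneg_right (hK Q R hR i j).2 (H.normOne_nonneg Q i)

omit hμ in
theorem nonneg (i : Fin (2 ^ n - 1)) : 0 ≤ K := by
  have hc := D.cubeAt_mem_descendants 1 (D.corner_mem_cube (0, 0))
  exact (mul_nonneg (H.normOne_nonneg _ i) (H.normTop_nonneg _ i)).trans (hK _ _ hc i i).1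

theorem normOne_le_sq_mul (Q : CubeIndex n) (i j : Fin (2 ^ n - 1)) :
    H.normOne Q i ≤ K ^ 2 * H.normOne Q j := by
  obtain ⟨R, hR⟩ := D.descendants_nonempty 1 Q
  calc H.normOne Q i ≤ K * H.normOne R j := hK.normOne_le_mul_child hμ hR i j
    _ ≤ K * (K * H.normOne Q j) :=
        mul_le_mul_of_nonneg_left (hK.normOne_child_le_mul hμ hR j j) (hK.nonneg i)
    _ = K ^ 2 * H.normOne Q j := by ring

theorem normTop_mul_normOne_le (Q : CubeIndex n) (i j : Fin (2 ^ n - 1)) :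
    H.normTop Q i * H.normOne Q j ≤ K ^ 2 := by
  obtain ⟨R, hR⟩ := D.descendants_nonempty 1 Q
  calc H.normTop Q i * H.normOne Q j ≤ H.normTop Q i * (K * H.normOne R j) :=
        mul_le_mul_of_nonneg_left (hK.normOne_le_mul_child hμ hR j j) (H.normTop_nonneg Q i)
    _ = K * (H.normTop Q i * H.normOne R j) := by ring
    _ ≤ K * K := mul_le_mul_of_nonneg_left (hK Q R hR i j).2 (hK.nonneg i)
    _ = K ^ 2 := by ring

theorem normOne_sq_le (Q : CubeIndex n) (i : Fin (2 ^ n - 1)) :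
    H.normOne Q i ^ 2 ≤ K ^ 4 * μ.real (D.cube Q) :=
  calc H.normOne Q i ^ 2 ≤ H.normOne Q i ^ 2 * (H.normTop Q i ^ 2 * μ.real (D.cube Q)) :=
        le_mul_of_one_le_right (sq_nonneg _) (H.one_le_normTop_sq_mul_measureReal hμ Q i)
    _ = (H.normTop Q i * H.normOne Q i) ^ 2 * μ.real (D.cube Q) := by ring
    _ ≤ (K ^ 2) ^ 2 * μ.real (D.cube Q) := by
        refine mul_le_mul_of_nonneg_right (pow_le_pow_left₀ ?_ ?_ 2) measureReal_nonneg
        · exact mul_nonneg (H.normTop_nonneg Q i) (H.normOne_nonneg Q i)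
        · exact hK.normTop_mul_normOne_le hμ Q i i
    _ = K ^ 4 * μ.real (D.cube Q) := by ring

end BalancedWith

variable (H) in
/-- `b` is a scale for the Haar system, with constant `K`: a positive number `b Q` for every cube,
comparable to the `L¹`-norms and to the inverses of the `L^∞`-norms of the Haar functions attached
to `Q`, and slowly varying along the dyadic tree. -/
structure IsScale (b : CubeIndex n → ℝ) (K : ℝ) : Prop where
  one_le : 1 ≤ K
  pos : ∀ Q, 0 < b Q
  le_mul_child : ∀ Q, ∀ R ∈ D.descendants 1 Q, b Q ≤ K * b R
  child_le_mul : ∀ Q, ∀ R ∈ D.descendants 1 Q, b R ≤ K * b Q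
  abs_h_mul_measureReal_le : ∀ Q i, ∀ R ∈ D.descendants 1 Q,
    |H.h Q i (D.corner R)| * μ.real (D.cube R) ≤ K * b Q
  abs_h_mul_le : ∀ Q i, ∀ R ∈ D.descendants 1 Q, |H.h Q i (D.corner R)| * b Q ≤ K
  sq_le : ∀ Q, b Q ^ 2 ≤ K * μ.real (D.cube Q)

theorem BalancedWith.isScale_normOne {K : ℝ} (hK : H.BalancedWith K) (hK1 : 1 ≤ K)
    (hμ : D.IsNondegenerate μ) (i₀ : Fin (2 ^ n - 1)) :
    H.IsScale (fun Q => H.normOne Q i₀) (K ^ 4) := by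
  have hK4 : K ≤ K ^ 4 := le_self_pow₀ hK1 (by norm_num)
  have hK24 : K ^ 2 ≤ K ^ 4 := pow_le_pow_right₀ hK1 (by norm_num)
  refine ⟨one_le_pow₀ hK1, fun Q => H.normOne_pos hμ Q i₀, fun Q R hR => ?_, fun Q R hR => ?_,
    fun Q i R hR => ?_, fun Q i R hR => ?_, fun Q => hK.normOne_sq_le hμ Q i₀⟩
  · exact (hK.normOne_le_mul_child hμ hR i₀ i₀).trans
      (mul_le_mul_of_nonneg_right hK4 (H.normOne_nonneg R i₀))
  · exact (hK.normOne_child_le_mul hμ hR i₀ i₀).trans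
      (mul_le_mul_of_nonneg_right hK4 (H.normOne_nonneg Q i₀))
  · exact (H.abs_h_mul_measureReal_le_normOne hμ hR i).trans ((hK.normOne_le_sq_mul hμ Q i i₀).trans
      (mul_le_mul_of_nonneg_right hK24 (H.normOne_nonneg Q i₀)))
  · exact (mul_le_mul_of_nonneg_right (H.abs_h_le_normTop hμ hR i) (H.normOne_nonneg Q i₀)).trans
      ((hK.normTop_mul_normOne_le hμ Q i i₀).trans hK24)

theorem Balanced.exists_isScale (hbal : H.Balanced) (hn : 1 ≤ n) (hμ : D.IsNondegenerate μ) :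
    ∃ (b : CubeIndex n → ℝ) (K : ℝ), H.IsScale b K := by
  obtain ⟨K, hK1, hK⟩ := hbal.exists_balancedWith
  have hpos : 0 < 2 ^ n - 1 := Nat.sub_pos_of_lt (Nat.one_lt_two_pow (by omega))
  exact ⟨_, _, hK.isScale_normOne hK1 hμ ⟨0, hpos⟩⟩

theorem IsScale.le_pow_mul_of_mem_descendants {b : CubeIndex n → ℝ} {K : ℝ} (hb : H.IsScale b K)
    {m : ℕ} {Q R : CubeIndex n} (hR : R ∈ D.descendants m Q) :
    b R ≤ K ^ m * b Q ∧ b Q ≤ K ^ m * b R := by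
  have hK : 0 ≤ K := zero_le_one.trans hb.one_le
  induction m generalizing R with
  | zero =>
    obtain ⟨h1, h2⟩ := D.mem_descendants.1 hR
    have : R = Q := D.eq_of_mem_cube (by simpa using h1) (D.corner_mem_cube R)
      (h2 (D.corner_mem_cube R))
    simp [this]
  | succ m ih =>
    obtain ⟨S, hS, hRS⟩ := D.exists_mem_descendants_of_succ hR
    obtain ⟨h1, h2⟩ := ih hS
    constructor
    · calc b R ≤ K * b S := hb.child_le_mul S R hRS
        _ ≤ K * (K ^ m * b Q) := mul_le_mul_of_nonneg_left h1 hK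
        _ = K ^ (m + 1) * b Q := by ring
    · calc b Q ≤ K ^ m * b S := h2
        _ ≤ K ^ m * (K * b R) := by gcongr; exact hb.le_mul_child S R hRS
        _ = K ^ (m + 1) * b R := by ring

-- Some Haar function attached to `Q` has size `≳ μ(R) ^ (-1/2)` on `R`.
theorem IsScale.measureReal_le_of_two_mul_le {b : CubeIndex n → ℝ} {K : ℝ} (hb : H.IsScale b K)
    (hμ : D.IsNondegenerate μ) {Q R : CubeIndex n} (hR : R ∈ D.descendants 1 Q)
    (hRQ : 2 * μ.real (D.cube R) ≤ μ.real (D.cube Q)) :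
    μ.real (D.cube R) ≤ 2 * (2 ^ n - 1 : ℕ) * K ^ 2 * b Q ^ 2 := by
  have hR0 := measureReal_cube_pos hμ R
  have hhalf : 1 / 2 ≤ (∑ i, H.h Q i (D.corner R) ^ 2) * μ.real (D.cube R) := by
    have hratio : μ.real (D.cube R) / μ.real (D.cube Q) ≤ 1 / 2 := by
      rw [div_le_iff₀ (measureReal_cube_pos hμ Q)]
      linarith
    linarith [H.sum_sq_mul_measureReal_add hμ hR]
  have hsum : (∑ i, H.h Q i (D.corner R) ^ 2) * μ.real (D.cube R) ^ 2
      ≤ (2 ^ n - 1 : ℕ) * (K * b Q) ^ 2 := by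
    rw [Finset.sum_mul]
    refine (Finset.sum_le_card_nsmul _ _ ((K * b Q) ^ 2) fun i _ => ?_).trans
      (by simp only [Finset.card_univ, Fintype.card_fin, nsmul_eq_mul, le_refl])
    rw [← sq_abs, ← mul_pow]
    exact pow_le_pow_left₀ (by positivity) (hb.abs_h_mul_measureReal_le Q i R hR) 2
  linarith [mul_le_mul_of_nonneg_right hhalf hR0.le]

theorem sum_measureReal_mul_mean_sub {f : (Fin n → ℝ) → ℝ} (hμ : D.IsNondegenerate μ)
    {Q : CubeIndex n} (hf : IntegrableOn f (D.cube Q) μ) :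
    ∑ R ∈ D.descendants 1 Q, μ.real (D.cube R) * (D.mean μ f R - D.mean μ f Q) = 0 := by
  simp only [mul_comm (μ.real _), sub_mul]
  simp only [mean_mul hμ]
  rw [Finset.sum_sub_distrib, ← D.integral_cube_eq_sum μ 1 Q hf, ← Finset.mul_sum,
    ← measureReal_cube_eq_sum hμ, mean_mul hμ, sub_self]

variable (H) in
theorem integral_mul_h_eq_sum_erase {f : (Fin n → ℝ) → ℝ} (hμ : D.IsNondegenerate μ)
    {Q Z : CubeIndex n} (hf : IntegrableOn f (D.cube Q) μ) (hZ : Z ∈ D.descendants 1 Q)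
    (i : Fin (2 ^ n - 1)) :
    ∫ x, f x * H.h Q i x ∂μ = ∑ R ∈ (D.descendants 1 Q).erase Z,
      (H.h Q i (D.corner R) - H.h Q i (D.corner Z)) * μ.real (D.cube R)
        * (D.mean μ f R - D.mean μ f Q) := by
  calc ∫ x, f x * H.h Q i x ∂μ
      = ∑ R ∈ D.descendants 1 Q, (H.h Q i (D.corner R) * (D.mean μ f R * μ.real (D.cube R))
          - H.h Q i (D.corner R) * μ.real (D.cube R) * D.mean μ f Q
          - H.h Q i (D.corner Z) * (μ.real (D.cube R) * (D.mean μ f R - D.mean μ f Q))) := by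
        rw [Finset.sum_sub_distrib, Finset.sum_sub_distrib, ← Finset.sum_mul, ← Finset.mul_sum,
          H.sum_h_mul_measureReal hμ, sum_measureReal_mul_mean_sub hμ hf, zero_mul, mul_zero,
          sub_zero, sub_zero, H.integral_mul_h_eq_sum hf]
        simp only [mean_mul hμ]
    _ = ∑ R ∈ D.descendants 1 Q, (H.h Q i (D.corner R) - H.h Q i (D.corner Z))
          * μ.real (D.cube R) * (D.mean μ f R - D.mean μ f Q) :=
        Finset.sum_congr rfl fun R _ => by ring
    _ = _ := by rw [← Finset.add_sum_erase _ _ hZ, sub_self, zero_mul, zero_mul, zero_add]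

theorem IsScale.abs_h_sub_h_mul_measureReal_le {b : CubeIndex n → ℝ} {K E : ℝ}
    (hb : H.IsScale b K) {Q R Z : CubeIndex n} (hR : R ∈ D.descendants 1 Q)
    (hZ : Z ∈ D.descendants 1 Q) (hE : μ.real (D.cube R) ≤ E * b Q ^ 2) (i : Fin (2 ^ n - 1)) :
    |(H.h Q i (D.corner R) - H.h Q i (D.corner Z)) * μ.real (D.cube R)| ≤ K * (1 + E) * b Q := by
  have hb0 := hb.pos Q
  have hE0 : 0 ≤ E := nonneg_of_mul_nonneg_left (measureReal_nonneg.trans hE) (pow_pos hb0 2)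
  calc |(H.h Q i (D.corner R) - H.h Q i (D.corner Z)) * μ.real (D.cube R)|
      ≤ (|H.h Q i (D.corner R)| + |H.h Q i (D.corner Z)|) * μ.real (D.cube R) := by
        rw [abs_mul, abs_of_nonneg (measureReal_nonneg (μ := μ) (s := D.cube R))]
        exact mul_le_mul_of_nonneg_right (abs_sub _ _) measureReal_nonneg
    _ ≤ |H.h Q i (D.corner R)| * μ.real (D.cube R) + |H.h Q i (D.corner Z)| * (E * b Q ^ 2) := by
        rw [add_mul]
        gcongr
    _ = |H.h Q i (D.corner R)| * μ.real (D.cube R)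
          + |H.h Q i (D.corner Z)| * b Q * (E * b Q) := by ring
    _ ≤ K * b Q + K * (E * b Q) :=
        add_le_add (hb.abs_h_mul_measureReal_le Q i R hR)
          (mul_le_mul_of_nonneg_right (hb.abs_h_mul_le Q i Z hZ) (by positivity))
    _ = K * (1 + E) * b Q := by ring

theorem IsScale.exists_forall_erase_measureReal_le {b : CubeIndex n → ℝ} {K : ℝ}
    (hb : H.IsScale b K) (hμ : D.IsNondegenerate μ) (Q : CubeIndex n) :
    ∃ Z ∈ D.descendants 1 Q, ∀ R ∈ (D.descendants 1 Q).erase Z,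
      μ.real (D.cube R) ≤ 2 * (2 ^ n - 1 : ℕ) * K ^ 2 * b Q ^ 2 := by
  obtain ⟨Z, hZ, hmax⟩ := Finset.exists_max_image (D.descendants 1 Q) (fun R => μ.real (D.cube R))
    (D.descendants_nonempty 1 Q)
  refine ⟨Z, hZ, fun R hR => ?_⟩
  obtain ⟨hne, hR⟩ := Finset.mem_erase.1 hR
  have hpair : μ.real (D.cube R) + μ.real (D.cube Z) ≤ μ.real (D.cube Q) := by
    rw [measureReal_cube_eq_sum hμ 1 Q]
    exact Finset.add_le_sum (fun S _ => measureReal_nonneg) hR hZ hne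
  exact hb.measureReal_le_of_two_mul_le hμ hR (by linarith [hmax R hR])

-- Cancelling the term of the heaviest child leaves only children of mass `≲ b(Q) ^ 2`.
theorem IsScale.exists_abs_integral_mul_h_le {b : CubeIndex n → ℝ} {K : ℝ} (hb : H.IsScale b K)
    (hμ : D.IsNondegenerate μ) {a : ℝ} (ha : 0 ≤ a) :
    ∃ C : ℝ, 0 ≤ C ∧ ∀ f : (Fin n → ℝ) → ℝ, (∀ Q, IntegrableOn f (D.cube Q) μ) →
      D.lipSeminorm μ 1 a f ≠ ∞ → ∀ Q i,
        |∫ x, f x * H.h Q i x ∂μ|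
          ≤ C * (D.lipSeminorm μ 1 a f).toReal * (b Q ^ 2) ^ (1 / 2 + a) := by
  set E : ℝ := 2 * (2 ^ n - 1 : ℕ) * K ^ 2
  have hE : 0 ≤ E := by positivity
  have hK : 0 ≤ K := zero_le_one.trans hb.one_le
  refine ⟨2 ^ n * (K * (1 + E) * E ^ a), by positivity, fun f hf hL Q i => ?_⟩
  set L := (D.lipSeminorm μ 1 a f).toReal
  have hb0 := hb.pos Q
  obtain ⟨Z, hZ, hsmall⟩ := hb.exists_forall_erase_measureReal_le hμ Q
  have hterm : ∀ R ∈ (D.descendants 1 Q).erase Z,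
      |(H.h Q i (D.corner R) - H.h Q i (D.corner Z)) * μ.real (D.cube R)
        * (D.mean μ f R - D.mean μ f Q)| ≤ K * (1 + E) * b Q * (L * (E * b Q ^ 2) ^ a) := by
    intro R hR
    have hRQ := Finset.mem_of_mem_erase hR
    have hosc := abs_mean_sub_mean_parent_le hμ hf hL R
    rw [D.parent_of_mem_descendants hRQ] at hosc
    rw [abs_mul]
    refine mul_le_mul (hb.abs_h_sub_h_mul_measureReal_le hRQ hZ (hsmall R hR) i) (hosc.trans ?_)
      (abs_nonneg _) (by positivity)
    exact mul_le_mul_of_nonneg_left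
      (Real.rpow_le_rpow measureReal_nonneg (hsmall R hR) ha) ENNReal.toReal_nonneg
  have hcard : (((D.descendants 1 Q).erase Z).card : ℝ) ≤ 2 ^ n := by
    have := (Finset.card_erase_le (s := D.descendants 1 Q) (a := Z)).trans_eq
      (D.card_descendants 1 Q)
    rw [mul_one] at this
    exact_mod_cast this
  have hpow : b Q * (E * b Q ^ 2) ^ a = E ^ a * (b Q ^ 2) ^ (1 / 2 + a) := by
    rw [Real.mul_rpow hE (by positivity), Real.rpow_add (pow_pos hb0 2), ← Real.sqrt_eq_rpow,
      Real.sqrt_sq hb0.le]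
    ring
  rw [H.integral_mul_h_eq_sum_erase hμ (hf Q) hZ]
  calc _ ≤ _ := Finset.abs_sum_le_sum_abs _ _
    _ ≤ ((D.descendants 1 Q).erase Z).card • (K * (1 + E) * b Q * (L * (E * b Q ^ 2) ^ a)) :=
        Finset.sum_le_card_nsmul _ _ _ hterm
    _ ≤ 2 ^ n * (K * (1 + E) * b Q * (L * (E * b Q ^ 2) ^ a)) := by
        rw [nsmul_eq_mul]
        exact mul_le_mul_of_nonneg_right hcard (by positivity)
    _ = 2 ^ n * (K * (1 + E)) * L * (b Q * (E * b Q ^ 2) ^ a) := by ring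
    _ = 2 ^ n * (K * (1 + E) * E ^ a) * L * (b Q ^ 2) ^ (1 / 2 + a) := by rw [hpow]; ring

theorem IsScale.sq_le_mul_measureReal {b : CubeIndex n → ℝ} {K : ℝ} (hb : H.IsScale b K)
    {r m M : ℕ} (hm : m ≤ M) {Q R P : CubeIndex n} (hR : R ∈ D.descendants r Q)
    (hP : P ∈ D.descendants m Q) : b R ^ 2 ≤ (K ^ r * K ^ M) ^ 2 * K * μ.real (D.cube P) := by
  have hK : 0 ≤ K := zero_le_one.trans hb.one_le
  have hRP : b R ≤ K ^ r * K ^ M * b P := by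
    calc b R ≤ K ^ r * b Q := (hb.le_pow_mul_of_mem_descendants hR).1
      _ ≤ K ^ r * (K ^ m * b P) := by
          gcongr
          exact (hb.le_pow_mul_of_mem_descendants hP).2
      _ ≤ K ^ r * (K ^ M * b P) := by
          have := (hb.pos P).le
          gcongr
          exact hb.one_le
      _ = K ^ r * K ^ M * b P := by ring
  calc b R ^ 2 ≤ (K ^ r * K ^ M * b P) ^ 2 := pow_le_pow_left₀ (hb.pos R).le hRP 2
    _ = (K ^ r * K ^ M) ^ 2 * b P ^ 2 := by ring
    _ ≤ (K ^ r * K ^ M) ^ 2 * (K * μ.real (D.cube P)) := by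
        gcongr
        exact hb.sq_le P
    _ = (K ^ r * K ^ M) ^ 2 * K * μ.real (D.cube P) := by ring

theorem Balanced.exists_abs_integral_mul_h_le (hbal : H.Balanced) (hn : 1 ≤ n)
    (hμ : D.IsNondegenerate μ) {a : ℝ} (ha : 0 ≤ a) (r M : ℕ) :
    ∃ C : ℝ, 0 ≤ C ∧ ∀ f : (Fin n → ℝ) → ℝ, (∀ Q, IntegrableOn f (D.cube Q) μ) →
      D.lipSeminorm μ 1 a f ≠ ∞ → ∀ Q, ∀ R ∈ D.descendants r Q, ∀ m ≤ M,
        ∀ P ∈ D.descendants m Q, ∀ i,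
        |∫ x, f x * H.h R i x ∂μ|
          ≤ C * (D.lipSeminorm μ 1 a f).toReal * μ.real (D.cube P) ^ (1 / 2 + a) := by
  obtain ⟨b, K, hb⟩ := hbal.exists_isScale hn hμ
  obtain ⟨C, hC0, hC⟩ := hb.exists_abs_integral_mul_h_le hμ ha
  have hK : 0 ≤ K := zero_le_one.trans hb.one_le
  set E : ℝ := (K ^ r * K ^ M) ^ 2 * K
  refine ⟨C * E ^ (1 / 2 + a), by positivity, fun f hf hL Q R hR m hm P hP i => ?_⟩
  calc |∫ x, f x * H.h R i x ∂μ|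
      ≤ C * (D.lipSeminorm μ 1 a f).toReal * (b R ^ 2) ^ (1 / 2 + a) := hC f hf hL R i
    _ ≤ C * (D.lipSeminorm μ 1 a f).toReal * (E * μ.real (D.cube P)) ^ (1 / 2 + a) := by
        gcongr
        exact hb.sq_le_mul_measureReal hm hR hP
    _ = C * E ^ (1 / 2 + a) * (D.lipSeminorm μ 1 a f).toReal
          * μ.real (D.cube P) ^ (1 / 2 + a) := by
        rw [Real.mul_rpow (by positivity) measureReal_nonneg]
        ring

end HaarSystem

/-! ### Partial sums of a Haar shift -/

namespace HaarSystem

open DyadicSystem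

variable {n : ℕ} {D : DyadicSystem n} {μ : Measure (Fin n → ℝ)} (H : HaarSystem D μ)

section HaarExpansion

variable (hμ : D.IsNondegenerate μ)

/-- The Haar functions as elements of `L²(μ)`. -/
noncomputable def haarLp (p : CubeIndex n × Fin (2 ^ n - 1)) : Lp ℝ 2 μ :=
  (H.memLp_h hμ 2 p.1 p.2).toLp _

theorem inner_haarLp (p : CubeIndex n × Fin (2 ^ n - 1)) (f : Lp ℝ 2 μ) :
    inner ℝ (H.haarLp hμ p) f = ∫ x, f x * H.h p.1 p.2 x ∂μ := by
  rw [L2.inner_def]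
  refine integral_congr_ae ?_
  filter_upwards [(H.memLp_h hμ 2 p.1 p.2).coeFn_toLp] with x hx
  simp [haarLp, hx]

theorem orthonormal_haarLp : Orthonormal ℝ (H.haarLp hμ) := by
  rw [orthonormal_iff_ite]
  intro p p'
  have hinner : inner ℝ (H.haarLp hμ p) (H.haarLp hμ p')
      = ∫ x, H.h p'.1 p'.2 x * H.h p.1 p.2 x ∂μ := by
    rw [H.inner_haarLp hμ]
    refine integral_congr_ae ?_
    filter_upwards [(H.memLp_h hμ 2 p'.1 p'.2).coeFn_toLp] with x hx
    rw [haarLp, hx]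
  rw [hinner]
  split_ifs with h
  · rw [h, H.normalized]
  · exact H.orthogonal _ _ _ _ fun h' => h h'.symm

/-- The orthogonal projection of `f` to the span of the Haar functions with labels in `I`; it makes
sense for every locally integrable `f`. -/
noncomputable def haarProj (f : (Fin n → ℝ) → ℝ) (I : Finset (CubeIndex n × Fin (2 ^ n - 1))) :
    Lp ℝ 2 μ :=
  ∑ p ∈ I, (∫ x, f x * H.h p.1 p.2 x ∂μ) • H.haarLp hμ p

theorem integral_haarProj_mul_h (f : (Fin n → ℝ) → ℝ)
    (I : Finset (CubeIndex n × Fin (2 ^ n - 1))) (p : CubeIndex n × Fin (2 ^ n - 1)) :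
    ∫ x, H.haarProj hμ f I x * H.h p.1 p.2 x ∂μ
      = if p ∈ I then ∫ x, f x * H.h p.1 p.2 x ∂μ else 0 := by
  rw [← H.inner_haarLp hμ, haarProj, inner_sum]
  simp only [inner_smul_right, orthonormal_iff_ite.1 (H.orthonormal_haarLp hμ), mul_ite, mul_one,
    mul_zero]
  rw [Finset.sum_ite_eq]

theorem norm_haarProj_sq (f : (Fin n → ℝ) → ℝ) (I : Finset (CubeIndex n × Fin (2 ^ n - 1))) :
    ‖H.haarProj hμ f I‖ ^ 2 = ∑ p ∈ I, (∫ x, f x * H.h p.1 p.2 x ∂μ) ^ 2 := by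
  rw [← real_inner_self_eq_norm_sq, haarProj, (H.orthonormal_haarLp hμ).inner_sum]
  simp only [conj_trivial, pow_two]

end HaarExpansion

section HaarEnergy

theorem eq_of_mem_descendants {r : ℕ} {Q Q' R : CubeIndex n} (h : R ∈ D.descendants r Q)
    (h' : R ∈ D.descendants r Q') : Q = Q' := by
  obtain ⟨hg, hsub⟩ := D.mem_descendants.1 h
  obtain ⟨hg', hsub'⟩ := D.mem_descendants.1 h'
  exact D.eq_of_mem_cube (by omega) (hsub (D.corner_mem_cube R)) (hsub' (D.corner_mem_cube R))

/-- The sum of the squares of those Haar coefficients of `f` that enter the terms, indexed by `G`,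
of a Haar shift of complexity `(r, s)`. -/
noncomputable def haarEnergy (r : ℕ) (f : (Fin n → ℝ) → ℝ) (G : Finset (CubeIndex n)) : ℝ :=
  ∑ Q ∈ G, ∑ R ∈ D.descendants r Q, ∑ i, (∫ x, f x * H.h R i x ∂μ) ^ 2

variable (D) in
/-- The labels of the Haar functions attached to the `r`-th descendants of the cubes in `G`. -/
noncomputable def haarIndex (r : ℕ) (G : Finset (CubeIndex n)) :
    Finset (CubeIndex n × Fin (2 ^ n - 1)) :=
  G.biUnion (D.descendants r) ×ˢ Finset.univ

theorem mem_haarIndex {r : ℕ} {G : Finset (CubeIndex n)} {Q R : CubeIndex n}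
    (hR : R ∈ D.descendants r Q) (i : Fin (2 ^ n - 1)) : (R, i) ∈ haarIndex D r G ↔ Q ∈ G := by
  simp only [haarIndex, Finset.mem_product, Finset.mem_biUnion, Finset.mem_univ, and_true]
  exact ⟨fun ⟨Q', hQ', hR'⟩ => eq_of_mem_descendants hR hR' ▸ hQ', fun hQ => ⟨Q, hQ, hR⟩⟩

theorem haarEnergy_eq_sum (r : ℕ) (f : (Fin n → ℝ) → ℝ) (G : Finset (CubeIndex n)) :
    H.haarEnergy r f G = ∑ p ∈ haarIndex D r G, (∫ x, f x * H.h p.1 p.2 x ∂μ) ^ 2 := by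
  rw [haarIndex, Finset.sum_product, Finset.sum_biUnion]
  · rfl
  · intro Q _ Q' _ hne
    exact Finset.disjoint_left.2 fun R h h' => hne (eq_of_mem_descendants h h')

theorem haarEnergy_le_norm_sq (hμ : D.IsNondegenerate μ) (r : ℕ) (φ : Lp ℝ 2 μ)
    (G : Finset (CubeIndex n)) : H.haarEnergy r φ G ≤ ‖φ‖ ^ 2 := by
  rw [haarEnergy_eq_sum]
  refine (Finset.sum_le_sum fun p _ => ?_).trans
    ((H.orthonormal_haarLp hμ).sum_inner_products_le φ (s := haarIndex D r G))
  rw [H.inner_haarLp hμ, Real.norm_eq_abs, sq_abs]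

theorem haarEnergy_le_card_mul {r : ℕ} {f : (Fin n → ℝ) → ℝ} {G : Finset (CubeIndex n)} {W : ℝ}
    (hW : ∀ Q ∈ G, ∀ R ∈ D.descendants r Q, ∀ i, |∫ x, f x * H.h R i x ∂μ| ≤ W) :
    H.haarEnergy r f G ≤ G.card * (2 ^ (n * r) * ((2 ^ n - 1 : ℕ) * W ^ 2)) := by
  rw [haarEnergy, ← nsmul_eq_mul]
  refine Finset.sum_le_card_nsmul _ _ _ fun Q hQ => ?_
  refine (Finset.sum_le_card_nsmul _ _ ((2 ^ n - 1 : ℕ) * W ^ 2) fun R hR => ?_).trans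
    (by simp [D.card_descendants])
  refine (Finset.sum_le_card_nsmul _ _ (W ^ 2) fun i _ => ?_).trans (by simp)
  rw [← sq_abs]
  exact pow_le_pow_left₀ (abs_nonneg _) (hW Q hQ R hR i) 2

end HaarEnergy

section ShiftTerm

variable {r s : ℕ} {α : Coeff n}

theorem shiftTerm_congr {f g : (Fin n → ℝ) → ℝ} {Q : CubeIndex n}
    (h : ∀ R ∈ D.descendants r Q, ∀ i,
      ∫ x, f x * H.h R i x ∂μ = ∫ x, g x * H.h R i x ∂μ) :
    H.shiftTerm r s α f Q = H.shiftTerm r s α g Q := by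
  funext x
  refine Finset.sum_congr rfl fun R hR => Finset.sum_congr rfl fun S _ =>
    Finset.sum_congr rfl fun i _ => Finset.sum_congr rfl fun j _ => ?_
  rw [h R hR i]

theorem shiftTerm_eq_zero {f : (Fin n → ℝ) → ℝ} {Q : CubeIndex n}
    (h : ∀ R ∈ D.descendants r Q, ∀ i, ∫ x, f x * H.h R i x ∂μ = 0) (x : Fin n → ℝ) :
    H.shiftTerm r s α f Q x = 0 := by
  refine Finset.sum_eq_zero fun R hR => Finset.sum_eq_zero fun S _ =>
    Finset.sum_eq_zero fun i _ => Finset.sum_eq_zero fun j _ => ?_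
  rw [h R hR i, mul_zero, zero_mul]

theorem shiftTerm_of_notMem (f : (Fin n → ℝ) → ℝ) {Q : CubeIndex n} {x : Fin n → ℝ}
    (hx : x ∉ D.cube Q) : H.shiftTerm r s α f Q x = 0 := by
  refine Finset.sum_eq_zero fun R _ => Finset.sum_eq_zero fun S hS =>
    Finset.sum_eq_zero fun i _ => Finset.sum_eq_zero fun j _ => ?_
  rw [H.support S j x fun h => hx ((D.mem_descendants.1 hS).2 h), mul_zero]

theorem shiftTerm_eq_of_mem_cube (f : (Fin n → ℝ) → ℝ) {P Q : CubeIndex n}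
    (hg : Q.1 + s < P.1) {x : Fin n → ℝ} (hx : x ∈ D.cube P) :
    H.shiftTerm r s α f Q x = H.shiftTerm r s α f Q (D.corner P) := by
  refine Finset.sum_congr rfl fun R _ => Finset.sum_congr rfl fun S hS =>
    Finset.sum_congr rfl fun i _ => Finset.sum_congr rfl fun j _ => ?_
  rw [H.h_eq_of_mem_cube (by rwa [(D.mem_descendants.1 hS).1]) j hx]

theorem shiftTerm_eq_sum_mul_h (f : (Fin n → ℝ) → ℝ) (Q : CubeIndex n) (x : Fin n → ℝ) :
    H.shiftTerm r s α f Q x = ∑ S ∈ D.descendants s Q, ∑ j,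
      (∑ R ∈ D.descendants r Q, ∑ i, α Q R S i j * ∫ y, f y * H.h R i y ∂μ) * H.h S j x := by
  rw [shiftTerm, Finset.sum_comm]
  refine Finset.sum_congr rfl fun S _ => ?_
  simp only [Finset.sum_mul]
  symm
  rw [Finset.sum_comm]
  exact Finset.sum_congr rfl fun R _ => Finset.sum_comm

theorem memLp_shiftTerm (hμ : D.IsNondegenerate μ) (p : ℝ≥0∞) (f : (Fin n → ℝ) → ℝ)
    (Q : CubeIndex n) : MemLp (H.shiftTerm r s α f Q) p μ :=
  memLp_finsetSum _ fun _ _ => memLp_finsetSum _ fun S _ => memLp_finsetSum _ fun _ _ =>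
    memLp_finsetSum _ fun j _ => (H.memLp_h hμ p S j).const_mul _

theorem memLp_sum_shiftTerm (hμ : D.IsNondegenerate μ) (p : ℝ≥0∞) (f : (Fin n → ℝ) → ℝ)
    (F : Finset (CubeIndex n)) : MemLp (fun x => ∑ Q ∈ F, H.shiftTerm r s α f Q x) p μ :=
  memLp_finsetSum F fun Q _ => H.memLp_shiftTerm hμ p f Q

theorem integrable_shiftTerm (hμ : D.IsNondegenerate μ) (f : (Fin n → ℝ) → ℝ)
    (Q : CubeIndex n) : Integrable (H.shiftTerm r s α f Q) μ :=
  memLp_one_iff_integrable.1 (H.memLp_shiftTerm hμ 1 f Q)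

theorem integrable_sum_shiftTerm (hμ : D.IsNondegenerate μ) (f : (Fin n → ℝ) → ℝ)
    (F : Finset (CubeIndex n)) : Integrable (fun x => ∑ Q ∈ F, H.shiftTerm r s α f Q x) μ :=
  memLp_one_iff_integrable.1 (H.memLp_sum_shiftTerm hμ 1 f F)

theorem mean_shiftTerm_eq_zero (hμ : D.IsNondegenerate μ) (f : (Fin n → ℝ) → ℝ)
    {P Q : CubeIndex n} (hg : P.1 ≤ Q.1 + s) : D.mean μ (H.shiftTerm r s α f Q) P = 0 := by
  have h_int : ∀ S j (c : ℝ), IntegrableOn (fun x => c * H.h S j x) (D.cube P) μ :=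
    fun S j c => ((H.integrable_h hμ S j).const_mul c).integrableOn
  have hzero : ∫ x in D.cube P, H.shiftTerm r s α f Q x ∂μ = 0 := by
    simp only [shiftTerm_eq_sum_mul_h]
    rw [integral_finsetSum _ fun S _ => integrable_finsetSum _ fun j _ => h_int S j _]
    refine Finset.sum_eq_zero fun S hS => ?_
    rw [integral_finsetSum _ fun j _ => h_int S j _]
    refine Finset.sum_eq_zero fun j _ => ?_
    rw [integral_const_mul, H.setIntegral_h_eq_zero (by rwa [(D.mem_descendants.1 hS).1]),
      mul_zero]
  rw [mean, setAverage_eq, hzero, smul_zero]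

theorem mean_shiftTerm_eq_of_lt (hμ : D.IsNondegenerate μ) (f : (Fin n → ℝ) → ℝ)
    {P Q : CubeIndex n} (hg : Q.1 + s < P.1) {x : Fin n → ℝ} (hx : x ∈ D.cube P) :
    D.mean μ (H.shiftTerm r s α f Q) P = H.shiftTerm r s α f Q x := by
  have hconst : ∀ᵐ y ∂μ, y ∈ D.cube P → H.shiftTerm r s α f Q y = H.shiftTerm r s α f Q x :=
    Eventually.of_forall fun y hy => by
      rw [H.shiftTerm_eq_of_mem_cube f hg hy, H.shiftTerm_eq_of_mem_cube f hg hx]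
  rw [mean, setAverage_congr_fun (D.measurableSet_cube P) hconst]
  exact mean_const hμ _ P

theorem shiftTerm_sub_mean (hμ : D.IsNondegenerate μ) (f : (Fin n → ℝ) → ℝ) {P : CubeIndex n}
    (Q : CubeIndex n) {x : Fin n → ℝ} (hx : x ∈ D.cube P) :
    H.shiftTerm r s α f Q x - D.mean μ (H.shiftTerm r s α f Q) P
      = if P.1 ≤ Q.1 + s then H.shiftTerm r s α f Q x else 0 := by
  split_ifs with h
  · rw [H.mean_shiftTerm_eq_zero hμ f h, sub_zero]
  · rw [H.mean_shiftTerm_eq_of_lt hμ f (not_le.1 h) hx, sub_self]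

theorem mean_sum_shiftTerm (hμ : D.IsNondegenerate μ) (f : (Fin n → ℝ) → ℝ)
    (F : Finset (CubeIndex n)) (P : CubeIndex n) :
    D.mean μ (fun x => ∑ Q ∈ F, H.shiftTerm r s α f Q x) P
      = ∑ Q ∈ F, D.mean μ (H.shiftTerm r s α f Q) P := by
  simp only [mean, setAverage_eq]
  rw [integral_finsetSum _ fun Q _ => (H.integrable_shiftTerm hμ f Q).integrableOn,
    Finset.smul_sum]

open Classical in
theorem sum_shiftTerm_sub_mean (hμ : D.IsNondegenerate μ) (f : (Fin n → ℝ) → ℝ)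
    (F : Finset (CubeIndex n)) {P P' : CubeIndex n} (hP : D.cube P ⊆ D.cube P')
    {x : Fin n → ℝ} (hx : x ∈ D.cube P) :
    (∑ Q ∈ F, H.shiftTerm r s α f Q x) - D.mean μ (fun x => ∑ Q ∈ F, H.shiftTerm r s α f Q x) P'
      = ∑ Q ∈ F with P'.1 ≤ Q.1 + s ∧ ¬ Disjoint (D.cube Q) (D.cube P),
          H.shiftTerm r s α f Q x := by
  rw [H.mean_sum_shiftTerm hμ, ← Finset.sum_sub_distrib, Finset.sum_filter]
  refine Finset.sum_congr rfl fun Q _ => ?_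
  rw [H.shiftTerm_sub_mean hμ f Q (hP hx)]
  by_cases hdisj : Disjoint (D.cube Q) (D.cube P)
  · simp [hdisj, H.shiftTerm_of_notMem f (Set.disjoint_right.1 hdisj hx)]
  · simp [hdisj]

theorem shiftTerm_haarProj (hμ : D.IsNondegenerate μ) (f : (Fin n → ℝ) → ℝ)
    (G : Finset (CubeIndex n)) (Q : CubeIndex n) (x : Fin n → ℝ) :
    H.shiftTerm r s α (H.haarProj hμ f (haarIndex D r G)) Q x
      = if Q ∈ G then H.shiftTerm r s α f Q x else 0 := by
  split_ifs with hQ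
  · rw [H.shiftTerm_congr fun R hR i => ?_]
    rw [H.integral_haarProj_mul_h hμ f _ (R, i), if_pos ((mem_haarIndex hR i).2 hQ)]
  · refine H.shiftTerm_eq_zero (fun R hR i => ?_) x
    rw [H.integral_haarProj_mul_h hμ f _ (R, i), if_neg fun h => hQ ((mem_haarIndex hR i).1 h)]

theorem IsShiftOnL2.apply_haarProj_ae_eq {H : HaarSystem D μ} {T : Lp ℝ 2 μ →L[ℝ] Lp ℝ 2 μ}
    (hT : H.IsShiftOnL2 r s α T) (hμ : D.IsNondegenerate μ) (f : (Fin n → ℝ) → ℝ)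
    (G : Finset (CubeIndex n)) :
    (fun x => ∑ Q ∈ G, H.shiftTerm r s α f Q x) =ᵐ[μ] T (H.haarProj hμ f (haarIndex D r G)) := by
  set φ := H.haarProj hμ f (haarIndex D r G)
  have hsum : ∀ F, G ⊆ F → ∀ x,
      ∑ Q ∈ F, H.shiftTerm r s α φ Q x = ∑ Q ∈ G, H.shiftTerm r s α f Q x := fun F hF x => by
    simp only [φ, H.shiftTerm_haarProj hμ]
    rw [Finset.sum_ite_mem, Finset.inter_eq_right.2 hF]
  have hlim : Tendsto (fun _ : Finset (CubeIndex n) =>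
      eLpNorm (fun x => (∑ Q ∈ G, H.shiftTerm r s α f Q x) - T φ x) 2 μ) atTop (𝓝 0) := by
    refine (hT φ).congr' ?_
    filter_upwards [eventually_ge_atTop G] with F hF
    simp only [hsum F hF]
  have hzero := tendsto_nhds_unique tendsto_const_nhds hlim
  filter_upwards [(eLpNorm_eq_zero_iff ((H.memLp_sum_shiftTerm hμ 2 f G).1.sub
    (Lp.aestronglyMeasurable (T φ))) two_ne_zero).1 hzero] with x hx
  exact sub_eq_zero.1 hx

theorem IsShiftOnL2.eLpNorm_sum_shiftTerm_le {H : HaarSystem D μ} {T : Lp ℝ 2 μ →L[ℝ] Lp ℝ 2 μ}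
    (hT : H.IsShiftOnL2 r s α T) (hμ : D.IsNondegenerate μ) (f : (Fin n → ℝ) → ℝ)
    (G : Finset (CubeIndex n)) :
    eLpNorm (fun x => ∑ Q ∈ G, H.shiftTerm r s α f Q x) 2 μ
      ≤ ‖T‖ₑ * ENNReal.ofReal (√(H.haarEnergy r f G)) := by
  rw [eLpNorm_congr_ae (hT.apply_haarProj_ae_eq hμ f G), haarEnergy_eq_sum,
    ← H.norm_haarProj_sq hμ, Real.sqrt_sq (norm_nonneg _), ofReal_norm, ← Lp.enorm_def]
  exact T.le_opENorm _

end ShiftTerm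

section LocalEnergy

theorem eLpNorm_indicator_sub_mean_parent_le (hμ : D.IsNondegenerate μ) (a : ℝ)
    (f : (Fin n → ℝ) → ℝ) (P : CubeIndex n) :
    eLpNorm ((D.cube P).indicator fun x => f x - D.mean μ f (D.parent P)) 2 μ
      ≤ D.lipSeminorm μ 2 a f * μ (D.cube P) ^ (1 / 2 + a) := by
  rw [eLpNorm_indicator_eq_eLpNorm_restrict (D.measurableSet_cube P),
    eLpNorm_eq_lintegral_rpow_enorm_toReal two_ne_zero ENNReal.ofNat_ne_top, ENNReal.toReal_ofNat,
    one_div, ENNReal.rpow_inv_le_iff two_pos]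
  simpa only [one_div] using lintegral_rpow_le_lipSeminorm hμ two_pos a f P

theorem integral_indicator_sub_mul_h (hμ : D.IsNondegenerate μ) {f : (Fin n → ℝ) → ℝ}
    {P R : CubeIndex n} (hf : IntegrableOn f (D.cube P) μ) (hR : D.cube R ⊆ D.cube P)
    (c : ℝ) (i : Fin (2 ^ n - 1)) :
    ∫ x, (D.cube P).indicator (fun x => f x - c) x * H.h R i x ∂μ = ∫ x, f x * H.h R i x ∂μ := by
  have hzero : ∫ x in D.cube P, H.h R i x ∂μ = 0 := by
    rw [setIntegral_eq_integral_of_forall_compl_eq_zero, H.integral_eq_zero]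
    exact fun x hx => H.support R i x fun hxS => hx (hR hxS)
  rw [H.integral_mul_h_eq_setIntegral _ hR, H.integral_mul_h_eq_setIntegral f hR,
    setIntegral_congr_fun (g := fun x => f x * H.h R i x - c * H.h R i x)
      (D.measurableSet_cube P) fun x hx => by
        simp only [Set.indicator_of_mem hx]; ring,
    integral_sub (H.integrableOn_mul_h hf i)
      ((H.integrable_h hμ R i).const_mul c).integrableOn, integral_const_mul, hzero, mul_zero,
    sub_zero]

variable (hμ : D.IsNondegenerate μ) {a : ℝ} {f : (Fin n → ℝ) → ℝ}
  (hf : ∀ Q, IntegrableOn f (D.cube Q) μ) (hL : D.lipSeminorm μ 2 a f ≠ ∞)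
include hμ hf hL

theorem haarEnergy_le_of_subset (P : CubeIndex n) (r : ℕ) {G : Finset (CubeIndex n)}
    (hG : ∀ Q ∈ G, D.cube Q ⊆ D.cube P) :
    H.haarEnergy r f G
      ≤ ((D.lipSeminorm μ 2 a f).toReal * μ.real (D.cube P) ^ (1 / 2 + a)) ^ 2 := by
  set u := (D.cube P).indicator fun x => f x - D.mean μ f (D.parent P)
  have hle := eLpNorm_indicator_sub_mean_parent_le hμ a f P
  have htop : D.lipSeminorm μ 2 a f * μ (D.cube P) ^ (1 / 2 + a) ≠ ∞ :=
    ENNReal.mul_ne_top hL (ENNReal.rpow_ne_top_of_ne_zero (hμ P).1.ne' (hμ P).2.ne)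
  have hu : MemLp u 2 μ := ⟨(aestronglyMeasurable_indicator_iff (D.measurableSet_cube P)).2
    ((hf P).aestronglyMeasurable.sub aestronglyMeasurable_const), hle.trans_lt htop.lt_top⟩
  have hnorm : ‖hu.toLp u‖ ≤ (D.lipSeminorm μ 2 a f).toReal * μ.real (D.cube P) ^ (1 / 2 + a) := by
    rw [Lp.norm_toLp, measureReal_def, ENNReal.toReal_rpow, ← ENNReal.toReal_mul]
    exact ENNReal.toReal_mono htop hle
  have hcoef : H.haarEnergy r f G = H.haarEnergy r (hu.toLp u) G := by
    refine Finset.sum_congr rfl fun Q hQ => Finset.sum_congr rfl fun R hR =>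
      Finset.sum_congr rfl fun i _ => ?_
    rw [← H.integral_indicator_sub_mul_h hμ (hf P)
      ((D.mem_descendants.1 hR).2.trans (hG Q hQ)) (D.mean μ f (D.parent P)) i]
    congr 1
    refine integral_congr_ae ?_
    filter_upwards [hu.coeFn_toLp] with x hx
    rw [hx]
  rw [hcoef]
  exact (H.haarEnergy_le_norm_sq hμ r _ G).trans (pow_le_pow_left₀ (norm_nonneg _) hnorm 2)

end LocalEnergy

theorem card_le_of_forall_mem_cube {G : Finset (CubeIndex n)} {x : Fin n → ℝ} {k l : ℤ}
    (hx : ∀ Q ∈ G, x ∈ D.cube Q) (hgen : ∀ Q ∈ G, k ≤ Q.1 ∧ Q.1 < l) :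
    G.card ≤ (l - k).toNat := by
  rw [← Int.card_Ico]
  exact Finset.card_le_card_of_injOn Prod.fst
    (fun Q hQ => Finset.mem_coe.2 (Finset.mem_Ico.2 (hgen Q hQ)))
    fun Q hQ Q' hQ' he => D.eq_of_mem_cube he (hx Q hQ) (hx Q' hQ')

variable {H}

theorem Balanced.exists_haarEnergy_le (hbal : H.Balanced) (hn : 1 ≤ n)
    (hμ : D.IsNondegenerate μ) {a : ℝ} (ha : 0 ≤ a) (r s : ℕ) :
    ∃ N : ℝ, 0 ≤ N ∧ ∀ f : (Fin n → ℝ) → ℝ, (∀ Q, IntegrableOn f (D.cube Q) μ) →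
      D.lipSeminorm μ 2 a f ≠ ∞ → ∀ (P : CubeIndex n) (G : Finset (CubeIndex n)),
        (∀ Q ∈ G, P.1 - 1 ≤ Q.1 + s ∧ ¬ Disjoint (D.cube Q) (D.cube P)) →
        H.haarEnergy r f G
          ≤ N * ((D.lipSeminorm μ 2 a f).toReal * μ.real (D.cube P) ^ (1 / 2 + a)) ^ 2 := by
  obtain ⟨B, hB0, hB⟩ := hbal.exists_abs_integral_mul_h_le hn hμ ha r (s + 1)
  set N : ℝ := (s + 1) * (2 ^ (n * r) * ((2 ^ n - 1 : ℕ) * B ^ 2))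
  refine ⟨1 + N, by positivity, fun f hf hL P G hG => ?_⟩
  have hL₁ := lipSeminorm_mono_exponent hμ one_pos one_le_two a hf
  set W : ℝ := (D.lipSeminorm μ 2 a f).toReal * μ.real (D.cube P) ^ (1 / 2 + a) with hW
  have hinner : H.haarEnergy r f {Q ∈ G | P.1 ≤ Q.1} ≤ W ^ 2 := by
    refine H.haarEnergy_le_of_subset hμ hf hL P r fun Q hQ => ?_
    obtain ⟨hQG, hg⟩ := Finset.mem_filter.1 hQ
    exact (D.disjoint_or_subset hg).resolve_left fun h => (hG Q hQG).2 h.symm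
  have houter : H.haarEnergy r f {Q ∈ G | ¬ P.1 ≤ Q.1} ≤ N * W ^ 2 := by
    have hanc : ∀ Q ∈ G.filter (fun Q => ¬ P.1 ≤ Q.1),
        D.corner P ∈ D.cube Q ∧ P.1 - 1 - s ≤ Q.1 ∧ Q.1 < P.1 := fun Q hQ => by
      obtain ⟨hQG, hg⟩ := Finset.mem_filter.1 hQ
      obtain ⟨hgen, hmeet⟩ := hG Q hQG
      exact ⟨(D.disjoint_or_subset (not_le.1 hg).le).resolve_left hmeet (D.corner_mem_cube P),
        by omega, not_le.1 hg⟩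
    have hcoef : ∀ Q ∈ G.filter (fun Q => ¬ P.1 ≤ Q.1), ∀ R ∈ D.descendants r Q, ∀ i,
        |∫ x, f x * H.h R i x ∂μ| ≤ B * W := fun Q hQ R hR i => by
      obtain ⟨hmem, hge, hlt⟩ := hanc Q hQ
      have hP : P ∈ D.descendants (P.1 - Q.1).toNat Q :=
        D.mem_descendants_of_mem (by omega) hmem (D.corner_mem_cube P)
      refine (hB f hf (ne_top_of_le_ne_top hL hL₁) Q R hR _ (by omega) P hP i).trans ?_
      rw [hW, ← mul_assoc]
      gcongr
    have hcard : ((G.filter fun Q => ¬ P.1 ≤ Q.1).card : ℝ) ≤ s + 1 := by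
      have hc := card_le_of_forall_mem_cube (fun Q hQ => (hanc Q hQ).1) fun Q hQ => (hanc Q hQ).2
      exact_mod_cast hc.trans (by omega : (P.1 - (P.1 - 1 - s)).toNat ≤ s + 1)
    refine (H.haarEnergy_le_card_mul hcoef).trans
      ((mul_le_mul_of_nonneg_right hcard (by positivity)).trans_eq ?_)
    ring
  rw [haarEnergy, ← Finset.sum_filter_add_sum_filter_not G fun Q => P.1 ≤ Q.1, one_add_mul]
  exact add_le_add hinner houter

theorem Balanced.exists_lipSeminorm_two_sum_shiftTerm_le (hbal : H.Balanced) (hn : 1 ≤ n)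
    (hμ : D.IsNondegenerate μ) {a : ℝ} (ha : 0 ≤ a) (r s : ℕ) :
    ∃ C : ℝ≥0, ∀ (α : Coeff n) (T : Lp ℝ 2 μ →L[ℝ] Lp ℝ 2 μ), H.IsShiftOnL2 r s α T →
      ∀ f : (Fin n → ℝ) → ℝ, (∀ Q, IntegrableOn f (D.cube Q) μ) →
        D.lipSeminorm μ 2 a f ≠ ∞ → ∀ F : Finset (CubeIndex n),
          D.lipSeminorm μ 2 a (fun x => ∑ Q ∈ F, H.shiftTerm r s α f Q x)
            ≤ C * ‖T‖ₑ * D.lipSeminorm μ 2 a f := by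
  classical
  obtain ⟨N, hN0, hN⟩ := hbal.exists_haarEnergy_le hn hμ ha r s
  refine ⟨(√N).toNNReal, fun α T hT f hf hL F => (lipSeminorm_le_iff hμ two_pos).2 fun P => ?_⟩
  set W : ℝ := (D.lipSeminorm μ 2 a f).toReal * μ.real (D.cube P) ^ (1 / 2 + a)
  have hW0 : 0 ≤ W := by positivity
  have hW : ENNReal.ofReal W = D.lipSeminorm μ 2 a f * μ (D.cube P) ^ (1 / 2 + a) := by
    rw [ENNReal.ofReal_mul ENNReal.toReal_nonneg, ENNReal.ofReal_toReal hL,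
      ← ENNReal.ofReal_rpow_of_pos (measureReal_cube_pos hμ P), ofReal_measureReal (hμ P).2.ne]
  set G := F.filter fun Q => (D.parent P).1 ≤ Q.1 + s ∧ ¬ Disjoint (D.cube Q) (D.cube P)
  have hG := hN f hf hL P G fun Q hQ => (Finset.mem_filter.1 hQ).2
  calc ∫⁻ x in D.cube P, ‖(∑ Q ∈ F, H.shiftTerm r s α f Q x)
        - D.mean μ (fun x => ∑ Q ∈ F, H.shiftTerm r s α f Q x) (D.parent P)‖ₑ ^ (2 : ℝ) ∂μ
      = ∫⁻ x in D.cube P, ‖∑ Q ∈ G, H.shiftTerm r s α f Q x‖ₑ ^ (2 : ℝ) ∂μ :=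
        setLIntegral_congr_fun (D.measurableSet_cube P) fun x hx => by
          simp only [G, H.sum_shiftTerm_sub_mean hμ f F (D.cube_subset_cube_parent P) hx]
    _ ≤ ∫⁻ x, ‖∑ Q ∈ G, H.shiftTerm r s α f Q x‖ₑ ^ (2 : ℝ) ∂μ := setLIntegral_le_lintegral _ _
    _ = eLpNorm (fun x => ∑ Q ∈ G, H.shiftTerm r s α f Q x) 2 μ ^ (2 : ℝ) := by
        rw [eLpNorm_eq_lintegral_rpow_enorm_toReal two_ne_zero ENNReal.ofNat_ne_top,
          ENNReal.toReal_ofNat, ← ENNReal.rpow_mul, one_div_mul_cancel two_ne_zero,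
          ENNReal.rpow_one]
    _ ≤ (‖T‖ₑ * ENNReal.ofReal (√(N * W ^ 2))) ^ (2 : ℝ) := by
        gcongr
        exact (hT.eLpNorm_sum_shiftTerm_le hμ f G).trans (by gcongr)
    _ = ((√N).toNNReal * ‖T‖ₑ * D.lipSeminorm μ 2 a f * μ (D.cube P) ^ (1 / 2 + a)) ^ (2 : ℝ) := by
        rw [Real.sqrt_mul hN0, Real.sqrt_sq hW0, ENNReal.ofReal_mul (Real.sqrt_nonneg _), hW,
          ENNReal.ofReal]
        ring_nf

theorem Balanced.exists_lipSeminorm_sum_shiftTerm_le (hbal : H.Balanced) (hn : 1 ≤ n)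
    (hμ : D.IsNondegenerate μ) {a : ℝ} (ha : 0 ≤ a) (r s : ℕ) {p : ℝ} (hp : 0 < p) :
    ∃ C : ℝ≥0, ∀ (α : Coeff n) (T : Lp ℝ 2 μ →L[ℝ] Lp ℝ 2 μ), H.IsShiftOnL2 r s α T →
      ∀ f : (Fin n → ℝ) → ℝ, (∀ Q, IntegrableOn f (D.cube Q) μ) →
        D.lipSeminorm μ 1 a f ≠ ∞ → ∀ F : Finset (CubeIndex n),
          D.lipSeminorm μ p a (fun x => ∑ Q ∈ F, H.shiftTerm r s α f Q x)
            ≤ C * ‖T‖ₑ * D.lipSeminorm μ 1 a f := by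
  obtain ⟨C, hC⟩ := hbal.exists_lipSeminorm_two_sum_shiftTerm_le hn hμ ha r s
  obtain ⟨K₂, hK₂⟩ := exists_lipSeminorm_le_mul_lipSeminorm_one hμ two_pos ha
  obtain ⟨K, hK⟩ := exists_lipSeminorm_le_mul_lipSeminorm_one hμ hp ha
  refine ⟨K * (C * K₂), fun α T hT f hf hL F => ?_⟩
  have hF : ∀ P, IntegrableOn (fun x => ∑ Q ∈ F, H.shiftTerm r s α f Q x) (D.cube P) μ :=
    fun P => (H.integrable_sum_shiftTerm hμ f F).integrableOn
  have hL2 : D.lipSeminorm μ 2 a f ≠ ∞ :=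
    ne_top_of_le_ne_top (ENNReal.mul_ne_top ENNReal.coe_ne_top hL) (hK₂ f hf)
  calc D.lipSeminorm μ p a (fun x => ∑ Q ∈ F, H.shiftTerm r s α f Q x)
      ≤ K * D.lipSeminorm μ 1 a (fun x => ∑ Q ∈ F, H.shiftTerm r s α f Q x) := hK _ hF
    _ ≤ K * D.lipSeminorm μ 2 a (fun x => ∑ Q ∈ F, H.shiftTerm r s α f Q x) := by
        gcongr
        exact lipSeminorm_mono_exponent hμ one_pos one_le_two a hF
    _ ≤ K * (C * ‖T‖ₑ * D.lipSeminorm μ 2 a f) := by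
        gcongr
        exact hC α T hT f hf hL2 F
    _ ≤ K * (C * ‖T‖ₑ * (K₂ * D.lipSeminorm μ 1 a f)) := by
        gcongr
        exact hK₂ f hf
    _ = (K * (C * K₂) : ℝ≥0) * ‖T‖ₑ * D.lipSeminorm μ 1 a f := by push_cast; ring

end HaarSystem

/-! ### Convergence modulo constants -/

section LpConvergence

variable {Ω ι : Type*} [MeasurableSpace Ω] {ν : Measure Ω}

theorem eLpNorm_ofReal_eq_lintegral_rpow_enorm {E : Type*} [NormedAddCommGroup E] {p : ℝ}
    (hp : 0 < p) (u : Ω → E) :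
    eLpNorm u (ENNReal.ofReal p) ν = (∫⁻ x, ‖u x‖ₑ ^ p ∂ν) ^ (1 / p) := by
  rw [eLpNorm_eq_lintegral_rpow_enorm_toReal (by simpa using hp) ENNReal.ofReal_ne_top,
    ENNReal.toReal_ofReal hp.le]

theorem lintegral_enorm_sub_rpow_le {E : Type*} [NormedAddCommGroup E] {u v : Ω → E}
    (hu : AEStronglyMeasurable u ν) (hv : AEStronglyMeasurable v ν) {p : ℝ} (hp : 1 ≤ p) :
    ∫⁻ x, ‖u x - v x‖ₑ ^ p ∂ν ≤ 2 ^ (p - 1) * (∫⁻ x, ‖u x‖ₑ ^ p ∂ν + ∫⁻ x, ‖v x‖ₑ ^ p ∂ν) := by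
  have hu' : AEMeasurable (fun x => ‖u x‖ₑ ^ p) ν := hu.enorm.pow_const _
  have huv : AEMeasurable (fun x => ‖u x‖ₑ ^ p + ‖v x‖ₑ ^ p) ν := hu'.add (hv.enorm.pow_const _)
  calc ∫⁻ x, ‖u x - v x‖ₑ ^ p ∂ν ≤ ∫⁻ x, 2 ^ (p - 1) * (‖u x‖ₑ ^ p + ‖v x‖ₑ ^ p) ∂ν :=
        lintegral_mono fun x => (ENNReal.rpow_le_rpow enorm_sub_le (by linarith)).trans
          (ENNReal.rpow_add_le_mul_rpow_add_rpow _ _ hp)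
    _ = 2 ^ (p - 1) * (∫⁻ x, ‖u x‖ₑ ^ p ∂ν + ∫⁻ x, ‖v x‖ₑ ^ p ∂ν) := by
        rw [lintegral_const_mul'' _ huv, lintegral_add_left' hu']

theorem lintegral_rpow_le_sqrt_mul_sqrt {w : Ω → ℝ≥0∞} (hw : AEMeasurable w ν) {q : ℝ}
    (hq : 1 ≤ q) :
    ∫⁻ x, w x ^ q ∂ν
      ≤ (∫⁻ x, w x ^ (2 : ℝ) ∂ν) ^ (1 / 2 : ℝ) * (∫⁻ x, w x ^ (2 * (q - 1)) ∂ν) ^ (1 / 2 : ℝ) := by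
  have hsplit : ∀ x, w x ^ q = w x * w x ^ (q - 1) := fun x => by
    simpa only [ENNReal.rpow_one, add_sub_cancel] using
      ENNReal.rpow_add_of_nonneg (x := w x) 1 (q - 1) zero_le_one (by linarith)
  have hsq : ∀ x, w x ^ (2 * (q - 1)) = (w x ^ (q - 1)) ^ (2 : ℝ) := fun x => by
    rw [← ENNReal.rpow_mul, mul_comm]
  simp only [hsplit, hsq]
  exact ENNReal.lintegral_mul_le_Lp_mul_Lq ν Real.HolderConjugate.two_two hw (hw.pow_const _)

theorem tendsto_eLpNorm_ofReal_of_tendsto_two {E : Type*} [NormedAddCommGroup E] {l : Filter ι}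
    {w : ι → Ω → E} (hw : ∀ i, AEStronglyMeasurable (w i) ν)
    (h : Tendsto (fun i => eLpNorm (w i) 2 ν) l (𝓝 0)) {q : ℝ} (hq : 1 ≤ q) {B : ℝ≥0∞}
    (hBtop : B ≠ ∞) (hB : ∀ i, ∫⁻ x, ‖w i x‖ₑ ^ (2 * (q - 1)) ∂ν ≤ B) :
    Tendsto (fun i => eLpNorm (w i) (ENNReal.ofReal q) ν) l (𝓝 0) := by
  have hq0 : 0 < q := by linarith
  have hle : ∀ i, eLpNorm (w i) (ENNReal.ofReal q) ν
      ≤ (eLpNorm (w i) 2 ν * B ^ (1 / 2 : ℝ)) ^ (1 / q) := fun i => by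
    rw [eLpNorm_ofReal_eq_lintegral_rpow_enorm hq0,
      eLpNorm_eq_lintegral_rpow_enorm_toReal two_ne_zero ENNReal.ofNat_ne_top, ENNReal.toReal_ofNat]
    gcongr
    exact (lintegral_rpow_le_sqrt_mul_sqrt (hw i).enorm hq).trans (by gcongr; exact hB i)
  have hlim := (ENNReal.continuous_rpow_const (y := 1 / q)).tendsto _ |>.comp
    (ENNReal.Tendsto.mul_const h
      (Or.inr (ENNReal.rpow_ne_top_of_nonneg one_half_pos.le hBtop)))
  rw [zero_mul, ENNReal.zero_rpow_of_pos (by positivity)] at hlim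
  exact tendsto_of_tendsto_of_tendsto_of_le_of_le tendsto_const_nhds hlim (fun _ => zero_le) hle

theorem tendsto_eLpNorm_of_exponent_le [IsFiniteMeasure ν] {E : Type*} [NormedAddCommGroup E]
    {l : Filter ι} {w : ι → Ω → E} (hw : ∀ i, AEStronglyMeasurable (w i) ν) {p q : ℝ≥0∞}
    (hpq : p ≤ q) (h : Tendsto (fun i => eLpNorm (w i) q ν) l (𝓝 0)) :
    Tendsto (fun i => eLpNorm (w i) p ν) l (𝓝 0) := by
  rcases eq_or_ne p 0 with rfl | hp
  · simpa only [eLpNorm_exponent_zero] using tendsto_const_nhds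
  have hexp : 0 ≤ 1 / p.toReal - 1 / q.toReal := by
    rcases eq_or_ne q ∞ with rfl | hq
    · simp
    · exact sub_nonneg.2 (one_div_le_one_div_of_le
        (ENNReal.toReal_pos hp (ne_top_of_le_ne_top hq hpq)) (ENNReal.toReal_mono hq hpq))
  have hlim := ENNReal.Tendsto.mul_const (b := ν Set.univ ^ (1 / p.toReal - 1 / q.toReal)) h
    (Or.inr (ENNReal.rpow_ne_top_of_nonneg hexp (measure_ne_top ν _)))
  rw [zero_mul] at hlim
  exact tendsto_of_tendsto_of_tendsto_of_le_of_le tendsto_const_nhds hlim (fun _ => zero_le)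
    fun i => eLpNorm_le_eLpNorm_mul_rpow_measure_univ hpq (hw i)

theorem memLp_and_tendsto_eLpNorm_of_tendsto_two [IsFiniteMeasure ν] {E : Type*}
    [NormedAddCommGroup E] {l : Filter ι} [l.NeBot] [l.IsCountablyGenerated] {u : ι → Ω → E}
    {v : Ω → E} (hu : ∀ i, AEStronglyMeasurable (u i) ν) (hv : AEStronglyMeasurable v ν)
    (h : Tendsto (fun i => eLpNorm (fun x => u i x - v x) 2 ν) l (𝓝 0))
    (hB : ∀ p : ℝ, 0 < p → ∃ B : ℝ≥0∞, B ≠ ∞ ∧ ∀ i, ∫⁻ x, ‖u i x‖ₑ ^ p ∂ν ≤ B)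
    {q : ℝ} (hq : 0 < q) :
    MemLp v (ENNReal.ofReal q) ν ∧
      Tendsto (fun i => eLpNorm (fun x => u i x - v x) (ENNReal.ofReal q) ν) l (𝓝 0) := by
  have hlimit : ∀ {p : ℝ} {B : ℝ≥0∞}, (∀ i, ∫⁻ x, ‖u i x‖ₑ ^ p ∂ν ≤ B) →
      ∫⁻ x, ‖v x‖ₑ ^ p ∂ν ≤ B :=
    fun hB => lintegral_enorm_rpow_le_of_tendsto_eLpNorm hu hv two_ne_zero h hB
  constructor
  · obtain ⟨B, hBtop, hB⟩ := hB q hq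
    refine ⟨hv, ?_⟩
    rw [eLpNorm_ofReal_eq_lintegral_rpow_enorm hq]
    exact ENNReal.rpow_lt_top_of_nonneg (by positivity) (ne_top_of_le_ne_top hBtop (hlimit hB))
  have hM : 2 ≤ max q 2 := le_max_right _ _
  obtain ⟨B, hBtop, hB⟩ := hB (2 * (max q 2 - 1)) (by linarith)
  refine tendsto_eLpNorm_of_exponent_le (fun i => (hu i).sub hv)
    (ENNReal.ofReal_le_ofReal (le_max_left q 2))
    (tendsto_eLpNorm_ofReal_of_tendsto_two (fun i => (hu i).sub hv) h (by linarith)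
      (B := 2 ^ (2 * (max q 2 - 1) - 1) * (B + B)) ?_ fun i => ?_)
  · exact ENNReal.mul_ne_top (ENNReal.rpow_ne_top_of_nonneg (by linarith) ENNReal.ofNat_ne_top)
      (ENNReal.add_ne_top.2 ⟨hBtop, hBtop⟩)
  · refine (lintegral_enorm_sub_rpow_le (hu i) hv (by linarith)).trans ?_
    gcongr
    exacts [hB i, hlimit hB]

end LpConvergence

namespace DyadicSystem

variable {n : ℕ} {D : DyadicSystem n} {μ : Measure (Fin n → ℝ)}

section ModuloConstants

variable {e : ℝ≥0∞} {P R : CubeIndex n} {g g' w : (Fin n → ℝ) → ℝ}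

theorem ae_sub_mean_eq_of_ae_eq_sub_const (hμ : D.IsNondegenerate μ)
    (hg : IntegrableOn g (D.cube P) μ) {c : ℝ} (h : ∀ᵐ x ∂μ.restrict (D.cube P), g' x = g x - c)
    (hR : D.cube R ⊆ D.cube P) :
    ∀ᵐ x ∂μ.restrict (D.cube P), g' x - D.mean μ g' R = g x - D.mean μ g R := by
  have hmean : D.mean μ g' R = D.mean μ g R - c := by
    rw [← mean_sub_const hμ (hg.mono_set hR)]
    exact average_congr (ae_restrict_of_ae_restrict_of_subset hR h)
  filter_upwards [h] with x hx
  rw [hx, hmean, sub_sub_sub_cancel_right]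

theorem enorm_mean_mul_rpow_le (hμ : D.IsNondegenerate μ) (he : 1 ≤ e)
    (hw : IntegrableOn w (D.cube P) μ) :
    ‖D.mean μ w P‖ₑ * μ (D.cube P) ^ (1 / e.toReal) ≤ eLpNorm w e (μ.restrict (D.cube P)) := by
  have hpos := (hμ P).1.ne'
  have htop := (hμ P).2.ne
  have hL1 := enorm_mean_mul_le hμ w P
  rw [← eLpNorm_one_eq_lintegral_enorm] at hL1
  have hLe := hL1.trans (eLpNorm_le_eLpNorm_mul_rpow_measure_univ he hw.aestronglyMeasurable)
  rw [Measure.restrict_apply_univ, ENNReal.toReal_one, div_one] at hLe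
  refine (ENNReal.mul_le_mul_iff_left (c := μ (D.cube P) ^ (1 - 1 / e.toReal))
    (ENNReal.rpow_pos (hμ P).1 htop).ne' (ENNReal.rpow_ne_top_of_ne_zero hpos htop)).1 ?_
  rwa [mul_assoc, ← ENNReal.rpow_add _ _ hpos htop, add_sub_cancel, ENNReal.rpow_one]

theorem eLpNorm_sub_mean_le (hμ : D.IsNondegenerate μ) (he : 1 ≤ e)
    (hw : IntegrableOn w (D.cube P) μ) :
    eLpNorm (fun x => w x - D.mean μ w P) e (μ.restrict (D.cube P))
      ≤ 2 * eLpNorm w e (μ.restrict (D.cube P)) := by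
  have hconst : eLpNorm (fun _ => D.mean μ w P) e (μ.restrict (D.cube P))
      ≤ eLpNorm w e (μ.restrict (D.cube P)) := by
    rw [eLpNorm_const _ (zero_lt_one.trans_le he).ne'
      (Measure.restrict_eq_zero.not.2 (hμ P).1.ne'), Measure.restrict_apply_univ]
    exact enorm_mean_mul_rpow_le hμ he hw
  calc eLpNorm (fun x => w x - D.mean μ w P) e (μ.restrict (D.cube P))
      ≤ eLpNorm w e (μ.restrict (D.cube P))
        + eLpNorm (fun _ => D.mean μ w P) e (μ.restrict (D.cube P)) :=
        eLpNorm_sub_le hw.aestronglyMeasurable aestronglyMeasurable_const he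
    _ ≤ 2 * eLpNorm w e (μ.restrict (D.cube P)) := by
        rw [two_mul]
        gcongr

variable {ι : Type*} {l : Filter ι} {u : ι → (Fin n → ℝ) → ℝ}

variable (D μ) in
/-- `u i - ⟨u i⟩_P → g - ⟨g⟩_P` in `L^e(P, μ)`: convergence on the cube `P` modulo constants. -/
def TendstoSubMean (l : Filter ι) (e : ℝ≥0∞) (u : ι → (Fin n → ℝ) → ℝ)
    (g : (Fin n → ℝ) → ℝ) (P : CubeIndex n) : Prop :=
  Tendsto (fun i => eLpNorm (fun x => (u i x - D.mean μ (u i) P) - (g x - D.mean μ g P)) e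
    (μ.restrict (D.cube P))) l (𝓝 0)

theorem TendstoSubMean.of_tendsto_sub_const (hμ : D.IsNondegenerate μ) (he : 1 ≤ e)
    (hu : ∀ i, IntegrableOn (u i) (D.cube P) μ) (hg : IntegrableOn g (D.cube P) μ) (k : ι → ℝ)
    (h : Tendsto (fun i => eLpNorm (fun x => u i x - k i - g x) e (μ.restrict (D.cube P)))
      l (𝓝 0)) :
    D.TendstoSubMean μ l e u g P := by
  have hlim := ENNReal.Tendsto.const_mul (a := 2) h (Or.inr ENNReal.ofNat_ne_top)
  rw [mul_zero] at hlim
  refine tendsto_of_tendsto_of_tendsto_of_le_of_le tendsto_const_nhds hlim (fun _ => zero_le)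
    fun i => ?_
  have huk : IntegrableOn (fun x => u i x - k i) (D.cube P) μ :=
    (hu i).sub (integrableOn_const_cube hμ P (k i))
  have hmean : D.mean μ (fun x => u i x - k i - g x) P
      = D.mean μ (u i) P - k i - D.mean μ g P := by
    rw [mean_sub_fun huk hg, mean_sub_const hμ (hu i)]
  refine le_of_eq_of_le (congrArg (eLpNorm · e _) ?_) (eLpNorm_sub_mean_le hμ he (huk.sub hg))
  funext x
  rw [hmean]
  ring

theorem TendstoSubMean.mono (hμ : D.IsNondegenerate μ) (he : 1 ≤ e)
    (hu : ∀ i, IntegrableOn (u i) (D.cube P) μ) (hg : IntegrableOn g (D.cube P) μ)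
    (h : D.TendstoSubMean μ l e u g P) (hR : D.cube R ⊆ D.cube P) :
    D.TendstoSubMean μ l e u g R := by
  refine .of_tendsto_sub_const hμ he (fun i => (hu i).mono_set hR) (hg.mono_set hR)
    (fun i => D.mean μ (u i) P - D.mean μ g P) ?_
  refine tendsto_of_tendsto_of_tendsto_of_le_of_le tendsto_const_nhds h (fun _ => zero_le)
    fun i => le_of_eq_of_le (congrArg (eLpNorm · e _) ?_)
      (eLpNorm_mono_measure _ (Measure.restrict_mono hR le_rfl))
  funext x
  ring

theorem TendstoSubMean.congr_sub_const (hμ : D.IsNondegenerate μ)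
    (hg : IntegrableOn g (D.cube P) μ) (h : D.TendstoSubMean μ l e u g P) {c : ℝ}
    (hc : ∀ᵐ x ∂μ.restrict (D.cube P), g' x = g x - c) :
    D.TendstoSubMean μ l e u g' P := by
  refine Tendsto.congr (fun i => eLpNorm_congr_ae ?_) h
  filter_upwards [ae_sub_mean_eq_of_ae_eq_sub_const hμ hg hc subset_rfl] with x hx
  rw [hx]

theorem TendstoSubMean.ae_sub_mean_eq [l.NeBot] (he : 1 ≤ e)
    (hu : ∀ i, IntegrableOn (u i) (D.cube P) μ) (hg : IntegrableOn g (D.cube P) μ)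
    (hg' : IntegrableOn g' (D.cube P) μ) (h : D.TendstoSubMean μ l e u g P)
    (h' : D.TendstoSubMean μ l e u g' P) :
    ∀ᵐ x ∂μ.restrict (D.cube P), g x - D.mean μ g P = g' x - D.mean μ g' P := by
  have hmeas : ∀ {v : (Fin n → ℝ) → ℝ}, IntegrableOn v (D.cube P) μ →
      AEStronglyMeasurable (fun x => v x - D.mean μ v P) (μ.restrict (D.cube P)) :=
    fun hv => hv.aestronglyMeasurable.sub aestronglyMeasurable_const
  have hsum := h'.add h
  rw [add_zero] at hsum
  have hzero : eLpNorm (fun x => (g x - D.mean μ g P) - (g' x - D.mean μ g' P)) e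
      (μ.restrict (D.cube P)) ≤ 0 := by
    refine ge_of_tendsto hsum (Eventually.of_forall fun i => ?_)
    refine le_of_eq_of_le (congrArg (eLpNorm · e _) ?_) (eLpNorm_sub_le
      ((hmeas (hu i)).sub (hmeas hg')) ((hmeas (hu i)).sub (hmeas hg)) he)
    funext x
    simp only [Pi.sub_apply]
    ring
  filter_upwards [(eLpNorm_eq_zero_iff ((hmeas hg).sub (hmeas hg')) (zero_lt_one.trans_le he).ne').1
    (nonpos_iff_eq_zero.1 hzero)] with x hx
  exact sub_eq_zero.1 hx

end ModuloConstants

section Gluing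

variable (D) in
/-- Two points are equivalent if some cube of the system contains both. There may be several
classes (the `2 ^ n` orthants for the standard dyadic cubes), and constants are chosen
independently on each of them. -/
def commonCubeSetoid : Setoid (Fin n → ℝ) where
  r x y := ∃ V, x ∈ D.cube V ∧ y ∈ D.cube V
  iseqv :=
    { refl := fun x => ⟨_, D.mem_cube_cubeAt 0 x, D.mem_cube_cubeAt 0 x⟩
      symm := fun ⟨V, hx, hy⟩ => ⟨V, hy, hx⟩
      trans := by
        rintro x y z ⟨V, hxV, hyV⟩ ⟨W, hyW, hzW⟩
        rcases le_total V.1 W.1 with hg | hg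
        · exact ⟨V, hxV, D.cube_subset_of_mem hg hyV hyW hzW⟩
        · exact ⟨W, D.cube_subset_of_mem hg hyW hyV hxV, hzW⟩ }

variable (D) in
/-- A fixed cube of generation `0` in the class of `x` for `commonCubeSetoid`; the glued function
is normalised to have mean zero on it. -/
noncomputable def baseCube (x : Fin n → ℝ) : CubeIndex n :=
  D.cubeAt 0 (Quotient.mk D.commonCubeSetoid x).out

theorem exists_cube_subset_baseCube_eq (P : CubeIndex n) :
    ∃ V B, D.cube P ⊆ D.cube V ∧ D.cube B ⊆ D.cube V ∧ ∀ x ∈ D.cube V, D.baseCube x = B := by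
  set c := D.corner P
  obtain ⟨U, hoU, hcU⟩ : D.commonCubeSetoid (Quotient.mk D.commonCubeSetoid c).out c :=
    Quotient.exact (Quotient.out_eq _)
  set V := D.cubeAt (min 0 (min P.1 U.1)) c
  have hcV : c ∈ D.cube V := D.mem_cube_cubeAt _ c
  have hV0 : V.1 ≤ 0 := min_le_left _ _
  have hVP : V.1 ≤ P.1 := (min_le_right _ _).trans (min_le_left _ _)
  have hVU : V.1 ≤ U.1 := (min_le_right _ _).trans (min_le_right _ _)
  have hoV := D.cube_subset_of_mem hVU hcV hcU hoU
  refine ⟨V, D.baseCube c, D.cube_subset_of_mem hVP hcV (D.corner_mem_cube P),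
    D.cube_subset_of_mem hV0 hoV (D.mem_cube_cubeAt 0 _), fun x hx => ?_⟩
  have hxc : Quotient.mk D.commonCubeSetoid x = Quotient.mk D.commonCubeSetoid c :=
    Quotient.sound ⟨V, hx, hcV⟩
  rw [baseCube, hxc, baseCube]

theorem exists_ae_eq_sub_const_of_compatible (hμ : D.IsNondegenerate μ)
    {G : CubeIndex n → (Fin n → ℝ) → ℝ} (hG : ∀ P, IntegrableOn (G P) (D.cube P) μ)
    (hcompat : ∀ A V, D.cube V ⊆ D.cube A → ∀ᵐ x ∂μ.restrict (D.cube V),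
      G V x - D.mean μ (G V) V = G A x - D.mean μ (G A) V) :
    ∃ g : (Fin n → ℝ) → ℝ, ∀ P, ∃ V c, D.cube P ⊆ D.cube V ∧
      ∀ᵐ x ∂μ.restrict (D.cube V), g x = G V x - c := by
  have hbase : ∀ x, ∃ A, x ∈ D.cube A ∧ D.cube (D.baseCube x) ⊆ D.cube A := fun x => by
    obtain ⟨V, B, hPV, hBV, hB⟩ := D.exists_cube_subset_baseCube_eq (D.cubeAt 0 x)
    have hx := hPV (D.mem_cube_cubeAt 0 x)
    exact ⟨V, hx, hB x hx ▸ hBV⟩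
  choose A hxA hbA using hbase
  have hnested : ∀ {V W B : CubeIndex n}, D.cube V ⊆ D.cube W → D.cube B ⊆ D.cube V →
      ∀ᵐ x ∂μ, x ∈ D.cube V → G V x - D.mean μ (G V) B = G W x - D.mean μ (G W) B := by
    intro V W B hVW hBV
    refine (ae_restrict_iff' (D.measurableSet_cube V)).1
      (ae_sub_mean_eq_of_ae_eq_sub_const hμ ((hG W).mono_set hVW)
        (c := D.mean μ (G W) V - D.mean μ (G V) V) ?_ hBV)
    filter_upwards [hcompat W V hVW] with x hx
    linarith
  refine ⟨fun x => G (A x) x - D.mean μ (G (A x)) (D.baseCube x), fun P => ?_⟩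
  obtain ⟨V, B, hPV, hBV, hB⟩ := D.exists_cube_subset_baseCube_eq P
  refine ⟨V, D.mean μ (G V) B, hPV, (ae_restrict_iff' (D.measurableSet_cube V)).2 ?_⟩
  have hall : ∀ᵐ x ∂μ, ∀ W, x ∈ D.cube W → x ∈ D.cube V → D.cube B ⊆ D.cube W →
      G W x - D.mean μ (G W) B = G V x - D.mean μ (G V) B := by
    refine ae_all_iff.2 fun W => ?_
    by_cases hBW : D.cube B ⊆ D.cube W
    · have hcB := D.corner_mem_cube B
      rcases le_total W.1 V.1 with hg | hg
      · filter_upwards [hnested (D.cube_subset_of_mem hg (hBW hcB) (hBV hcB)) hBV]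
          with x hx _ hxV _ using (hx hxV).symm
      · filter_upwards [hnested (D.cube_subset_of_mem hg (hBV hcB) (hBW hcB)) hBW]
          with x hx hxW _ _ using hx hxW
    · exact Eventually.of_forall fun _ _ _ h => absurd h hBW
  filter_upwards [hall] with x hx hxV
  rw [hB x hxV]
  exact hx (A x) (hxA x) hxV (hB x hxV ▸ hbA x)

theorem exists_forall_tendstoSubMean {ι : Type*} {l : Filter ι} [l.NeBot]
    (hμ : D.IsNondegenerate μ) {e : ℝ≥0∞} (he : 1 ≤ e) {u : ι → (Fin n → ℝ) → ℝ}
    (hu : ∀ i P, IntegrableOn (u i) (D.cube P) μ)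
    (h : ∀ P, ∃ g, MemLp g e (μ.restrict (D.cube P)) ∧ D.TendstoSubMean μ l e u g P) :
    ∃ g, ∀ P, MemLp g e (μ.restrict (D.cube P)) ∧ D.TendstoSubMean μ l e u g P := by
  choose G hG hlim using h
  have hfin := isFiniteMeasure_restrict_cube hμ
  have hGint : ∀ P, IntegrableOn (G P) (D.cube P) μ := fun P => (hG P).integrable he
  obtain ⟨g, hg⟩ := exists_ae_eq_sub_const_of_compatible hμ hGint fun A V hVA =>
    (hlim V).ae_sub_mean_eq he (fun i => hu i V) (hGint V) ((hGint A).mono_set hVA)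
      ((hlim A).mono hμ he (fun i => hu i A) (hGint A) hVA)
  refine ⟨g, fun P => ?_⟩
  obtain ⟨V, c, hPV, hgV⟩ := hg P
  have hmem : MemLp g e (μ.restrict (D.cube V)) :=
    ((hG V).sub (memLp_const c)).ae_eq (hgV.mono fun x hx => hx.symm)
  exact ⟨hmem.mono_measure (Measure.restrict_mono hPV le_rfl),
    ((hlim V).congr_sub_const hμ (hGint V) hgV).mono hμ he (fun i => hu i V)
      (hmem.integrable he) hPV⟩

end Gluing

section Closure

variable {ι : Type*} {l : Filter ι} [l.NeBot] [l.IsCountablyGenerated] {a p : ℝ}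
  {u : ι → (Fin n → ℝ) → ℝ} {g : (Fin n → ℝ) → ℝ} {P : CubeIndex n}

theorem lintegral_sub_mean_rpow_le (hμ : D.IsNondegenerate μ) (hp : 0 < p) {L : ℝ≥0∞}
    {v : (Fin n → ℝ) → ℝ} (hL : D.lipSeminorm μ p a v ≤ L) (P : CubeIndex n) :
    ∫⁻ x in D.cube P, ‖v x - D.mean μ v P‖ₑ ^ p ∂μ
      ≤ ∑ R ∈ D.descendants 1 P, (L * μ (D.cube R) ^ (1 / p + a)) ^ p := by
  rw [D.lintegral_cube_eq_sum μ 1 P]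
  refine Finset.sum_le_sum fun R hR => ?_
  rw [← D.parent_of_mem_descendants hR]
  exact (lipSeminorm_le_iff hμ hp).1 hL R

theorem lipSeminorm_le_of_tendstoSubMean (hμ : D.IsNondegenerate μ) {e : ℝ≥0∞} (he : e ≠ 0)
    (hp : 0 < p) (hu : ∀ i P, IntegrableOn (u i) (D.cube P) μ)
    (hg : ∀ P, IntegrableOn g (D.cube P) μ) (h : ∀ P, D.TendstoSubMean μ l e u g P) {L : ℝ≥0∞}
    (hL : ∀ i, D.lipSeminorm μ p a (u i) ≤ L) : D.lipSeminorm μ p a g ≤ L := by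
  refine (lipSeminorm_le_iff hμ hp).2 fun P => ?_
  refine lintegral_enorm_rpow_le_of_tendsto_eLpNorm (l := l)
    (fun i => (hu i P).aestronglyMeasurable.sub aestronglyMeasurable_const)
    ((hg P).aestronglyMeasurable.sub aestronglyMeasurable_const) he ?_
    fun i => (lipSeminorm_le_iff hμ hp).1 (hL i) P
  exact tendsto_of_tendsto_of_tendsto_of_le_of_le tendsto_const_nhds (h (D.parent P))
    (fun _ => zero_le) fun i =>
      eLpNorm_mono_measure _ (Measure.restrict_mono (D.cube_subset_cube_parent P) le_rfl)

theorem TendstoSubMean.of_two (hμ : D.IsNondegenerate μ)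
    (hu : ∀ i, IntegrableOn (u i) (D.cube P) μ) (hg : IntegrableOn g (D.cube P) μ)
    (hL : ∀ p : ℝ, 0 < p → ∃ L : ℝ≥0∞, L ≠ ∞ ∧ ∀ i, D.lipSeminorm μ p a (u i) ≤ L)
    (h : D.TendstoSubMean μ l 2 u g P) {q : ℝ} (hq : 0 < q) :
    MemLp g (ENNReal.ofReal q) (μ.restrict (D.cube P)) ∧
      D.TendstoSubMean μ l (ENNReal.ofReal q) u g P := by
  have := isFiniteMeasure_restrict_cube hμ P
  obtain ⟨hmem, hlim⟩ := memLp_and_tendsto_eLpNorm_of_tendsto_two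
    (fun i => (hu i).aestronglyMeasurable.sub aestronglyMeasurable_const)
    (hg.aestronglyMeasurable.sub aestronglyMeasurable_const) h (fun p hp => by
      obtain ⟨L, hLtop, hL⟩ := hL p hp
      refine ⟨_, ?_, fun i => lintegral_sub_mean_rpow_le hμ hp (hL i) P⟩
      exact ENNReal.sum_ne_top.2 fun R _ => ENNReal.rpow_ne_top_of_nonneg hp.le
        (ENNReal.mul_ne_top hLtop (ENNReal.rpow_ne_top_of_ne_zero (hμ R).1.ne' (hμ R).2.ne))) hq
  refine ⟨?_, hlim⟩
  simpa using hmem.add (memLp_const (D.mean μ g P))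

end Closure

end DyadicSystem

/-! ### Images under a Haar shift -/

namespace HaarSystem

open DyadicSystem

variable {n : ℕ} {D : DyadicSystem n} {μ : Measure (Fin n → ℝ)} {H : HaarSystem D μ}
  {r s : ℕ} {α : Coeff n} {f g : (Fin n → ℝ) → ℝ}

theorem isShiftImage_iff (hμ : D.IsNondegenerate μ) {q : ℝ} :
    H.IsShiftImage r s α q f g ↔ D.MemLqLoc μ q g ∧ ∀ P, D.TendstoSubMean μ atTop
      (ENNReal.ofReal q) (fun (F : Finset _) x => ∑ Q ∈ F, H.shiftTerm r s α f Q x) g P := by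
  simp only [IsShiftImage, TendstoSubMean, H.mean_sum_shiftTerm hμ, Finset.sum_sub_distrib, mean]

variable (H r s α f) in
/-- The term `t_Q(f)` of a Haar shift as an element of `L²(μ)`. -/
noncomputable def shiftTermLp (hμ : D.IsNondegenerate μ) (Q : CubeIndex n) : Lp ℝ 2 μ :=
  (H.memLp_shiftTerm hμ 2 f Q).toLp (H.shiftTerm r s α f Q)

theorem coeFn_sum_shiftTermLp (hμ : D.IsNondegenerate μ) (F : Finset (CubeIndex n)) :
    ⇑(∑ Q ∈ F, H.shiftTermLp r s α f hμ Q) =ᵐ[μ] fun x => ∑ Q ∈ F, H.shiftTerm r s α f Q x := by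
  have hterm : ∀ᵐ x ∂μ, ∀ Q ∈ F, H.shiftTermLp r s α f hμ Q x = H.shiftTerm r s α f Q x :=
    F.eventually_all.2 fun Q _ => (H.memLp_shiftTerm hμ 2 f Q).coeFn_toLp
  filter_upwards [Lp.coeFn_finsetSum F (H.shiftTermLp r s α f hμ), hterm] with x hsum hx
  rw [hsum, Finset.sum_apply]
  exact Finset.sum_congr rfl hx

variable {T : Lp ℝ 2 μ →L[ℝ] Lp ℝ 2 μ}

theorem IsShiftOnL2.norm_sum_shiftTermLp_le (hT : H.IsShiftOnL2 r s α T)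
    (hμ : D.IsNondegenerate μ) (f : (Fin n → ℝ) → ℝ) (G : Finset (CubeIndex n)) :
    ‖∑ Q ∈ G, H.shiftTermLp r s α f hμ Q‖ ≤ ‖T‖ * √(H.haarEnergy r f G) := by
  have h := hT.eLpNorm_sum_shiftTerm_le hμ f G
  rw [← eLpNorm_congr_ae (coeFn_sum_shiftTermLp hμ G), ← Lp.enorm_def, ← ofReal_norm,
    ← ofReal_norm, ← ENNReal.ofReal_mul (norm_nonneg T)] at h
  exact (ENNReal.ofReal_le_ofReal_iff (by positivity)).1 h

theorem IsShiftOnL2.summable_indicator_shiftTermLp (hT : H.IsShiftOnL2 r s α T)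
    (hμ : D.IsNondegenerate μ) {S : Set (CubeIndex n)} {K : ℝ}
    (hK : ∀ G : Finset (CubeIndex n), (∀ Q ∈ G, Q ∈ S) → H.haarEnergy r f G ≤ K) :
    Summable (S.indicator (H.shiftTermLp r s α f hμ)) := by
  classical
  set E : CubeIndex n → ℝ := S.indicator fun Q => H.haarEnergy r f {Q}
  have hsum : ∀ G : Finset (CubeIndex n), ∑ Q ∈ G, E Q = H.haarEnergy r f {Q ∈ G | Q ∈ S} :=
    fun G => by
      simp only [E, haarEnergy, Finset.sum_singleton, Set.indicator_apply, Finset.sum_filter]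
  have hE : Summable E := by
    refine summable_of_sum_le (c := K) (fun Q => Set.indicator_nonneg (fun Q _ => ?_) Q)
      fun G => hsum G ▸ hK _ fun Q hQ => (Finset.mem_filter.1 hQ).2
    unfold haarEnergy
    positivity
  refine summable_iff_vanishing_norm.2 fun ε hε => ?_
  obtain ⟨F, hF⟩ := summable_iff_vanishing_norm.1 hE ((ε / (‖T‖ + 1)) ^ 2) (by positivity)
  refine ⟨F, fun G hG => ?_⟩
  have hG' : H.haarEnergy r f {Q ∈ G | Q ∈ S} < (ε / (‖T‖ + 1)) ^ 2 :=
    (Real.le_norm_self _).trans_lt (hsum G ▸ hF G hG)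
  calc ‖∑ Q ∈ G, S.indicator (H.shiftTermLp r s α f hμ) Q‖
      = ‖∑ Q ∈ G with Q ∈ S, H.shiftTermLp r s α f hμ Q‖ := by
        simp only [Set.indicator_apply, Finset.sum_filter]
    _ ≤ ‖T‖ * √(H.haarEnergy r f {Q ∈ G | Q ∈ S}) := hT.norm_sum_shiftTermLp_le hμ f _
    _ ≤ ‖T‖ * (ε / (‖T‖ + 1)) := by
        gcongr
        exact Real.sqrt_le_iff.2 ⟨by positivity, hG'.le⟩
    _ < ε := by
        rw [mul_div_left_comm]
        exact mul_lt_of_lt_one_right hε ((div_lt_one (by positivity)).2 (lt_add_one _))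

theorem integrableOn_coeFn_Lp (hμ : D.IsNondegenerate μ) (g : Lp ℝ 2 μ) (P : CubeIndex n) :
    IntegrableOn g (D.cube P) μ :=
  have := isFiniteMeasure_restrict_cube hμ P
  ((Lp.memLp g).mono_measure Measure.restrict_le_self).integrable one_le_two

theorem integrableOn_sum_shiftTerm (hμ : D.IsNondegenerate μ) (f : (Fin n → ℝ) → ℝ)
    (F : Finset (CubeIndex n)) (P : CubeIndex n) :
    IntegrableOn (fun x => ∑ Q ∈ F, H.shiftTerm r s α f Q x) (D.cube P) μ :=
  (H.integrable_sum_shiftTerm hμ f F).integrableOn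

theorem IsShiftOnL2.exists_tendstoSubMean_two (hT : H.IsShiftOnL2 r s α T)
    (hμ : D.IsNondegenerate μ) {P : CubeIndex n} {K : ℝ}
    (hK : ∀ G : Finset (CubeIndex n),
      (∀ Q ∈ G, P.1 ≤ Q.1 + s ∧ ¬ Disjoint (D.cube Q) (D.cube P)) → H.haarEnergy r f G ≤ K) :
    ∃ g : Lp ℝ 2 μ, D.TendstoSubMean μ atTop 2
      (fun (F : Finset _) x => ∑ Q ∈ F, H.shiftTerm r s α f Q x) g P := by
  classical
  obtain ⟨g, hg⟩ := hT.summable_indicator_shiftTermLp hμ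
    (S := {Q | P.1 ≤ Q.1 + s ∧ ¬ Disjoint (D.cube Q) (D.cube P)}) hK
  rw [HasSum, SummationFilter.unconditional_filter, Lp.tendsto_Lp_iff_tendsto_eLpNorm'] at hg
  refine ⟨g, .of_tendsto_sub_const hμ one_le_two
    (fun F => integrableOn_sum_shiftTerm hμ f F P) (integrableOn_coeFn_Lp hμ g P)
    (fun F => D.mean μ (fun x => ∑ Q ∈ F, H.shiftTerm r s α f Q x) P) ?_⟩
  refine tendsto_of_tendsto_of_tendsto_of_le_of_le tendsto_const_nhds hg (fun _ => zero_le)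
    fun F => le_of_eq_of_le (eLpNorm_congr_ae ?_)
      (eLpNorm_mono_measure _ (Measure.restrict_le_self (s := D.cube P)))
  filter_upwards [ae_restrict_of_ae (coeFn_sum_shiftTermLp hμ (F.filter fun Q =>
    P.1 ≤ Q.1 + s ∧ ¬ Disjoint (D.cube Q) (D.cube P))), ae_restrict_mem (D.measurableSet_cube P)]
    with x hx hxP
  simp only [Set.indicator_apply, Set.mem_ofPred_eq, Pi.sub_apply, ← Finset.sum_filter]
  rw [hx, H.sum_shiftTerm_sub_mean hμ f F subset_rfl hxP]

end HaarSystem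

namespace DyadicSystem

variable {n : ℕ} {D : DyadicSystem n} {μ : Measure (Fin n → ℝ)} {f : (Fin n → ℝ) → ℝ}

theorem MemLip.integrableOn (hμ : D.IsNondegenerate μ) {q a : ℝ} (hq : 1 ≤ q)
    (hf : D.MemLip μ q a f) (Q : CubeIndex n) : IntegrableOn f (D.cube Q) μ :=
  hf.1.integrableOn hμ hq Q

theorem MemLip.lipSeminorm_one_le (hμ : D.IsNondegenerate μ) {q a : ℝ} (hq : 1 ≤ q)
    (hf : D.MemLip μ q a f) : D.lipSeminorm μ 1 a f ≤ D.lipSeminorm μ q a f :=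
  lipSeminorm_mono_exponent hμ one_pos hq a (hf.integrableOn hμ hq)

theorem MemLip.lipSeminorm_one_ne_top (hμ : D.IsNondegenerate μ) {q a : ℝ} (hq : 1 ≤ q)
    (hf : D.MemLip μ q a f) : D.lipSeminorm μ 1 a f ≠ ∞ :=
  ((hf.lipSeminorm_one_le hμ hq).trans_lt hf.2).ne

end DyadicSystem

namespace HaarSystem

open DyadicSystem

variable {n : ℕ} {D : DyadicSystem n} {μ : Measure (Fin n → ℝ)} {H : HaarSystem D μ}
  {r s : ℕ} {q a : ℝ} {α : Coeff n} {T : Lp ℝ 2 μ →L[ℝ] Lp ℝ 2 μ}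

theorem IsShiftOnL2.exists_forall_lipSeminorm_sum_shiftTerm_le (hT : H.IsShiftOnL2 r s α T)
    (hbal : H.Balanced) (hn : 1 ≤ n) (hμ : D.IsNondegenerate μ) (ha : 0 ≤ a) (hq : 1 ≤ q)
    {f : (Fin n → ℝ) → ℝ} (hf : D.MemLip μ q a f) {p : ℝ} (hp : 0 < p) :
    ∃ L : ℝ≥0∞, L ≠ ∞ ∧ ∀ F : Finset (CubeIndex n),
      D.lipSeminorm μ p a (fun x => ∑ Q ∈ F, H.shiftTerm r s α f Q x) ≤ L := by
  obtain ⟨C, hC⟩ := hbal.exists_lipSeminorm_sum_shiftTerm_le hn hμ ha r s hp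
  have hL := hf.lipSeminorm_one_ne_top hμ hq
  exact ⟨_, ENNReal.mul_ne_top (ENNReal.mul_ne_top ENNReal.coe_ne_top enorm_ne_top) hL,
    hC α T hT f (hf.integrableOn hμ hq) hL⟩

theorem IsShiftOnL2.isShiftImage_coeFn (hT : H.IsShiftOnL2 r s α T)
    (hbal : H.Balanced) (hn : 1 ≤ n) (hμ : D.IsNondegenerate μ) (ha : 0 ≤ a) (hq : 1 ≤ q)
    {f : Lp ℝ 2 μ} (hf : D.MemLip μ q a f) : H.IsShiftImage r s α q f (T f) := by
  have hlim : ∀ P, D.TendstoSubMean μ atTop 2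
      (fun (F : Finset _) x => ∑ Q ∈ F, H.shiftTerm r s α f Q x) (T f) P := fun P => by
    refine .of_tendsto_sub_const hμ one_le_two (fun F => integrableOn_sum_shiftTerm hμ f F P)
      (integrableOn_coeFn_Lp hμ _ P) (fun _ => 0) ?_
    simp only [sub_zero]
    exact tendsto_of_tendsto_of_tendsto_of_le_of_le tendsto_const_nhds (hT f) (fun _ => zero_le)
      fun F => eLpNorm_mono_measure _ Measure.restrict_le_self
  have h := fun P => TendstoSubMean.of_two hμ (fun F => integrableOn_sum_shiftTerm hμ f F P)
    (integrableOn_coeFn_Lp hμ _ P)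
    (fun _ => hT.exists_forall_lipSeminorm_sum_shiftTerm_le hbal hn hμ ha hq hf) (hlim P)
    (zero_lt_one.trans_le hq)
  exact (isShiftImage_iff hμ).2 ⟨fun P => (h P).1, fun P => (h P).2⟩

theorem IsShiftOnL2.exists_isShiftImage (hT : H.IsShiftOnL2 r s α T)
    (hbal : H.Balanced) (hn : 1 ≤ n) (hμ : D.IsNondegenerate μ) (ha : 0 ≤ a) (hq : 1 ≤ q)
    {f : (Fin n → ℝ) → ℝ} (hf : D.MemLip μ q a f) : ∃ g, H.IsShiftImage r s α q f g := by
  have h_int := hf.integrableOn hμ hq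
  obtain ⟨K, hK⟩ := exists_lipSeminorm_le_mul_lipSeminorm_one hμ two_pos ha
  have hL : D.lipSeminorm μ 2 a f ≠ ∞ := ne_top_of_le_ne_top
    (ENNReal.mul_ne_top ENNReal.coe_ne_top (hf.lipSeminorm_one_ne_top hμ hq)) (hK f h_int)
  obtain ⟨N, -, hN⟩ := hbal.exists_haarEnergy_le hn hμ ha r s
  obtain ⟨g, hg⟩ := exists_forall_tendstoSubMean (e := ENNReal.ofReal q) (l := atTop) hμ
    (by simpa using ENNReal.ofReal_le_ofReal hq) (integrableOn_sum_shiftTerm hμ f) fun P => by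
      obtain ⟨g, hg⟩ := hT.exists_tendstoSubMean_two hμ fun G hG =>
        hN f h_int hL P G fun Q hQ => ⟨by have := (hG Q hQ).1; omega, (hG Q hQ).2⟩
      exact ⟨g, hg.of_two hμ (fun F => integrableOn_sum_shiftTerm hμ f F P)
        (integrableOn_coeFn_Lp hμ g P)
        (fun _ => hT.exists_forall_lipSeminorm_sum_shiftTerm_le hbal hn hμ ha hq hf)
        (zero_lt_one.trans_le hq)⟩
  exact ⟨g, (isShiftImage_iff hμ).2 ⟨fun P => (hg P).1, fun P => (hg P).2⟩⟩

theorem Balanced.exists_lipSeminorm_isShiftImage_le (hbal : H.Balanced) (hn : 1 ≤ n)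
    (hμ : D.IsNondegenerate μ) (ha : 0 ≤ a) (r s : ℕ) (hq : 1 ≤ q) :
    ∃ C : ℝ≥0, ∀ (α : Coeff n) (T : Lp ℝ 2 μ →L[ℝ] Lp ℝ 2 μ), H.IsShiftOnL2 r s α T →
      ∀ f : (Fin n → ℝ) → ℝ, D.MemLip μ q a f → ∀ g, H.IsShiftImage r s α q f g →
        D.lipSeminorm μ q a g ≤ C * ‖T‖ₑ * D.lipSeminorm μ q a f := by
  have hq0 := zero_lt_one.trans_le hq
  obtain ⟨C, hC⟩ := hbal.exists_lipSeminorm_sum_shiftTerm_le hn hμ ha r s hq0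
  refine ⟨C, fun α T hT f hf g hg => ?_⟩
  obtain ⟨hgloc, hlim⟩ := (isShiftImage_iff hμ).1 hg
  refine lipSeminorm_le_of_tendstoSubMean hμ (ENNReal.ofReal_pos.2 hq0).ne' hq0
    (integrableOn_sum_shiftTerm hμ f) (hgloc.integrableOn hμ hq) hlim fun F => ?_
  refine (hC α T hT f (hf.integrableOn hμ hq) (hf.lipSeminorm_one_ne_top hμ hq) F).trans ?_
  gcongr
  exact hf.lipSeminorm_one_le hμ hq

end HaarSystem

theorem theoremB_general {n : ℕ} (hn : 1 ≤ n) (D : DyadicSystem n) (μ : Measure (Fin n → ℝ))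
    (hμ : ∀ Q : CubeIndex n, 0 < μ (D.cube Q) ∧ μ (D.cube Q) < ∞)
    (H : HaarSystem D μ) (hbal : H.Balanced)
    (r s : ℕ) (q a : ℝ) (hq : 1 ≤ q) (ha : 0 ≤ a) :
    ∃ C : ℝ≥0, ∀ (α : HaarSystem.Coeff n) (T : Lp ℝ 2 μ →L[ℝ] Lp ℝ 2 μ),
      H.IsShiftOnL2 r s α T →
        (∀ f : Lp ℝ 2 μ, D.MemLip μ q a f → H.IsShiftImage r s α q f (T f)) ∧
        ∀ f : (Fin n → ℝ) → ℝ, D.MemLip μ q a f →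
          (∃ g, H.IsShiftImage r s α q f g) ∧
          ∀ g, H.IsShiftImage r s α q f g →
            D.MemLip μ q a g ∧
              D.lipSeminorm μ q a g ≤ C * ‖T‖ₑ * D.lipSeminorm μ q a f := by
  obtain ⟨C, hC⟩ := hbal.exists_lipSeminorm_isShiftImage_le hn hμ ha r s hq
  refine ⟨C, fun α T hT => ⟨fun f hf => hT.isShiftImage_coeFn hbal hn hμ ha hq hf,
    fun f hf => ⟨hT.exists_isShiftImage hbal hn hμ ha hq hf, fun g hg => ?_⟩⟩⟩
  have hle := hC α T hT f hf g hg
  exact ⟨⟨hg.1, hle.trans_lt (ENNReal.mul_lt_top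
    (ENNReal.mul_lt_top ENNReal.coe_lt_top enorm_lt_top) hf.2)⟩, hle⟩

theorem theoremB {n : ℕ} (hn : 1 ≤ n) (D : DyadicSystem n) (μ : Measure (Fin n → ℝ))
    (hμ : ∀ Q : CubeIndex n, 0 < μ (D.cube Q) ∧ μ (D.cube Q) < ∞)
    (H : HaarSystem D μ) (hbal : H.Balanced)
    (r s : ℕ) (q a : ℝ) (hq : 1 < q) (ha : 0 < a) :
    ∃ C : ℝ≥0, ∀ (α : HaarSystem.Coeff n) (T : Lp ℝ 2 μ →L[ℝ] Lp ℝ 2 μ),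
      H.IsShiftOnL2 r s α T →
        -- on `L² ∩ Λ_q(a)`, the image defined through local convergence is the original `T f`
        (∀ f : Lp ℝ 2 μ, D.MemLip μ q a f → H.IsShiftImage r s α q f (T f)) ∧
        ∀ f : (Fin n → ℝ) → ℝ, D.MemLip μ q a f →
          (∃ g, H.IsShiftImage r s α q f g) ∧
          ∀ g, H.IsShiftImage r s α q f g →
            D.MemLip μ q a g ∧
              D.lipSeminorm μ q a g ≤ C * ‖T‖ₑ * D.lipSeminorm μ q a f :=
  theoremB_general hn D μ hμ H hbal r s q a hq.le ha.le
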